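/- Let $S$ be a connected smooth manifold (Hausdorff, second countable, without boundary) of dimension $m\ge 2$, with a smooth Riemannian metric $g_0$, a smooth one-form $\omega$ with $\omega_x\neq 0$ for all $x\in S$, and a smooth function $\Lambda:S\to[0,+\infty)$. Put $\mathcal D_x:=\ker\omega_x$ and let $F$ be the Randers-Kropina metric $$F(v)=\frac{g_0(v,v)}{-\omega(v)+\sqrt{\Lambda g_0(v,v)+\omega(v)^2}}$$ on the set $\mathcal A\subset TS$ consisting of all $v\in T_xS$ if $\Lambda(x)>0$, and of the $v\in T_xS$ with $\omega(v)<0$ if $\Lambda(x)=0$ (where $F(0):=0$ if $\Lambda(x)>0$). For $\varepsilon\in(0,1]$ let $F_\varepsilon$ be the Randers metric on $TS$ $$F_\varepsilon(v)=\frac{1}{\Lambda+\varepsilon}\Big(\sqrt{(\Lambda+\varepsilon)g_0(v,v)+\omega(v)^2}+\omega(v)\Big).$$ For $x,y\in S$ and $A\subset TS$ let $\Omega_{xy}(A)$ be the set of continuous piecewise smooth curves $[0,1]\to S$ from $x$ to $y$ whose one-sided derivatives all lie in $A$. A geodesic of $F$ (resp. of $F_\varepsilon$) from $x$ to $y$ is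 a critical point of the energy $E(\gamma)=\frac12\int_0^1F(\dot\gamma)^2\,ds$ on $\Omega_{xy}(\mathcal A)$ (resp. of $E_\varepsilon(\gamma)=\frac12\int_0^1F_\varepsilon(\dot\gamma)^2\,ds$ on $\Omega_{xy}(TS)$), with respect to piecewise smooth variations with fixed end points; $\ell_F(\gamma)=\int_0^1F(\dot\gamma)\,ds$ and $\ell_\varepsilon(\gamma)=\int_0^1F_\varepsilon(\dot\gamma)\,ds$ are the lengths. Let $d_\varepsilon(x,y)$ be the infimum of $\ell_\varepsilon$ on $\Omega_{xy}(TS)$, and put $B^+_\varepsilon(x,r)=\{y:d_\varepsilon(x,y)<r\}$, $B^-_\varepsilon(x,r)=\{y:d_\varepsilon(y,x)<r\}$. Assume $(\star)$ there exists $\bar\varepsilon\in(0,1]$ such that $\overline{B^+_{\bar\varepsilon}(x,r)}\cap\overline{B^-_{\bar\varepsilon}(y,s)}$ is compact for all $x,y\in S$ and $r,s>0$. Let $x_0\neq x_1$ be points of $S$ and, for each $\varepsilon\in(0,1]$, let $\sigma_\varepsilon:[0,1]\to S$ be a geodesic of $F_\varepsilon$ from $x_0$ to $x_1$, with $\sup_{\varepsilon\in(0,1]}E_\varepsilon(\sigma_\varepsilon)<+\infty$.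 Then there exist a sequence $\varepsilon_n\to0$ in $(0,1]$ and a geodesic $\sigma$ of $F$ from $x_0$ to $x_1$ such that $\sigma_{\varepsilon_n}\to\sigma$ uniformly on $[0,1]$ (with respect to the distance of $g_0$) and $\ell_{\varepsilon_n}(\sigma_{\varepsilon_n})\to\ell_F(\sigma)$. The same holds with $x_1=x_0$ if $\Lambda(x_0)\neq0$, or if $\Lambda(x_0)=0$ and $d\Lambda_{x_0}$ does not vanish identically on $\mathcal D_{x_0}$; moreover $\sigma$ can be chosen non-constant if all the $\sigma_\varepsilon$ are non-constant. -/

import Mathlib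

open Set Filter Topology Bundle
open scoped Manifold ContDiff

noncomputable section RandersKropina

/-- Smooth Riemannian metrics on the `m`-dimensional manifold `S`. -/
abbrev RMetric (m : ℕ) (S : Type*) [TopologicalSpace S]
    [ChartedSpace (EuclideanSpace ℝ (Fin m)) S] [IsManifold (𝓡 m) ∞ S] :=
  ContMDiffRiemannianMetric (𝓡 m) ∞ (EuclideanSpace ℝ (Fin m))
    (fun x : S => TangentSpace (𝓡 m) x)

/-- (Not necessarily continuous) one-forms on the `m`-dimensional manifold `S`. -/
abbrev OneForm (m : ℕ) (S : Type*) [TopologicalSpace S]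
    [ChartedSpace (EuclideanSpace ℝ (Fin m)) S] :=
  (x : S) → TangentSpace (𝓡 m) x →L[ℝ] ℝ

variable {m : ℕ} {S : Type*} [TopologicalSpace S]
  [ChartedSpace (EuclideanSpace ℝ (Fin m)) S]

/-- Smooth one-forms: smooth sections of the cotangent bundle. -/
def OneForm.IsSmooth [IsManifold (𝓡 m) ∞ S] (θ : OneForm m S) : Prop :=
  ContMDiff (𝓡 m) ((𝓡 m).prod 𝓘(ℝ, EuclideanSpace ℝ (Fin m) →L[ℝ] ℝ)) ∞
    (fun x : S => TotalSpace.mk' (EuclideanSpace ℝ (Fin m) →L[ℝ] ℝ)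
      (E := fun x : S => TangentSpace (𝓡 m) x →L[ℝ] ℝ) x (θ x))

/-! ### The metrics -/

/-- The norm `√(g₀(v,v))` of a Riemannian metric. -/
def riemannianNorm [IsManifold (𝓡 m) ∞ S] (g₀ : RMetric m S) (v : TangentBundle (𝓡 m) S) : ℝ :=
  √(g₀.inner v.1 v.2 v.2)

/-- The Randers-Kropina metric `F(v) = g₀(v,v) / (-θ(v) + √(Λ g₀(v,v) + θ(v)²))`, to be considered
on the domain `randersKropinaDomain θ Λ` only. -/
def randersKropina [IsManifold (𝓡 m) ∞ S] (g₀ : RMetric m S) (θ : OneForm m S) (Λ : S → ℝ)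
    (v : TangentBundle (𝓡 m) S) : ℝ :=
  g₀.inner v.1 v.2 v.2 /
    (-(θ v.1 v.2) + √(Λ v.1 * g₀.inner v.1 v.2 v.2 + (θ v.1 v.2) ^ 2))

/-- The domain `𝒜 ⊆ TS` of the Randers-Kropina metric: all vectors at the points where `Λ > 0`,
the vectors with `θ(v) < 0` at the points where `Λ = 0`. -/
def randersKropinaDomain (θ : OneForm m S) (Λ : S → ℝ) : Set (TangentBundle (𝓡 m) S) :=
  {v | 0 < Λ v.1 ∨ (Λ v.1 = 0 ∧ θ v.1 v.2 < 0)}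

/-- The Randers metric
`F_ε(v) = (√((Λ+ε) g₀(v,v) + θ(v)²) + θ(v)) / (Λ+ε)`, defined on all of `TS`. -/
def randers [IsManifold (𝓡 m) ∞ S] (g₀ : RMetric m S) (θ : OneForm m S) (Λ : S → ℝ) (ε : ℝ)
    (v : TangentBundle (𝓡 m) S) : ℝ :=
  1 / (Λ v.1 + ε) *
    (√((Λ v.1 + ε) * g₀.inner v.1 v.2 v.2 + (θ v.1 v.2) ^ 2) + θ v.1 v.2)

/-! ### Curves on `[0,1]`, represented by functions on `ℝ` of which only the values on `[0,1]`
matter -/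

/-- `t` is a partition `0 = t₀ < t₁ < ⋯ < t_N = 1` of `[0,1]`. -/
def IsUnitPartition {N : ℕ} (t : Fin (N + 1) → ℝ) : Prop :=
  StrictMono t ∧ t 0 = 0 ∧ t (Fin.last N) = 1

/-- Continuous, piecewise smooth curves `[0,1] → S`. -/
def IsPiecewiseSmooth (m : ℕ) {S : Type*} [TopologicalSpace S]
    [ChartedSpace (EuclideanSpace ℝ (Fin m)) S] (γ : ℝ → S) : Prop :=
  ContinuousOn γ (Icc 0 1) ∧
    ∃ (N : ℕ) (t : Fin (N + 1) → ℝ), IsUnitPartition t ∧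
      ∀ i : Fin N, ContMDiffOn 𝓘(ℝ, ℝ) (𝓡 m) ∞ γ (Icc (t i.castSucc) (t i.succ))

/-- The velocity vector of `γ` at `s`. -/
def velocity (m : ℕ) {S : Type*} [TopologicalSpace S]
    [ChartedSpace (EuclideanSpace ℝ (Fin m)) S] (γ : ℝ → S) (s : ℝ) : TangentBundle (𝓡 m) S :=
  ⟨γ s, mfderiv 𝓘(ℝ, ℝ) (𝓡 m) γ s (1 : ℝ)⟩

/-- The left derivative of `γ` at `s`. -/
def leftVelocity (m : ℕ) {S : Type*} [TopologicalSpace S]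
    [ChartedSpace (EuclideanSpace ℝ (Fin m)) S] (γ : ℝ → S) (s : ℝ) : TangentBundle (𝓡 m) S :=
  ⟨γ s, mfderivWithin 𝓘(ℝ, ℝ) (𝓡 m) γ (Iic s) s (1 : ℝ)⟩

/-- The right derivative of `γ` at `s`. -/
def rightVelocity (m : ℕ) {S : Type*} [TopologicalSpace S]
    [ChartedSpace (EuclideanSpace ℝ (Fin m)) S] (γ : ℝ → S) (s : ℝ) : TangentBundle (𝓡 m) S :=
  ⟨γ s, mfderivWithin 𝓘(ℝ, ℝ) (𝓡 m) γ (Ici s) s (1 : ℝ)⟩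

/-- The set `Ω_{xy}(A)` of continuous piecewise smooth curves from `x` to `y` all of whose one-sided
derivatives on `[0,1]` belong to `A ⊆ TS`. -/
def admissiblePaths (A : Set (TangentBundle (𝓡 m) S)) (x y : S) : Set (ℝ → S) :=
  {γ : ℝ → S | IsPiecewiseSmooth m γ ∧ γ 0 = x ∧ γ 1 = y ∧
    (∀ s ∈ Ioc (0 : ℝ) 1, leftVelocity m γ s ∈ A) ∧
    (∀ s ∈ Ico (0 : ℝ) 1, rightVelocity m γ s ∈ A)}

/-! ### Length, energy, distance, geodesics -/

/-- The length `∫₀¹ F(γ') ds`. -/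
def finslerLength (F : TangentBundle (𝓡 m) S → ℝ) (γ : ℝ → S) : ℝ :=
  ∫ s in (0 : ℝ)..1, F (velocity m γ s)

/-- The energy `(1/2) ∫₀¹ F(γ')² ds`. -/
def energy (F : TangentBundle (𝓡 m) S → ℝ) (γ : ℝ → S) : ℝ :=
  1 / 2 * ∫ s in (0 : ℝ)..1, F (velocity m γ s) ^ 2

/-- The (possibly non-symmetric) distance of a metric `F` defined on all of `TS`: the infimum of the
lengths of the continuous piecewise smooth curves from `x` to `y`. -/
def pathDist (F : TangentBundle (𝓡 m) S → ℝ) (x y : S) : ℝ :=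
  sInf (finslerLength F '' admissiblePaths (univ : Set (TangentBundle (𝓡 m) S)) x y)

/-- `H : (-δ,δ) × [0,1] → S` is a piecewise smooth variation of `γ` with fixed end points through
curves in `Ω_{xy}(A)`. -/
structure IsVariation (A : Set (TangentBundle (𝓡 m) S)) (x y : S) (γ : ℝ → S) (δ : ℝ)
    (H : ℝ → ℝ → S) : Prop where
  pos : 0 < δ
  eq_zero : ∀ s ∈ Icc (0 : ℝ) 1, H 0 s = γ s
  mem : ∀ r ∈ Ioo (-δ) δ, H r ∈ admissiblePaths A x y
  smooth : ∃ (N : ℕ) (t : Fin (N + 1) → ℝ), IsUnitPartition t ∧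
    ∀ i : Fin N, ContMDiffOn 𝓘(ℝ, ℝ × ℝ) (𝓡 m) ∞ (fun p : ℝ × ℝ => H p.1 p.2)
      (Ioo (-δ) δ ×ˢ Icc (t i.castSucc) (t i.succ))

/-- Geodesics from `x` to `y` of a metric `F` with domain `A`: the critical points of the energy
functional on `Ω_{xy}(A)`. -/
def IsFinslerGeodesic (A : Set (TangentBundle (𝓡 m) S)) (F : TangentBundle (𝓡 m) S → ℝ)
    (x y : S) (γ : ℝ → S) : Prop :=
  γ ∈ admissiblePaths A x y ∧
    ∀ (δ : ℝ) (H : ℝ → ℝ → S), IsVariation A x y γ δ H →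
      HasDerivAt (fun r => energy F (H r)) 0 0

/-- The forward ball. -/
def forwardBall (F : TangentBundle (𝓡 m) S → ℝ) (x : S) (r : ℝ) : Set S :=
  {y | pathDist F x y < r}

/-- The backward ball. -/
def backwardBall (F : TangentBundle (𝓡 m) S → ℝ) (x : S) (r : ℝ) : Set S :=
  {y | pathDist F y x < r}

/-- For some `ε ∈ (0,1]`, the intersections of the closed forward and the closed backward balls of
the Randers metric `F_ε` are compact. -/
def CompactBallsCondition [IsManifold (𝓡 m) ∞ S] (g₀ : RMetric m S) (θ : OneForm m S)
    (Λ : S → ℝ) : Prop :=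
  ∃ ε ∈ Ioc (0 : ℝ) 1, ∀ (x y : S) (r s : ℝ), 0 < r → 0 < s →
    IsCompact (closure (forwardBall (randers g₀ θ Λ ε) x r) ∩
      closure (backwardBall (randers g₀ θ Λ ε) y s))

end RandersKropina

/-!
The Randers metric `F_ε` is the Randers-Kropina metric with `Λ + ε` in place of `Λ`
(`randers_eq`), so all local computations are made for the expression of `F` with an arbitrary
coefficient `l ≥ 0` of a chart, jointly with the parameter `ε ≥ 0`.

**Duality.** On the domain of `F`, the momentum `p = ∂(F²/2)/∂v` of a vector `v ≠ 0` satisfies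
`H(x, p) = F(v)` and `v = F(v) • vel(x, p)`, with `H(x, p) = R ‖p‖ - p(θ♯)`, `R² = l + ‖θ‖²`, and
`vel = ∂H/∂p` (`Coeffs.vel_momentum`, `Coeffs.momentum_vel`). Unlike `F`, which is singular where
`l = 0` and `θ(v) = 0`, the functions `H`, `vel` and `drift = -∂H/∂x` are smooth in `(ε, x, p)` for
all `p ≠ 0`, up to and including `ε = 0`, because `θ` has no zeros. A solution of the
Euler-Lagrange equation of speed `c` is, after multiplying the momentum by a constant, a solution of
`x' = c vel(x, q)`, `q' = c drift(x, q)` with `‖q‖` close to `1` on short intervals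
(`Coeffs.exists_normalized`).

**Geodesics.** The energy is differentiable along variations (`hasDerivAt_energy_of_isVariation`).
Variations supported in a chart and the lemma of du Bois-Reymond show that the geodesics of `F_ε`
solve the Euler-Lagrange equation with constant speed `c ε`
(`exists_eulerLagrange_of_isFinslerGeodesic`, `exists_speed`). Conversely, a curve which is locally a
solution in the domain of `F` is a geodesic: the derivative of the energy is the integral of the
derivative of the pairing of momentum and variation field, which vanishes at the end points
(`IsExtremalCurve.isFinslerGeodesic`).

**The limit.** The energies bound the speeds `c ε`, and since `F_ε` decreases in `ε`, the curves
`σ ε` stay in an intersection of closed balls of one fixed Randers metric, hence in a compact set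
(`exists_isCompact`). Along an ultrafilter converging to `0⁺`, the `σ ε s` converge to some `τ s`,
and the `c ε` to some `c₀`. In a chart, where the curves are confined for short times
(`SolvesEulerLagrange.mem_chart`), the normalized momenta converge too, and the limit solves the
Hamiltonian equation for `ε = 0` (`Coeffs.exists_limit`).

The Hamiltonian of the limit is locally constant. If it is positive, `τ` solves the Euler-Lagrange
equation of `F` with speed `c₀`. If it vanishes, then so do `l` and `vel`, and `τ` is constant at a
zero of `Λ`. For `c₀ > 0` the two cases cannot meet, so that one of them holds on all of `[0,1]`;
the second is impossible if `x₀ ≠ x₁` or `Λ(x₀) > 0`. If the curves `σ ε` are not constant, the limit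
speed `c₀` is indeed positive: otherwise `τ` is constant, and `(σ ε - x₀) / c ε` converges, in a
chart at `x₀ = x₁`, to a line `s ↦ s w` with `w = 0` since the curves close up, whereas
`w = vel(x₀, q) ≠ 0` as `Λ(x₀) > 0` (`IsLimitCurve.speed_pos`). This proves
`IsLimitCurve.isExtremalCurve`.

A function `Λ ≥ 0` is critical at its zeros, so the condition that `dΛ` does not vanish on `ker θ`
at a zero of `Λ` is never met, and loops only have to be considered at points with `Λ > 0`.
-/


noncomputable section

namespace RandersKropina

/-! ### The Randers-Kropina function of three real variables -/

/-- The Randers-Kropina metric as a function of `l = Λ`, `G = g₀(v,v)` and `t = θ(v)`. -/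
def rkFun (l G t : ℝ) : ℝ := G / (-t + √(l * G + t ^ 2))

lemma rkFun_zero (l t : ℝ) : rkFun l 0 t = 0 := by simp [rkFun]

lemma rkFun_disc_pos {l G t : ℝ} (hl : 0 ≤ l) (hG : 0 < G) (h : 0 < l ∨ t < 0) :
    0 < l * G + t ^ 2 := by
  rcases h with h | h
  · positivity
  · have : 0 < t ^ 2 := sq_pos_of_neg h
    positivity

lemma rkFun_denom_pos {l G t : ℝ} (hG : 0 < G) (h : 0 < l ∨ t < 0) :
    0 < -t + √(l * G + t ^ 2) := by
  rcases h with h | h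
  · have : |t| < √(l * G + t ^ 2) := by
      rw [← Real.sqrt_sq_eq_abs]
      exact Real.sqrt_lt_sqrt (sq_nonneg t) (by nlinarith [mul_pos h hG])
    linarith [le_abs_self t]
  · have := Real.sqrt_nonneg (l * G + t ^ 2)
    linarith

lemma rkFun_pos {l G t : ℝ} (hG : 0 < G) (h : 0 < l ∨ t < 0) :
    0 < rkFun l G t := div_pos hG (rkFun_denom_pos hG h)

/-- `τ = rkFun l G t` is the root of `G + 2 t τ - l τ² = 0` with `√(l G + t²) = l τ - t`. -/
lemma sqrt_eq_rkFun {l G t : ℝ} (hl : 0 ≤ l) (hG : 0 < G) (h : 0 < l ∨ t < 0) :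
    √(l * G + t ^ 2) = l * rkFun l G t - t := by
  have hD := rkFun_denom_pos hG h
  have h2 : √(l * G + t ^ 2) ^ 2 = l * G + t ^ 2 := Real.sq_sqrt (rkFun_disc_pos hl hG h).le
  rw [rkFun]
  field_simp
  linear_combination h2

lemma rkFun_quadratic {l G t : ℝ} (hl : 0 ≤ l) (hG : 0 < G) (h : 0 < l ∨ t < 0) :
    G + 2 * t * rkFun l G t - l * rkFun l G t ^ 2 = 0 := by
  have hD := rkFun_denom_pos hG h
  have h1 := sqrt_eq_rkFun hl hG h
  have h2 : rkFun l G t * (-t + √(l * G + t ^ 2)) = G := div_mul_cancel₀ _ hD.ne'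
  rw [h1] at h2
  linear_combination -h2

lemma rkFun_eq_of_quadratic {l G t c : ℝ} (hG : 0 < G) (hP : 0 ≤ l * c - t)
    (h : G + 2 * t * c - l * c ^ 2 = 0) : rkFun l G t = c := by
  have h1 : √(l * G + t ^ 2) = l * c - t := by
    rw [← Real.sqrt_sq hP]
    congr 1
    linear_combination l * h
  have h2 : G = c * (l * c - 2 * t) := by linear_combination h
  have h3 : l * c - 2 * t ≠ 0 := fun h' => by rw [h', mul_zero] at h2; exact hG.ne' h2
  rw [rkFun, h1, div_eq_iff (by convert! h3 using 1; ring)]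
  linear_combination h2

lemma rkFun_eq_randers {l G t : ℝ} (hl : 0 < l) (hG : 0 ≤ G) (h0 : G = 0 → t = 0) :
    1 / l * (√(l * G + t ^ 2) + t) = rkFun l G t := by
  rcases hG.eq_or_lt with h | h
  · simp [← h, h0 h.symm, rkFun_zero]
  · rw [sqrt_eq_rkFun hl.le h (Or.inl hl)]
    field_simp
    ring

lemma rkFun_nonneg {l G t : ℝ} (hl : 0 ≤ l) (hG : 0 ≤ G) : 0 ≤ rkFun l G t := by
  refine div_nonneg hG ?_
  have : |t| ≤ √(l * G + t ^ 2) := by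
    rw [← Real.sqrt_sq_eq_abs]
    exact Real.sqrt_le_sqrt (by nlinarith [mul_nonneg hl hG])
  linarith [le_abs_self t]

/-- The Randers-Kropina function decreases with `Λ`. -/
lemma rkFun_anti {l l' G t : ℝ} (hl : 0 < l) (hll : l ≤ l') (hG : 0 ≤ G) :
    rkFun l' G t ≤ rkFun l G t := by
  rcases hG.eq_or_lt with h | h
  · simp [← h, rkFun_zero]
  · refine div_le_div_of_nonneg_left hG (rkFun_denom_pos h (Or.inl hl)) ?_
    have : √(l * G + t ^ 2) ≤ √(l' * G + t ^ 2) := Real.sqrt_le_sqrt (by gcongr)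
    linarith

lemma rkFun_sq_le {l G t : ℝ} (hl : 0 < l) (hG : 0 ≤ G) :
    rkFun l G t ^ 2 ≤ 4 * (l * G + t ^ 2) / l ^ 2 := by
  rcases hG.eq_or_lt with h | h
  · rw [← h, rkFun_zero, mul_zero, zero_add, zero_pow two_ne_zero]; positivity
  · have h1 := sqrt_eq_rkFun (t := t) hl.le h (Or.inl hl)
    have h2 : √(l * G + t ^ 2) ^ 2 = l * G + t ^ 2 :=
      Real.sq_sqrt (rkFun_disc_pos hl.le h (Or.inl hl)).le
    have h3 : |t| ≤ √(l * G + t ^ 2) := by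
      rw [← Real.sqrt_sq_eq_abs]
      exact Real.sqrt_le_sqrt (by nlinarith [mul_nonneg hl.le hG])
    have h4 := abs_le.1 h3
    rw [le_div_iff₀ (by positivity), ← h2]
    have h5 : 0 ≤ l * rkFun l G t := mul_nonneg hl.le (rkFun_nonneg hl.le hG)
    have h6 : l * rkFun l G t ≤ 2 * √(l * G + t ^ 2) := by linarith
    nlinarith

/-- `rkFun / √(l G + t²) ≤ 2 / l`. -/
lemma rkFun_div_sqrt_le {l G t : ℝ} (hl : 0 < l) (hG : 0 ≤ G) :
    rkFun l G t / √(l * G + t ^ 2) ≤ 2 / l := by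
  rcases hG.eq_or_lt with h | h
  · rw [← h, rkFun_zero, zero_div]; positivity
  · have h1 := sqrt_eq_rkFun (t := t) hl.le h (Or.inl hl)
    have h3 : |t| ≤ √(l * G + t ^ 2) := by
      rw [← Real.sqrt_sq_eq_abs]
      exact Real.sqrt_le_sqrt (by nlinarith [mul_nonneg hl.le hG])
    have h4 := abs_le.1 h3
    have h5 : 0 < √(l * G + t ^ 2) := Real.sqrt_pos.2 (rkFun_disc_pos hl.le h (Or.inl hl))
    rw [div_le_div_iff₀ h5 hl]
    linarith

/-- The derivative of `F²/2`, as it results from differentiating `l F² - 2 t F - G = 0`. -/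
lemma hasFDerivAt_rkFun_sq {Z : Type*} [NormedAddCommGroup Z] [NormedSpace ℝ Z]
    {l G t : Z → ℝ} {l' G' t' : Z →L[ℝ] ℝ} {z : Z} (hl : HasFDerivAt l l' z)
    (hG : HasFDerivAt G G' z) (ht : HasFDerivAt t t' z) (hl0 : 0 ≤ l z) (hG0 : 0 < G z)
    (h : 0 < l z ∨ t z < 0) :
    HasFDerivAt (fun z => 1 / 2 * rkFun (l z) (G z) (t z) ^ 2)
      ((rkFun (l z) (G z) (t z) / √(l z * G z + t z ^ 2) / 2) •
        (G' + (2 * rkFun (l z) (G z) (t z)) • t' - (rkFun (l z) (G z) (t z) ^ 2) • l')) z := by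
  have hd := rkFun_disc_pos hl0 hG0 h
  have hD := rkFun_denom_pos hG0 h
  have hΦ := rkFun_pos hG0 h
  have h1 := sqrt_eq_rkFun hl0 hG0 h
  have hP : 0 < √(l z * G z + t z ^ 2) := Real.sqrt_pos.2 hd
  have hq := rkFun_quadratic hl0 hG0 h
  have e1 := ((hl.mul hG).add (ht.pow 2)).sqrt (x := z) hd.ne'
  have e2 := hG.mul ((hasDerivAt_inv hD.ne').comp_hasFDerivAt z (ht.neg.add e1))
  have e3 := (e2.pow 2).const_mul (1 / 2)
  refine (e3.congr_fderiv ?_).congr_of_eventuallyEq (Eventually.of_forall fun y => ?_)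
  · ext w
    have h2 : rkFun (l z) (G z) (t z) * (-t z + √(l z * G z + t z ^ 2)) = G z :=
      div_mul_cancel₀ _ hD.ne'
    simp only [Pi.mul_apply, Pi.add_apply, Pi.neg_apply, Function.comp_apply,
      smul_apply, add_apply, sub_apply,
      neg_apply, smul_eq_mul, nsmul_eq_mul]
    generalize √(l z * G z + t z ^ 2) = P at *
    generalize rkFun (l z) (G z) (t z) = Φ at *
    -- all quantities are rational in `Φ`, `P` and `D = P - t`
    obtain ⟨D, hDt⟩ : ∃ D, D = -t z + P := ⟨_, rfl⟩
    have e5 : t z = P - D := by linarith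
    have e6 : l z = (2 * P - D) / Φ := by rw [eq_div_iff hΦ.ne']; linarith
    rw [← hDt] at hD h2 ⊢
    rw [e5, e6, ← h2]
    field_simp
    ring
  · simp [rkFun, div_eq_mul_inv]

/-! ### Randers-Kropina norms on a vector space and their Legendre transform -/

section Pointwise

variable {E : Type*} [NormedAddCommGroup E] [NormedSpace ℝ E]

/-- A continuous bilinear form is a scalar product. -/
structure IsInner (g : E →L[ℝ] E →L[ℝ] ℝ) : Prop where
  symm : ∀ u v, g u v = g v u
  pos : ∀ v, v ≠ 0 → 0 < g v v

/-- The identification of covectors with vectors by the scalar product `g`. -/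
def sharp (g : E →L[ℝ] E →L[ℝ] ℝ) : (E →L[ℝ] ℝ) →L[ℝ] E := ContinuousLinearMap.inverse g

/-- The Randers-Kropina norm of `v`. -/
def speed (g : E →L[ℝ] E →L[ℝ] ℝ) (θ : E →L[ℝ] ℝ) (l : ℝ) (v : E) : ℝ := rkFun l (g v v) (θ v)

/-- The square root in the definition of the Randers-Kropina norm. -/
def root (g : E →L[ℝ] E →L[ℝ] ℝ) (θ : E →L[ℝ] ℝ) (l : ℝ) (v : E) : ℝ :=
  √(l * g v v + θ v ^ 2)

/-- The Legendre transform `v ↦ d(F²/2)(v)` of the Randers-Kropina norm. -/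
def mom (g : E →L[ℝ] E →L[ℝ] ℝ) (θ : E →L[ℝ] ℝ) (l : ℝ) (v : E) : E →L[ℝ] ℝ :=
  (speed g θ l v / root g θ l v) • (g v + speed g θ l v • θ)

/-- The norm of a covector dual to the norm of `g`. -/
def conorm (g : E →L[ℝ] E →L[ℝ] ℝ) (p : E →L[ℝ] ℝ) : ℝ := √(p (sharp g p))

/-- The unit sphere of the Randers-Kropina norm is the `g`-sphere of this radius
centred at `- sharp θ`. -/
def radius (g : E →L[ℝ] E →L[ℝ] ℝ) (θ : E →L[ℝ] ℝ) (l : ℝ) : ℝ := √(l + θ (sharp g θ))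

/-- The point of the unit sphere of the Randers-Kropina norm with conormal `p`, that is the
differential in `p` of the dual function `ham`. -/
def dir (g : E →L[ℝ] E →L[ℝ] ℝ) (θ : E →L[ℝ] ℝ) (l : ℝ) (p : E →L[ℝ] ℝ) : E :=
  (radius g θ l / conorm g p) • sharp g p - sharp g θ

/-- The support function of the unit ball of the Randers-Kropina norm. In contrast to the norm, it
does not degenerate where `l = 0`. -/
def ham (g : E →L[ℝ] E →L[ℝ] ℝ) (θ : E →L[ℝ] ℝ) (l : ℝ) (p : E →L[ℝ] ℝ) : ℝ :=
  radius g θ l * conorm g p - p (sharp g θ)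

variable {g : E →L[ℝ] E →L[ℝ] ℝ} {θ p : E →L[ℝ] ℝ} {l c : ℝ} {v : E}

lemma IsInner.nonneg (hg : IsInner g) (v : E) : 0 ≤ g v v := by
  rcases eq_or_ne v 0 with rfl | h
  · simp
  · exact (hg.pos v h).le

lemma speed_zero : speed g θ l 0 = 0 := by simp [speed, rkFun_zero]

lemma mom_zero : mom g θ l 0 = 0 := by simp [mom, speed_zero]

lemma speed_nonneg (hg : IsInner g) (hl : 0 ≤ l) (v : E) : 0 ≤ speed g θ l v :=
  rkFun_nonneg hl (hg.nonneg v)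

lemma speed_pos (hg : IsInner g) (hv : v ≠ 0) (h : 0 < l ∨ θ v < 0) :
    0 < speed g θ l v := rkFun_pos (hg.pos v hv) h

lemma root_pos (hg : IsInner g) (hl : 0 ≤ l) (hv : v ≠ 0) (h : 0 < l ∨ θ v < 0) :
    0 < root g θ l v := Real.sqrt_pos.2 (rkFun_disc_pos hl (hg.pos v hv) h)

lemma root_eq (hg : IsInner g) (hl : 0 ≤ l) (hv : v ≠ 0) (h : 0 < l ∨ θ v < 0) :
    root g θ l v = l * speed g θ l v - θ v := sqrt_eq_rkFun hl (hg.pos v hv) h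

lemma speed_quadratic (hg : IsInner g) (hl : 0 ≤ l) (hv : v ≠ 0) (h : 0 < l ∨ θ v < 0) :
    g v v + 2 * θ v * speed g θ l v - l * speed g θ l v ^ 2 = 0 :=
  rkFun_quadratic hl (hg.pos v hv) h

/-- Euler's identity for the `2`-homogeneous function `F²/2`. -/
lemma mom_apply_self (hg : IsInner g) (hl : 0 ≤ l) (h : 0 < l ∨ θ v < 0) :
    mom g θ l v v = speed g θ l v ^ 2 := by
  rcases eq_or_ne v 0 with rfl | hv
  · simp [speed_zero]
  · have h1 := speed_quadratic hg hl hv h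
    have h2 := root_eq hg hl hv h
    have h3 := root_pos hg hl hv h
    simp only [mom, smul_apply, add_apply, smul_eq_mul]
    rw [div_mul_eq_mul_div, div_eq_iff h3.ne', h2]
    linear_combination speed g θ l v * h1

lemma ham_zero : ham g θ l 0 = 0 := by simp [ham, conorm]

lemma mom_ne_zero (hg : IsInner g) (hl : 0 ≤ l) (hv : v ≠ 0) (h : 0 < l ∨ θ v < 0) :
    mom g θ l v ≠ 0 := by
  intro h0
  have h1 := mom_apply_self hg hl h
  rw [h0, zero_apply] at h1
  exact (pow_pos (speed_pos hg hv h) 2).ne h1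

variable [FiniteDimensional ℝ E]

lemma IsInner.isInvertible (hg : IsInner g) : g.IsInvertible := by
  have hinj : Function.Injective (g : E →ₗ[ℝ] E →L[ℝ] ℝ) := by
    rw [injective_iff_map_eq_zero]
    intro v hv
    by_contra h
    have h1 := hg.pos v h
    have h2 : g v = 0 := hv
    simp [h2] at h1
  have hdim : Module.finrank ℝ E = Module.finrank ℝ (E →L[ℝ] ℝ) := by
    rw [← LinearMap.toContinuousLinearMap.finrank_eq]
    exact Subspace.dual_finrank_eq.symm
  exact ⟨(LinearEquiv.ofInjectiveOfFinrankEq _ hinj hdim).toContinuousLinearEquiv, by ext; rfl⟩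

lemma IsInner.apply_sharp (hg : IsInner g) (p : E →L[ℝ] ℝ) : g (sharp g p) = p :=
  hg.isInvertible.self_apply_inverse p

lemma IsInner.sharp_apply (hg : IsInner g) (v : E) : sharp g (g v) = v :=
  hg.isInvertible.inverse_apply_self v

lemma IsInner.sharp_comm (hg : IsInner g) (p q : E →L[ℝ] ℝ) : p (sharp g q) = q (sharp g p) := by
  rw [← hg.apply_sharp p, hg.sharp_apply, hg.symm, hg.apply_sharp]

lemma IsInner.apply_sharp_nonneg (hg : IsInner g) (p : E →L[ℝ] ℝ) : 0 ≤ p (sharp g p) := by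
  have := hg.nonneg (sharp g p)
  rwa [hg.apply_sharp] at this

lemma IsInner.sharp_ne (hg : IsInner g) (hp : p ≠ 0) : sharp g p ≠ 0 := fun h => hp <| by
  rw [← hg.apply_sharp p, h, map_zero]

lemma IsInner.apply_sharp_pos (hg : IsInner g) (hp : p ≠ 0) : 0 < p (sharp g p) := by
  have := hg.pos (sharp g p) (hg.sharp_ne hp)
  rwa [hg.apply_sharp] at this

lemma conorm_pos (hg : IsInner g) (hp : p ≠ 0) : 0 < conorm g p :=
  Real.sqrt_pos.2 (hg.apply_sharp_pos hp)

lemma conorm_sq (hg : IsInner g) (p : E →L[ℝ] ℝ) : conorm g p ^ 2 = p (sharp g p) :=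
  Real.sq_sqrt (hg.apply_sharp_nonneg p)

lemma radius_pos (hg : IsInner g) (hl : 0 ≤ l) (hθ : θ ≠ 0) : 0 < radius g θ l :=
  Real.sqrt_pos.2 (add_pos_of_nonneg_of_pos hl (hg.apply_sharp_pos hθ))

lemma radius_sq (hg : IsInner g) (hl : 0 ≤ l) (θ : E →L[ℝ] ℝ) :
    radius g θ l ^ 2 = l + θ (sharp g θ) :=
  Real.sq_sqrt (add_nonneg hl (hg.apply_sharp_nonneg θ))

lemma apply_dir (hg : IsInner g) (p : E →L[ℝ] ℝ) :
    g (dir g θ l p) = (radius g θ l / conorm g p) • p - θ := by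
  simp [dir, hg.apply_sharp]

/-- `dir p` lies on the unit sphere of the Randers-Kropina norm. -/
lemma dir_quadratic (hg : IsInner g) (hl : 0 ≤ l) (hp : p ≠ 0) :
    g (dir g θ l p) (dir g θ l p) + 2 * θ (dir g θ l p) - l = 0 := by
  have h1 := conorm_pos hg hp
  have h2 := conorm_sq hg p
  have h3 := radius_sq hg hl θ
  have h4 := hg.sharp_comm θ p
  rw [apply_dir hg]
  simp only [dir, map_sub, map_smul, smul_eq_mul, sub_apply, smul_apply, h4]
  rw [← h2]
  field_simp
  linear_combination (conorm g p) * h3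

/-- The square root in the definition of `speed` takes, at `dir p`, the value `l - θ (dir p)`, since
`dir p` lies on the indicatrix when `H > 0`; this expresses it through `p`. -/
lemma conorm_mul_root_dir (hg : IsInner g) (hl : 0 ≤ l) (hp : p ≠ 0) :
    conorm g p * (l - θ (dir g θ l p)) = radius g θ l * ham g θ l p := by
  have h1 := conorm_pos hg hp
  have h3 := radius_sq hg hl θ
  have h4 := hg.sharp_comm θ p
  simp only [dir, ham, map_sub, map_smul, smul_eq_mul, h4]
  field_simp
  linear_combination (-conorm g p) * h3

lemma ham_nonneg (hg : IsInner g) (hl : 0 ≤ l) (p : E →L[ℝ] ℝ) : 0 ≤ ham g θ l p := by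
  -- the Cauchy-Schwarz inequality for the dual scalar product
  have hCS : p (sharp g θ) ≤ conorm g p * √(θ (sharp g θ)) := by
    rcases eq_or_ne p 0 with rfl | hp
    · simp [conorm]
    rcases eq_or_ne θ 0 with rfl | hθ
    · simp
    have ha := conorm_pos hg hp
    have hb : 0 < √(θ (sharp g θ)) := Real.sqrt_pos.2 (hg.apply_sharp_pos hθ)
    have hb2 : √(θ (sharp g θ)) ^ 2 = θ (sharp g θ) := Real.sq_sqrt (hg.apply_sharp_nonneg θ)
    have ha2 := conorm_sq hg p
    have h4 := hg.sharp_comm θ p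
    have h := hg.apply_sharp_nonneg (√(θ (sharp g θ)) • p - conorm g p • θ)
    simp only [map_sub, map_smul, sub_apply, smul_apply, smul_eq_mul, h4] at h
    rw [← ha2, ← hb2, Real.sqrt_sq hb.le] at h
    have : 0 ≤ 2 * (conorm g p * √(θ (sharp g θ))) *
      (conorm g p * √(θ (sharp g θ)) - p (sharp g θ)) := by linarith
    have := nonneg_of_mul_nonneg_right this (by positivity)
    linarith
  have hR : √(θ (sharp g θ)) ≤ radius g θ l := Real.sqrt_le_sqrt (by linarith)
  have : 0 ≤ conorm g p := Real.sqrt_nonneg _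
  rw [ham]
  nlinarith

/-- If `ham p = 0`, then `dir p = 0`: this happens only where `l = 0`. -/
lemma dir_eq_zero_of_ham_eq_zero (hg : IsInner g) (hl : 0 ≤ l) (hp : p ≠ 0)
    (h : ham g θ l p = 0) : dir g θ l p = 0 ∧ l = 0 := by
  have h1 := conorm_mul_root_dir (θ := θ) hg hl hp
  rw [h, mul_zero] at h1
  have h2 : l - θ (dir g θ l p) = 0 :=
    (mul_eq_zero.1 h1).resolve_left (conorm_pos hg hp).ne'
  have h3 := dir_quadratic (θ := θ) hg hl hp
  have h4 := hg.nonneg (dir g θ l p)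
  have h5 : l = 0 := by linarith
  refine ⟨?_, h5⟩
  by_contra h6
  have := hg.pos _ h6
  linarith

lemma ham_pos (hg : IsInner g) (hl : 0 < l) (hp : p ≠ 0) : 0 < ham g θ l p := by
  refine (ham_nonneg hg hl.le p).lt_of_ne' fun h => ?_
  exact hl.ne' (dir_eq_zero_of_ham_eq_zero hg hl.le hp h).2

lemma dir_ne_zero (hg : IsInner g) (hl : 0 < l) (hp : p ≠ 0) : dir g θ l p ≠ 0 := by
  intro h0
  have h1 := dir_quadratic (θ := θ) hg hl.le hp
  simp only [h0, map_zero, mul_zero, add_zero, zero_sub, neg_eq_zero] at h1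
  exact hl.ne' h1

lemma dir_mem (hg : IsInner g) (hl : 0 ≤ l) (hp : p ≠ 0) (hθ : θ ≠ 0) (hh : 0 < ham g θ l p) :
    0 < l ∨ θ (dir g θ l p) < 0 := by
  rcases hl.eq_or_lt with h | h
  · right
    have h2 := conorm_mul_root_dir (θ := θ) hg hl hp
    rw [← h, zero_sub] at h2
    have h3 := mul_pos (radius_pos hg hl hθ) hh
    rw [← h] at h3
    rw [← h2] at h3
    have := pos_of_mul_pos_right h3 (conorm_pos hg hp).le
    rw [← h]
    linarith
  · exact Or.inl h

/-- The vector `c dir p` has Randers-Kropina norm `c`. -/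
lemma speed_dir (hg : IsInner g) (hl : 0 ≤ l) (hθ : θ ≠ 0) (hp : p ≠ 0) (hc : 0 < c)
    (hh : 0 < ham g θ l p) : speed g θ l (c • dir g θ l p) = c := by
  have h1 := dir_quadratic (θ := θ) hg hl hp
  have h2 := conorm_mul_root_dir (θ := θ) hg hl hp
  have h3 : 0 < l - θ (dir g θ l p) := by
    have := mul_pos (radius_pos hg hl hθ) hh
    rw [← h2] at this
    exact pos_of_mul_pos_right this (conorm_pos hg hp).le
  have h4 : dir g θ l p ≠ 0 := fun h0 => by
    simp only [h0, map_zero, mul_zero, add_zero, zero_sub, neg_eq_zero] at h1 h3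
    simp [h1] at h3
  refine rkFun_eq_of_quadratic (hg.pos _ (smul_ne_zero hc.ne' h4)) ?_ ?_
  · rw [map_smul, smul_eq_mul]
    nlinarith
  · simp only [map_smul, smul_apply, smul_eq_mul]
    linear_combination c ^ 2 * h1

lemma ratio_dir (hg : IsInner g) (hl : 0 ≤ l) (hθ : θ ≠ 0) (hp : p ≠ 0) (hc : 0 < c)
    (hh : 0 < ham g θ l p) :
    speed g θ l (c • dir g θ l p) / root g θ l (c • dir g θ l p) =
      conorm g p / (radius g θ l * ham g θ l p) := by
  have h1 := dir_quadratic (θ := θ) hg hl hp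
  have h2 := conorm_mul_root_dir (θ := θ) hg hl hp
  have hm := dir_mem hg hl hp hθ hh
  have h4 : dir g θ l p ≠ 0 := fun h0 => by
    have := speed_dir hg hl hθ hp one_pos hh
    simp [h0, speed_zero] at this
  rw [root_eq hg hl (smul_ne_zero hc.ne' h4), speed_dir hg hl hθ hp hc hh, ← h2, map_smul,
    smul_eq_mul]
  · have : 0 < l - θ (dir g θ l p) := by
      have := mul_pos (radius_pos hg hl hθ) hh
      rw [← h2] at this
      exact pos_of_mul_pos_right this (conorm_pos hg hp).le
    have h5 : l * c - c * θ (dir g θ l p) ≠ 0 := by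
      rw [mul_comm l c, ← mul_sub]; positivity
    have := conorm_pos hg hp
    field_simp
  · rcases hm with h | h
    · exact Or.inl h
    · right; rw [map_smul, smul_eq_mul]; exact mul_neg_of_pos_of_neg hc h

/-- The Legendre transform of `c dir p` is a positive multiple of `p`. -/
lemma mom_dir (hg : IsInner g) (hl : 0 ≤ l) (hθ : θ ≠ 0) (hp : p ≠ 0) (hc : 0 < c)
    (hh : 0 < ham g θ l p) : mom g θ l (c • dir g θ l p) = (c / ham g θ l p) • p := by
  rw [mom, ratio_dir hg hl hθ hp hc hh, speed_dir hg hl hθ hp hc hh, map_smul, apply_dir hg]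
  have h1 := conorm_pos hg hp
  have h2 := radius_pos hg hl hθ
  ext w
  simp only [smul_apply, add_apply, sub_apply, smul_eq_mul]
  field_simp
  ring

/-- `ham p • dir p` is the inverse Legendre transform of `p`. -/
lemma mom_ham_smul_dir (hg : IsInner g) (hl : 0 < l) (hθ : θ ≠ 0) (p : E →L[ℝ] ℝ) :
    mom g θ l (ham g θ l p • dir g θ l p) = p := by
  rcases eq_or_ne p 0 with rfl | hp
  · rw [ham_zero, zero_smul, mom_zero]
  · have := ham_pos (θ := θ) hg hl hp
    rw [mom_dir hg hl.le hθ hp this this, div_self this.ne', one_smul]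

lemma conorm_mom (hg : IsInner g) (hl : 0 ≤ l) (hv : v ≠ 0) (h : 0 < l ∨ θ v < 0) :
    conorm g (mom g θ l v) =
      speed g θ l v / root g θ l v * (speed g θ l v * radius g θ l) := by
  have h1 := speed_quadratic hg hl hv h
  have h2 := speed_pos hg hv h
  have h3 := root_pos hg hl hv h
  have h4 := radius_sq hg hl θ
  have h5 : 0 ≤ radius g θ l := Real.sqrt_nonneg _
  rw [conorm, ← Real.sqrt_sq (show 0 ≤ speed g θ l v / root g θ l v *
    (speed g θ l v * radius g θ l) by positivity)]
  congr 1
  have h6 : g v (sharp g θ) = θ v := by rw [hg.symm, hg.apply_sharp]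
  simp only [mom, map_smul, map_add, smul_apply, add_apply, smul_eq_mul, hg.sharp_apply, h6]
  linear_combination (speed g θ l v / root g θ l v) ^ 2 * (h1 - speed g θ l v ^ 2 * h4)

/-- With `ham_mom`: the Legendre transform is inverted by `ham` and `dir`. -/
lemma dir_mom (hg : IsInner g) (hl : 0 ≤ l) (hθ : θ ≠ 0) (hv : v ≠ 0) (h : 0 < l ∨ θ v < 0) :
    speed g θ l v • dir g θ l (mom g θ l v) = v := by
  have h2 := speed_pos hg hv h
  have h3 := root_pos hg hl hv h
  have h4 := radius_pos hg hl hθ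
  rw [dir, conorm_mom hg hl hv h, smul_sub, smul_smul]
  have : sharp g (mom g θ l v) =
      (speed g θ l v / root g θ l v) • (v + speed g θ l v • sharp g θ) := by
    simp only [mom, map_smul, map_add, hg.sharp_apply]
  rw [this, smul_smul]
  have h5 : speed g θ l v * (radius g θ l / (speed g θ l v / root g θ l v *
    (speed g θ l v * radius g θ l))) * (speed g θ l v / root g θ l v) = 1 := by
    field_simp
  rw [h5, one_smul, add_sub_cancel_right]

lemma ham_mom (hg : IsInner g) (hl : 0 ≤ l) (hv : v ≠ 0) (h : 0 < l ∨ θ v < 0) :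
    ham g θ l (mom g θ l v) = speed g θ l v := by
  have h2 := speed_pos hg hv h
  have h3 := root_pos hg hl hv h
  have h4 := radius_sq hg hl θ
  have h5 := root_eq hg hl hv h
  have h6 : g v (sharp g θ) = θ v := by rw [hg.symm, hg.apply_sharp]
  rw [ham, conorm_mom hg hl hv h]
  simp only [mom, smul_apply, add_apply, smul_eq_mul, h6]
  have : radius g θ l * (speed g θ l v / root g θ l v * (speed g θ l v * radius g θ l)) -
      speed g θ l v / root g θ l v * (θ v + speed g θ l v * θ (sharp g θ)) =
      speed g θ l v / root g θ l v * (l * speed g θ l v - θ v) := by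
    linear_combination (speed g θ l v ^ 2 / root g θ l v) * h4
  rw [this, ← h5, div_mul_cancel₀ _ h3.ne']

end Pointwise

/-! ### Randers-Kropina metrics on open subsets of a vector space -/

section Local

variable {E : Type*} [NormedAddCommGroup E] [NormedSpace ℝ E]

/-! Shortcuts for instance resolution. -/

instance instNormedAddCommGroupDual : NormedAddCommGroup (E →L[ℝ] ℝ) := inferInstance
instance instNormedSpaceDual : NormedSpace ℝ (E →L[ℝ] ℝ) := inferInstance
instance instNormedAddCommGroupBilin : NormedAddCommGroup (E →L[ℝ] E →L[ℝ] ℝ) := inferInstance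
instance instNormedSpaceBilin : NormedSpace ℝ (E →L[ℝ] E →L[ℝ] ℝ) := inferInstance
instance instNormedAddCommGroupTrilin : NormedAddCommGroup (E →L[ℝ] E →L[ℝ] E →L[ℝ] ℝ) :=
  inferInstance
instance instNormedSpaceTrilin : NormedSpace ℝ (E →L[ℝ] E →L[ℝ] E →L[ℝ] ℝ) := inferInstance

/-- The coefficients `g₀`, `θ`, `Λ` of a Randers-Kropina metric in a chart. -/
structure Coeffs (E : Type*) [NormedAddCommGroup E] [NormedSpace ℝ E] where
  g : E → E →L[ℝ] E →L[ℝ] ℝ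
  θ : E → E →L[ℝ] ℝ
  l : E → ℝ

namespace Coeffs

/-- The coefficients define a Randers-Kropina metric on the open set `U`. -/
structure IsGood (D : Coeffs E) (U : Set E) : Prop where
  isOpen : IsOpen U
  inner : ∀ x ∈ U, IsInner (D.g x)
  θ_ne : ∀ x ∈ U, D.θ x ≠ 0
  l_nonneg : ∀ x ∈ U, 0 ≤ D.l x
  g_smooth : ContDiffOn ℝ ∞ D.g U
  θ_smooth : ContDiffOn ℝ ∞ D.θ U
  l_smooth : ContDiffOn ℝ ∞ D.l U

/-- The coefficients with `Λ` replaced by `Λ + ε`. -/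
def add (D : Coeffs E) (ε : ℝ) : Coeffs E := ⟨D.g, D.θ, fun x => D.l x + ε⟩

lemma add_zero (D : Coeffs E) : D.add 0 = D := by simp [add]

/-- The metric. -/
def F (D : Coeffs E) (x v : E) : ℝ := speed (D.g x) (D.θ x) (D.l x) v

/-- The momentum `∂(F²/2)/∂v`. -/
def momentum (D : Coeffs E) (x v : E) : E →L[ℝ] ℝ := mom (D.g x) (D.θ x) (D.l x) v

/-- The differential in `x` of `g₀(v,v) + 2 c θ(v) - c² Λ`. -/
def slope (D : Coeffs E) (x v : E) (c : ℝ) : E →L[ℝ] ℝ :=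
  ((fderiv ℝ D.g x).flip v).flip v + (2 * c) • (fderiv ℝ D.θ x).flip v - c ^ 2 • fderiv ℝ D.l x

/-- The force `∂(F²/2)/∂x`. -/
def force (D : Coeffs E) (x v : E) : E →L[ℝ] ℝ :=
  (D.F x v / root (D.g x) (D.θ x) (D.l x) v / 2) • D.slope x v (D.F x v)

/-- The Hamiltonian. -/
def H (D : Coeffs E) (x : E) (p : E →L[ℝ] ℝ) : ℝ := ham (D.g x) (D.θ x) (D.l x) p

/-- The first component of the Hamiltonian vector field. -/
def vel (D : Coeffs E) (x : E) (p : E →L[ℝ] ℝ) : E := dir (D.g x) (D.θ x) (D.l x) p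

/-- The second component of the Hamiltonian vector field. -/
def drift (D : Coeffs E) (x : E) (p : E →L[ℝ] ℝ) : E →L[ℝ] ℝ :=
  (conorm (D.g x) p / (2 * radius (D.g x) (D.θ x) (D.l x))) • D.slope x (D.vel x p) 1

/-- The domain of the metric over `U`. -/
def dom (D : Coeffs E) (U : Set E) : Set (E × E) :=
  {z | z.1 ∈ U ∧ (0 < D.l z.1 ∨ D.θ z.1 z.2 < 0)}

variable {D : Coeffs E} {U : Set E} {x v : E} {p : E →L[ℝ] ℝ} {c : ℝ}

lemma IsGood.add (hD : D.IsGood U) {ε : ℝ} (hε : 0 ≤ ε) : (D.add ε).IsGood U where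
  isOpen := hD.isOpen
  inner := hD.inner
  θ_ne := hD.θ_ne
  l_nonneg x hx := add_nonneg (hD.l_nonneg x hx) hε
  g_smooth := hD.g_smooth
  θ_smooth := hD.θ_smooth
  l_smooth := hD.l_smooth.add contDiffOn_const

lemma IsGood.g_contDiffAt (hD : D.IsGood U) (hx : x ∈ U) : ContDiffAt ℝ ∞ D.g x :=
  hD.g_smooth.contDiffAt (hD.isOpen.mem_nhds hx)

lemma IsGood.θ_contDiffAt (hD : D.IsGood U) (hx : x ∈ U) : ContDiffAt ℝ ∞ D.θ x :=
  hD.θ_smooth.contDiffAt (hD.isOpen.mem_nhds hx)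

lemma IsGood.l_contDiffAt (hD : D.IsGood U) (hx : x ∈ U) : ContDiffAt ℝ ∞ D.l x :=
  hD.l_smooth.contDiffAt (hD.isOpen.mem_nhds hx)

lemma IsGood.isOpen_dom (hD : D.IsGood U) : IsOpen (D.dom U) := by
  have h1 : ContinuousOn (fun z : E × E => D.l z.1) (U ×ˢ univ) :=
    hD.l_smooth.continuousOn.comp continuousOn_fst fun z hz => hz.1
  have h2 : ContinuousOn (fun z : E × E => D.θ z.1 z.2) (U ×ˢ univ) :=
    (hD.θ_smooth.continuousOn.comp continuousOn_fst fun z hz => hz.1).clm_apply continuousOn_snd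
  have hU : IsOpen (U ×ˢ (univ : Set E)) := hD.isOpen.prod isOpen_univ
  have := (h1.isOpen_inter_preimage hU isOpen_Ioi (t := Ioi 0)).union
    (h2.isOpen_inter_preimage hU isOpen_Iio (t := Iio 0))
  convert! this using 1
  ext z
  simp only [dom, mem_ofPred_eq, mem_union, mem_inter_iff, mem_prod, mem_univ, and_true,
    mem_preimage, mem_Ioi, mem_Iio]
  tauto

lemma IsGood.hasFDerivAt_gram (hD : D.IsGood U) (hx : x ∈ U) (v : E) :
    HasFDerivAt (fun z : E × E => D.g z.1 z.2 z.2)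
      ((((fderiv ℝ D.g x).flip v).flip v).comp (.fst ℝ E E) +
        ((2 : ℝ) • D.g x v).comp (.snd ℝ E E)) (x, v) := by
  have h1 : HasFDerivAt (fun z : E × E => D.g z.1) ((fderiv ℝ D.g x).comp (.fst ℝ E E)) (x, v) :=
    (((hD.g_contDiffAt hx).differentiableAt (by simp)).hasFDerivAt (x := (x, v).1)).comp (x, v)
      hasFDerivAt_fst
  have h2 := (h1.clm_apply hasFDerivAt_snd).clm_apply hasFDerivAt_snd
  refine h2.congr_fderiv ?_
  ext w
  · simp
  · simp [two_mul, (hD.inner x hx).symm w v]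

lemma IsGood.hasFDerivAt_form (hD : D.IsGood U) (hx : x ∈ U) (v : E) :
    HasFDerivAt (fun z : E × E => D.θ z.1 z.2)
      (((fderiv ℝ D.θ x).flip v).comp (.fst ℝ E E) + (D.θ x).comp (.snd ℝ E E)) (x, v) := by
  have h1 : HasFDerivAt (fun z : E × E => D.θ z.1) ((fderiv ℝ D.θ x).comp (.fst ℝ E E)) (x, v) :=
    (((hD.θ_contDiffAt hx).differentiableAt (by simp)).hasFDerivAt (x := (x, v).1)).comp (x, v)
      hasFDerivAt_fst
  refine (h1.clm_apply hasFDerivAt_snd).congr_fderiv ?_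
  ext w <;> simp

lemma IsGood.hasFDerivAt_l (hD : D.IsGood U) (hx : x ∈ U) (v : E) :
    HasFDerivAt (fun z : E × E => D.l z.1) ((fderiv ℝ D.l x).comp (.fst ℝ E E)) (x, v) :=
  (((hD.l_contDiffAt hx).differentiableAt (by simp)).hasFDerivAt (x := (x, v).1)).comp (x, v)
    hasFDerivAt_fst

lemma force_zero : D.force x 0 = 0 := by simp [force, F, speed_zero]

lemma momentum_zero : D.momentum x 0 = 0 := mom_zero

/-- A nonnegative function below a function with a critical zero has a critical zero. -/
lemma hasFDerivAt_zero_of_le {Z : Type*} [NormedAddCommGroup Z] [NormedSpace ℝ Z]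
    {f u : Z → ℝ} {z : Z} (hu : HasFDerivAt u (0 : Z →L[ℝ] ℝ) z) (hu0 : u z = 0)
    (hf : ∀ᶠ y in 𝓝 z, 0 ≤ f y ∧ f y ≤ u y) : HasFDerivAt f (0 : Z →L[ℝ] ℝ) z := by
  have hf0 : f z = 0 := le_antisymm (hu0 ▸ hf.self_of_nhds.2) hf.self_of_nhds.1
  rw [hasFDerivAt_iff_isLittleO] at hu ⊢
  refine Asymptotics.IsBigO.trans_isLittleO ?_ hu
  refine Asymptotics.IsBigO.of_bound 1 ?_
  filter_upwards [hf] with y hy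
  simp only [hf0, hu0, sub_zero, zero_apply, Real.norm_eq_abs, one_mul]
  rw [abs_of_nonneg hy.1, abs_of_nonneg (hy.1.trans hy.2)]
  exact hy.2

/-- `F²/2` is differentiable on its domain, including the zero vectors. -/
lemma IsGood.hasFDerivAt_energy (hD : D.IsGood U) (hz : (x, v) ∈ D.dom U) :
    HasFDerivAt (fun z : E × E => 1 / 2 * D.F z.1 z.2 ^ 2)
      ((D.force x v).comp (.fst ℝ E E) + (D.momentum x v).comp (.snd ℝ E E)) (x, v) := by
  obtain ⟨hx, hz⟩ : x ∈ U ∧ (0 < D.l x ∨ D.θ x v < 0) := hz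
  have hl := hD.hasFDerivAt_l hx v
  have ht := hD.hasFDerivAt_form hx v
  have hg := hD.hasFDerivAt_gram hx v
  -- at zero vectors, `F²` is squeezed between `0` and a function with vanishing derivative
  rcases eq_or_ne v 0 with rfl | hv
  · have hl0 : 0 < D.l x := by simpa using hz
    rw [force_zero, momentum_zero, ContinuousLinearMap.zero_comp, ContinuousLinearMap.zero_comp,
      zero_add]
    have h1 := (((hl.mul hg).add (ht.pow 2)).const_mul 2).mul
      ((hasDerivAt_inv (pow_pos hl0 2).ne').comp_hasFDerivAt (x, (0 : E)) (hl.pow 2))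
    refine hasFDerivAt_zero_of_le (h1.congr_fderiv ?_) (by simp) ?_
    · ext w <;> simp
    · have hU : ∀ᶠ z : E × E in 𝓝 (x, 0), z.1 ∈ U :=
        continuous_fst.continuousAt.eventually (hD.isOpen.mem_nhds hx)
      filter_upwards [hU, hl.continuousAt.eventually (lt_mem_nhds hl0)] with z hz1 hz2
      refine ⟨by positivity, ?_⟩
      have := rkFun_sq_le (t := D.θ z.1 z.2) hz2 ((hD.inner _ hz1).nonneg z.2)
      simp only [Pi.mul_apply, Pi.add_apply, Function.comp_apply]
      rw [← div_eq_mul_inv]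
      simp only [F, speed]
      calc _ ≤ 1 / 2 * (4 * (D.l z.1 * D.g z.1 z.2 z.2 + D.θ z.1 z.2 ^ 2) / D.l z.1 ^ 2) := by
            gcongr
        _ = _ := by ring
  · have h1 := hasFDerivAt_rkFun_sq hl hg ht (hD.l_nonneg x hx) ((hD.inner x hx).pos v hv) hz
    refine h1.congr_fderiv ?_
    ext w
    · simp [momentum, mom, force, slope, F, speed, root]
    · simp [momentum, mom, force, slope, F, speed, root]
      ring

lemma IsGood.F_nonneg (hD : D.IsGood U) (hx : x ∈ U) (v : E) : 0 ≤ D.F x v :=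
  speed_nonneg (hD.inner x hx) (hD.l_nonneg x hx) v

lemma IsGood.continuousAt_F (hD : D.IsGood U) (hz : (x, v) ∈ D.dom U) :
    ContinuousAt (fun z : E × E => D.F z.1 z.2) (x, v) := by
  have h1 := ((hD.hasFDerivAt_energy hz).continuousAt.const_mul 2).sqrt
  refine h1.congr ?_
  filter_upwards [hD.isOpen_dom.mem_nhds hz] with z hz
  rw [show 2 * (1 / 2 * D.F z.1 z.2 ^ 2) = D.F z.1 z.2 ^ 2 by ring,
    Real.sqrt_sq (hD.F_nonneg hz.1 _)]

/-- The factor `F / √(Λ g₀(v,v) + θ(v)²)` may be discontinuous at the zero vectors only, and is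
bounded there. -/
lemma IsGood.continuousAt_ratio_smul (hD : D.IsGood U) (hz : (x, v) ∈ D.dom U)
    {A : E × E → E →L[ℝ] ℝ} (hA : ContinuousAt A (x, v)) (hA0 : v = 0 → A (x, v) = 0) :
    ContinuousAt (fun z : E × E =>
      (D.F z.1 z.2 / root (D.g z.1) (D.θ z.1) (D.l z.1) z.2) • A z) (x, v) := by
  obtain ⟨hx, hz'⟩ : x ∈ U ∧ (0 < D.l x ∨ D.θ x v < 0) := id hz
  rcases eq_or_ne v 0 with rfl | hv
  · have hl0 : 0 < D.l x := by simpa using hz'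
    rw [ContinuousAt, hA0 rfl, smul_zero]
    rw [ContinuousAt, hA0 rfl] at hA
    refine IsBoundedUnder.smul_tendsto_zero ?_ hA
    refine ⟨2 / (D.l x / 2), ?_⟩
    rw [eventually_map]
    have hU : ∀ᶠ z : E × E in 𝓝 (x, 0), z.1 ∈ U :=
      continuous_fst.continuousAt.eventually (hD.isOpen.mem_nhds hx)
    filter_upwards [hU, (hD.hasFDerivAt_l hx 0).continuousAt.eventually
      (lt_mem_nhds (half_lt_self hl0))] with z hz1 hz2
    have hz3 : 0 < D.l z.1 := (half_pos hl0).trans hz2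
    have := rkFun_div_sqrt_le (t := D.θ z.1 z.2) hz3 ((hD.inner _ hz1).nonneg z.2)
    have h0 : 0 ≤ D.F z.1 z.2 / root (D.g z.1) (D.θ z.1) (D.l z.1) z.2 :=
      div_nonneg (hD.F_nonneg hz1 _) (Real.sqrt_nonneg _)
    simp only [Function.comp_apply, Real.norm_eq_abs]
    rw [abs_of_nonneg h0]
    refine this.trans ?_
    gcongr
  · refine ((hD.continuousAt_F hz).div ?_
      (root_pos (hD.inner x hx) (hD.l_nonneg x hx) hv hz').ne').smul hA
    exact (((hD.hasFDerivAt_l hx v).continuousAt.mul (hD.hasFDerivAt_gram hx v).continuousAt).add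
      ((hD.hasFDerivAt_form hx v).continuousAt.pow 2)).sqrt

lemma IsGood.continuousAt_momentum (hD : D.IsGood U) (hz : (x, v) ∈ D.dom U) :
    ContinuousAt (fun z : E × E => D.momentum z.1 z.2) (x, v) := by
  refine hD.continuousAt_ratio_smul hz (A := fun z => D.g z.1 z.2 + D.F z.1 z.2 • D.θ z.1) ?_ ?_
  · have h1 : ContinuousAt (fun z : E × E => D.g z.1) (x, v) :=
      (hD.g_contDiffAt hz.1).continuousAt.comp_of_eq continuousAt_fst rfl
    have h2 : ContinuousAt (fun z : E × E => D.θ z.1) (x, v) :=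
      (hD.θ_contDiffAt hz.1).continuousAt.comp_of_eq continuousAt_fst rfl
    exact (h1.clm_apply continuousAt_snd).add ((hD.continuousAt_F hz).smul h2)
  · rintro rfl
    simp [F, speed_zero]

lemma IsGood.contDiffAt_slope (hD : D.IsGood U) {y : E × E × ℝ} (hx : y.1 ∈ U) :
    ContDiffAt ℝ ∞ (fun z : E × E × ℝ => D.slope z.1 z.2.1 z.2.2) y := by
  have h1 : ContDiffAt ℝ ∞ (fun z : E × E × ℝ => fderiv ℝ D.g z.1) y :=
    ((hD.g_contDiffAt hx).fderiv_right (m := ∞) (by simp)).comp y contDiffAt_fst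
  have h2 : ContDiffAt ℝ ∞ (fun z : E × E × ℝ => fderiv ℝ D.θ z.1) y :=
    ((hD.θ_contDiffAt hx).fderiv_right (m := ∞) (by simp)).comp y contDiffAt_fst
  have h3 : ContDiffAt ℝ ∞ (fun z : E × E × ℝ => fderiv ℝ D.l z.1) y :=
    ((hD.l_contDiffAt hx).fderiv_right (m := ∞) (by simp)).comp y contDiffAt_fst
  have h4 : ContDiff ℝ ∞ fun A : E →L[ℝ] E →L[ℝ] E →L[ℝ] ℝ => A.flip :=
    (ContinuousLinearMap.flipₗᵢ ℝ E E (E →L[ℝ] ℝ)).toContinuousLinearEquiv.contDiff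
  have h5 : ContDiff ℝ ∞ fun A : E →L[ℝ] E →L[ℝ] ℝ => A.flip :=
    (ContinuousLinearMap.flipₗᵢ ℝ E E ℝ).toContinuousLinearEquiv.contDiff
  have hv : ContDiffAt ℝ ∞ (fun z : E × E × ℝ => z.2.1) y := by fun_prop
  have hc : ContDiffAt ℝ ∞ (fun z : E × E × ℝ => z.2.2) y := by fun_prop
  have h6 := (h5.contDiffAt.comp y ((h4.contDiffAt.comp y h1).clm_apply hv)).clm_apply hv
  have h7 := (h5.contDiffAt.comp y h2).clm_apply hv
  exact (h6.add ((contDiffAt_const.mul hc).smul h7)).sub ((hc.pow 2).smul h3)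

lemma IsGood.continuousAt_slope (hD : D.IsGood U) {y : E × E × ℝ} (hx : y.1 ∈ U) :
    ContinuousAt (fun z : E × E × ℝ => D.slope z.1 z.2.1 z.2.2) y :=
  (hD.contDiffAt_slope hx).continuousAt

lemma IsGood.continuousAt_force (hD : D.IsGood U) (hz : (x, v) ∈ D.dom U) :
    ContinuousAt (fun z : E × E => D.force z.1 z.2) (x, v) := by
  have h := hD.continuousAt_ratio_smul hz
    (A := fun z => (1 / 2 : ℝ) • D.slope z.1 z.2 (D.F z.1 z.2)) ?_ ?_
  · refine h.congr (Eventually.of_forall fun z => ?_)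
    simp only [force, smul_smul]
    congr 1
    ring
  · have h1 : ContinuousAt (fun z : E × E => (z.1, z.2, D.F z.1 z.2)) (x, v) :=
      continuousAt_fst.prodMk (continuousAt_snd.prodMk (hD.continuousAt_F hz))
    have h2 := (hD.continuousAt_slope (y := (x, v, D.F x v)) hz.1).comp_of_eq h1 rfl
    exact (continuousAt_const (y := (1 / 2 : ℝ))).smul h2
  · rintro rfl
    simp [F, speed_zero, slope]

/-- `F²/2` is of class `C¹` on its domain. -/
lemma IsGood.hasStrictFDerivAt_energy (hD : D.IsGood U) (hz : (x, v) ∈ D.dom U) :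
    HasStrictFDerivAt (fun z : E × E => 1 / 2 * D.F z.1 z.2 ^ 2)
      ((D.force x v).comp (.fst ℝ E E) + (D.momentum x v).comp (.snd ℝ E E)) (x, v) := by
  set L : E × E → E × E →L[ℝ] ℝ := fun z =>
    (D.force z.1 z.2).comp (.fst ℝ E E) + (D.momentum z.1 z.2).comp (.snd ℝ E E) with hL
  have A : ∀ᶠ z in 𝓝 (x, v), HasFDerivAt (fun z : E × E => 1 / 2 * D.F z.1 z.2 ^ 2) (L z) z := by
    filter_upwards [hD.isOpen_dom.mem_nhds hz] with z hz
    exact hD.hasFDerivAt_energy hz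
  have B : ContinuousAt L (x, v) := by
    have h1 : Continuous fun q : E →L[ℝ] ℝ => q.comp (.fst ℝ E E) :=
      ((ContinuousLinearMap.compL ℝ (E × E) E ℝ).flip (.fst ℝ E E)).continuous
    have h2 : Continuous fun q : E →L[ℝ] ℝ => q.comp (.snd ℝ E E) :=
      ((ContinuousLinearMap.compL ℝ (E × E) E ℝ).flip (.snd ℝ E E)).continuous
    exact (h1.continuousAt.comp (hD.continuousAt_force hz)).add
      (h2.continuousAt.comp (hD.continuousAt_momentum hz))
  exact hasStrictFDerivAt_of_hasFDerivAt_of_continuousAt A B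

end Coeffs

end Local

/-! ### The Hamiltonian vector field -/

section Hamilton

variable {E : Type*} [NormedAddCommGroup E] [NormedSpace ℝ E]

namespace Coeffs

variable {D : Coeffs E} {U : Set E} {x v : E} {p : E →L[ℝ] ℝ} {a c ε : ℝ}

lemma slope_add (D : Coeffs E) (ε : ℝ) : (D.add ε).slope x v c = D.slope x v c := by
  simp [slope, add]

lemma slope_smul (a c : ℝ) : D.slope x (a • v) (a * c) = a ^ 2 • D.slope x v c := by
  ext w
  simp [slope]
  ring

lemma conorm_smul (g : E →L[ℝ] E →L[ℝ] ℝ) (ha : 0 ≤ a) (p : E →L[ℝ] ℝ) :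
    conorm g (a • p) = a * conorm g p := by
  rw [conorm, conorm, map_smul, smul_apply, map_smul, smul_eq_mul, smul_eq_mul, ← mul_assoc,
    Real.sqrt_mul (by positivity), Real.sqrt_mul_self ha]

lemma vel_smul (ha : 0 < a) : D.vel x (a • p) = D.vel x p := by
  rw [vel, vel, dir, dir, conorm_smul _ ha.le, map_smul, smul_smul]
  congr 2
  rcases eq_or_ne (conorm (D.g x) p) 0 with h | h
  · simp [h]
  · field_simp

lemma drift_smul (ha : 0 < a) : D.drift x (a • p) = a • D.drift x p := by
  rw [drift, drift, conorm_smul _ ha.le, vel_smul ha, smul_smul]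
  congr 1
  ring

lemma H_smul (ha : 0 ≤ a) : D.H x (a • p) = a * D.H x p := by
  rw [H, H, ham, ham, conorm_smul _ ha, smul_apply, smul_eq_mul]
  ring

lemma momentum_ne_zero (hD : D.IsGood U) (hz : (x, v) ∈ D.dom U) (hv : v ≠ 0) :
    D.momentum x v ≠ 0 :=
  mom_ne_zero (hD.inner x hz.1) (hD.l_nonneg x hz.1) hv hz.2

lemma F_pos (hD : D.IsGood U) (hz : (x, v) ∈ D.dom U) (hv : v ≠ 0) : 0 < D.F x v :=
  speed_pos (hD.inner x hz.1) hv hz.2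

variable [FiniteDimensional ℝ E]

lemma IsGood.contDiffAt_sharp (hD : D.IsGood U) (hx : x ∈ U) :
    ContDiffAt ℝ ∞ (fun x => sharp (D.g x)) x := by
  obtain ⟨e, he⟩ := (hD.inner x hx).isInvertible
  have h1 := contDiffAt_map_inverse (𝕜 := ℝ) (n := ∞) e
  rw [he] at h1
  exact h1.comp x (hD.g_contDiffAt hx)

lemma IsGood.contDiffAt_conorm (hD : D.IsGood U) {y : ℝ × E × (E →L[ℝ] ℝ)} (hx : y.2.1 ∈ U)
    (hp : y.2.2 ≠ 0) :
    ContDiffAt ℝ ∞ (fun z : ℝ × E × (E →L[ℝ] ℝ) => conorm (D.g z.2.1) z.2.2) y := by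
  have h1 : ContDiffAt ℝ ∞ (fun z : ℝ × E × (E →L[ℝ] ℝ) => sharp (D.g z.2.1)) y :=
    (hD.contDiffAt_sharp hx).comp (f := fun z : ℝ × E × (E →L[ℝ] ℝ) => z.2.1) y (by fun_prop)
  have h2 : ContDiffAt ℝ ∞ (fun z : ℝ × E × (E →L[ℝ] ℝ) => z.2.2) y := by fun_prop
  exact (h2.clm_apply (h1.clm_apply h2)).sqrt ((hD.inner _ hx).apply_sharp_pos hp).ne'

lemma IsGood.contDiffAt_radius (hD : D.IsGood U) {y : ℝ × E × (E →L[ℝ] ℝ)} (hx : y.2.1 ∈ U)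
    (hε : 0 ≤ y.1) :
    ContDiffAt ℝ ∞ (fun z : ℝ × E × (E →L[ℝ] ℝ) =>
      radius (D.g z.2.1) (D.θ z.2.1) (D.l z.2.1 + z.1)) y := by
  have hc : ContDiffAt ℝ ∞ (fun z : ℝ × E × (E →L[ℝ] ℝ) => z.2.1) y := by fun_prop
  have h1 := (hD.contDiffAt_sharp hx).comp y hc
  have h2 := (hD.θ_contDiffAt hx).comp y hc
  have h3 := (hD.l_contDiffAt hx).comp y hc
  refine ((h3.add contDiffAt_fst).add (h2.clm_apply (h1.clm_apply h2))).sqrt ?_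
  exact (add_pos_of_nonneg_of_pos (add_nonneg (hD.l_nonneg _ hx) hε)
    ((hD.inner _ hx).apply_sharp_pos (hD.θ_ne _ hx))).ne'

lemma IsGood.contDiffAt_vel (hD : D.IsGood U) {y : ℝ × E × (E →L[ℝ] ℝ)} (hx : y.2.1 ∈ U)
    (hε : 0 ≤ y.1) (hp : y.2.2 ≠ 0) :
    ContDiffAt ℝ ∞ (fun z : ℝ × E × (E →L[ℝ] ℝ) => (D.add z.1).vel z.2.1 z.2.2) y := by
  have hc : ContDiffAt ℝ ∞ (fun z : ℝ × E × (E →L[ℝ] ℝ) => z.2.1) y := by fun_prop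
  have h1 := (hD.contDiffAt_sharp hx).comp y hc
  have h2 := (hD.θ_contDiffAt hx).comp y hc
  have h4 : ContDiffAt ℝ ∞ (fun z : ℝ × E × (E →L[ℝ] ℝ) => z.2.2) y := by fun_prop
  exact (((hD.contDiffAt_radius hx hε).div (hD.contDiffAt_conorm hx hp)
    (conorm_pos (hD.inner _ hx) hp).ne').smul (h1.clm_apply h4)).sub (h1.clm_apply h2)

lemma IsGood.contDiffAt_H (hD : D.IsGood U) {y : ℝ × E × (E →L[ℝ] ℝ)} (hx : y.2.1 ∈ U)
    (hε : 0 ≤ y.1) (hp : y.2.2 ≠ 0) :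
    ContDiffAt ℝ ∞ (fun z : ℝ × E × (E →L[ℝ] ℝ) => (D.add z.1).H z.2.1 z.2.2) y := by
  have hc : ContDiffAt ℝ ∞ (fun z : ℝ × E × (E →L[ℝ] ℝ) => z.2.1) y := by fun_prop
  have h1 := (hD.contDiffAt_sharp hx).comp y hc
  have h2 := (hD.θ_contDiffAt hx).comp y hc
  have h4 : ContDiffAt ℝ ∞ (fun z : ℝ × E × (E →L[ℝ] ℝ) => z.2.2) y := by fun_prop
  exact ((hD.contDiffAt_radius hx hε).mul (hD.contDiffAt_conorm hx hp)).sub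
    (h4.clm_apply (h1.clm_apply h2))

lemma IsGood.contDiffAt_drift (hD : D.IsGood U) {y : ℝ × E × (E →L[ℝ] ℝ)} (hx : y.2.1 ∈ U)
    (hε : 0 ≤ y.1) (hp : y.2.2 ≠ 0) :
    ContDiffAt ℝ ∞ (fun z : ℝ × E × (E →L[ℝ] ℝ) => (D.add z.1).drift z.2.1 z.2.2) y := by
  have hc : ContDiffAt ℝ ∞ (fun z : ℝ × E × (E →L[ℝ] ℝ) => z.2.1) y := by fun_prop
  have h1 : ContDiffAt ℝ ∞ (fun z : ℝ × E × (E →L[ℝ] ℝ) =>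
      (z.2.1, (D.add z.1).vel z.2.1 z.2.2, (1 : ℝ))) y :=
    hc.prodMk ((hD.contDiffAt_vel hx hε hp).prodMk contDiffAt_const)
  have h2 := (hD.contDiffAt_slope (y := (y.2.1, (D.add y.1).vel y.2.1 y.2.2, (1 : ℝ))) hx).comp y h1
  have h3 : 2 * radius (D.g y.2.1) (D.θ y.2.1) (D.l y.2.1 + y.1) ≠ 0 :=
    (mul_pos two_pos (radius_pos (hD.inner _ hx) (add_nonneg (hD.l_nonneg _ hx) hε)
      (hD.θ_ne _ hx))).ne'
  have h4 := ((hD.contDiffAt_conorm hx hp).div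
    (contDiffAt_const.mul (hD.contDiffAt_radius hx hε)) h3).smul h2
  refine h4.congr_of_eventuallyEq (Eventually.of_forall fun z => ?_)
  simp only [drift, slope_add]
  rfl

lemma vel_mem_dom (hD : D.IsGood U) (hx : x ∈ U) (hp : p ≠ 0) (hc : 0 < c) (hH : 0 < D.H x p) :
    (x, c • D.vel x p) ∈ D.dom U := by
  refine ⟨hx, ?_⟩
  rcases dir_mem (hD.inner x hx) (hD.l_nonneg x hx) hp (hD.θ_ne x hx) hH with h | h
  · exact Or.inl h
  · right
    simp only [map_smul, smul_eq_mul]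
    exact mul_neg_of_pos_of_neg hc h

lemma F_vel (hD : D.IsGood U) (hx : x ∈ U) (hp : p ≠ 0) (hc : 0 < c) (hH : 0 < D.H x p) :
    D.F x (c • D.vel x p) = c :=
  speed_dir (hD.inner x hx) (hD.l_nonneg x hx) (hD.θ_ne x hx) hp hc hH

lemma momentum_vel (hD : D.IsGood U) (hx : x ∈ U) (hp : p ≠ 0) (hc : 0 < c) (hH : 0 < D.H x p) :
    D.momentum x (c • D.vel x p) = (c / D.H x p) • p :=
  mom_dir (hD.inner x hx) (hD.l_nonneg x hx) (hD.θ_ne x hx) hp hc hH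

lemma force_vel (hD : D.IsGood U) (hx : x ∈ U) (hp : p ≠ 0) (hc : 0 < c) (hH : 0 < D.H x p) :
    D.force x (c • D.vel x p) = (c / D.H x p) • c • D.drift x p := by
  have h1 := ratio_dir (hD.inner x hx) (hD.l_nonneg x hx) (hD.θ_ne x hx) hp hc hH
  have h2 : D.F x (c • D.vel x p) / root (D.g x) (D.θ x) (D.l x) (c • D.vel x p) =
    conorm (D.g x) p / (radius (D.g x) (D.θ x) (D.l x) * D.H x p) := h1
  have h3 := slope_smul (D := D) (x := x) (v := D.vel x p) c 1
  rw [mul_one] at h3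
  rw [force, h2, F_vel hD hx hp hc hH, h3, drift, smul_smul, smul_smul, smul_smul]
  congr 1
  have := radius_pos (hD.inner x hx) (hD.l_nonneg x hx) (hD.θ_ne x hx)
  field_simp

lemma vel_momentum (hD : D.IsGood U) (hz : (x, v) ∈ D.dom U) (hv : v ≠ 0) :
    D.F x v • D.vel x (D.momentum x v) = v :=
  dir_mom (hD.inner x hz.1) (hD.l_nonneg x hz.1) (hD.θ_ne x hz.1) hv hz.2

lemma H_momentum (hD : D.IsGood U) (hz : (x, v) ∈ D.dom U) (hv : v ≠ 0) :
    D.H x (D.momentum x v) = D.F x v :=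
  ham_mom (hD.inner x hz.1) (hD.l_nonneg x hz.1) hv hz.2

lemma force_eq_drift (hD : D.IsGood U) (hz : (x, v) ∈ D.dom U) (hv : v ≠ 0) :
    D.force x v = D.F x v • D.drift x (D.momentum x v) := by
  have hF := F_pos hD hz hv
  have hH := H_momentum hD hz hv
  have h := force_vel hD hz.1 (momentum_ne_zero hD hz hv) hF (by rwa [hH])
  rwa [vel_momentum hD hz hv, hH, div_self hF.ne', one_smul] at h

/-- Over compact sets, the Hamiltonian vector field grows at most linearly in the momentum,
uniformly as `ε → 0`. -/
lemma IsGood.exists_bound (hD : D.IsGood U) {B : Set E} (hB : IsCompact B) (hBU : B ⊆ U) :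
    ∃ C > 0, ∀ ε ∈ Icc (0 : ℝ) 1, ∀ x ∈ B, ∀ p : E →L[ℝ] ℝ, p ≠ 0 →
      ‖(D.add ε).vel x p‖ ≤ C ∧ ‖(D.add ε).drift x p‖ ≤ C * ‖p‖ := by
  have hK : IsCompact (Icc (0 : ℝ) 1 ×ˢ B ×ˢ Metric.sphere (0 : E →L[ℝ] ℝ) 1) :=
    isCompact_Icc.prod (hB.prod (isCompact_sphere _ _))
  have hne : ∀ p ∈ Metric.sphere (0 : E →L[ℝ] ℝ) 1, p ≠ 0 := fun p hp =>
    Metric.ne_of_mem_sphere hp one_ne_zero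
  obtain ⟨C₁, hC₁⟩ := hK.exists_bound_of_continuousOn
    (f := fun z : ℝ × E × (E →L[ℝ] ℝ) => (D.add z.1).vel z.2.1 z.2.2) fun z hz =>
      (hD.contDiffAt_vel (hBU hz.2.1) hz.1.1 (hne _ hz.2.2)).continuousAt.continuousWithinAt
  obtain ⟨C₂, hC₂⟩ := hK.exists_bound_of_continuousOn
    (f := fun z : ℝ × E × (E →L[ℝ] ℝ) => (D.add z.1).drift z.2.1 z.2.2) fun z hz =>
      (hD.contDiffAt_drift (hBU hz.2.1) hz.1.1 (hne _ hz.2.2)).continuousAt.continuousWithinAt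
  refine ⟨max 1 (max C₁ C₂), by positivity, fun ε hε x hx p hp => ?_⟩
  have hp0 : 0 < ‖p‖ := norm_pos_iff.2 hp
  have hs : ‖p‖⁻¹ • p ∈ Metric.sphere (0 : E →L[ℝ] ℝ) 1 := by
    rw [mem_sphere_zero_iff_norm, norm_smul, norm_inv, norm_norm, inv_mul_cancel₀ hp0.ne']
  have h1 := hC₁ (ε, x, ‖p‖⁻¹ • p) ⟨hε, hx, hs⟩
  have h2 := hC₂ (ε, x, ‖p‖⁻¹ • p) ⟨hε, hx, hs⟩
  simp only [vel_smul (inv_pos.2 hp0), drift_smul (inv_pos.2 hp0), norm_smul, norm_inv,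
    norm_norm] at h1 h2
  rw [inv_mul_le_iff₀ hp0, mul_comm] at h2
  refine ⟨h1.trans ((le_max_left _ _).trans (le_max_right _ _)), h2.trans ?_⟩
  gcongr
  exact (le_max_right _ _).trans (le_max_right _ _)

lemma IsGood.continuousAt_H (hD : D.IsGood U) (hx : x ∈ U) (p : E →L[ℝ] ℝ) :
    ContinuousAt (fun z : E × (E →L[ℝ] ℝ) => D.H z.1 z.2) (x, p) := by
  have hc : ContinuousAt (fun z : E × (E →L[ℝ] ℝ) => z.1) (x, p) := by fun_prop
  have h4 : ContinuousAt (fun z : E × (E →L[ℝ] ℝ) => z.2) (x, p) := by fun_prop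
  have h1 := (hD.contDiffAt_sharp hx).continuousAt.comp_of_eq hc rfl
  have h2 := (hD.θ_contDiffAt hx).continuousAt.comp_of_eq hc rfl
  have h3 := (hD.l_contDiffAt hx).continuousAt.comp_of_eq hc rfl
  exact ((h3.add (h2.clm_apply (h1.clm_apply h2))).sqrt.mul
    (h4.clm_apply (h1.clm_apply h4)).sqrt).sub (h4.clm_apply (h1.clm_apply h2))

/-- The inverse Legendre transform `p ↦ H(x,p) vel(x,p)` is continuous, also at `p = 0`. -/
lemma IsGood.continuousAt_H_smul_vel (hD : D.IsGood U) (hx : x ∈ U) (p : E →L[ℝ] ℝ) :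
    ContinuousAt (fun z : E × (E →L[ℝ] ℝ) => D.H z.1 z.2 • D.vel z.1 z.2) (x, p) := by
  have hi : ContinuousAt (fun z : E × (E →L[ℝ] ℝ) => ((0 : ℝ), z)) (x, p) := by fun_prop
  have h2 := hD.continuousAt_H hx p
  rcases eq_or_ne p 0 with rfl | hp
  · obtain ⟨r, hr, hrU⟩ := Metric.nhds_basis_closedBall.mem_iff.1 (hD.isOpen.mem_nhds hx)
    have := FiniteDimensional.proper ℝ E
    obtain ⟨C, hC, hb⟩ := hD.exists_bound (isCompact_closedBall x r) hrU
    have h0 : ∀ y, D.H y 0 = 0 := fun y => ham_zero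
    rw [ContinuousAt] at h2 ⊢
    simp only [h0, zero_smul] at h2 ⊢
    have h3 := h2.norm.mul_const C
    rw [norm_zero, zero_mul] at h3
    refine squeeze_zero_norm' ?_ h3
    filter_upwards [continuousAt_fst.eventually (Metric.closedBall_mem_nhds x hr)] with z hz
    rw [norm_smul]
    rcases eq_or_ne z.2 0 with h | h
    · simp [h, h0]
    · have := (hb 0 (by simp) z.1 hz z.2 h).1
      rw [add_zero] at this
      gcongr
  · have h1 := (hD.contDiffAt_vel (y := (0, x, p)) hx le_rfl hp).continuousAt.comp_of_eq hi rfl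
    refine (h2.smul h1).congr (Eventually.of_forall fun z => ?_)
    simp [add_zero]

end Coeffs

end Hamilton

/-! ### Analysis on intervals -/

section Interval

open MeasureTheory

/-- A property of intervals that is additive and holds for all short intervals with a given
left or right end point holds for all intervals. -/
lemma interval_induction {a b : ℝ} (hab : a ≤ b) (W : ℝ → ℝ → Prop)
    (hadd : ∀ x y z, a ≤ x → x ≤ y → y ≤ z → z ≤ b → W x y → W y z → W x z)
    (hloc : ∀ s ∈ Icc a b, ∃ δ > 0, ∀ x ∈ Icc a b,
      (s - δ < x → x ≤ s → W x s) ∧ (s ≤ x → x < s + δ → W s x)) : W a b := by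
  set T : Set ℝ := {s | s ∈ Icc a b ∧ W a s} with hT
  have haT : a ∈ T := by
    obtain ⟨δ, hδ, h⟩ := hloc a (left_mem_Icc.2 hab)
    exact ⟨left_mem_Icc.2 hab, (h a (left_mem_Icc.2 hab)).2 le_rfl (by linarith)⟩
  have hbdd : BddAbove T := ⟨b, fun s hs => hs.1.2⟩
  set c := sSup T with hc
  have hac : a ≤ c := le_csSup hbdd haT
  have hcb : c ≤ b := csSup_le ⟨a, haT⟩ fun s hs => hs.1.2
  obtain ⟨δ, hδ, h⟩ := hloc c ⟨hac, hcb⟩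
  obtain ⟨s, hsT, hs⟩ := exists_lt_of_lt_csSup ⟨a, haT⟩ (show c - δ < sSup T by linarith)
  have hsc : s ≤ c := le_csSup hbdd hsT
  have hWc : W a c := hadd a s c le_rfl hsT.1.1 hsc hcb hsT.2 ((h s hsT.1).1 hs hsc)
  rcases hcb.eq_or_lt with h' | h'
  · rwa [h'] at hWc
  · exfalso
    have hx : c < min b (c + δ / 2) := lt_min h' (by linarith)
    have hxT : min b (c + δ / 2) ∈ T := by
      have hI : min b (c + δ / 2) ∈ Icc a b := ⟨hac.trans hx.le, min_le_left _ _⟩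
      refine ⟨hI, hadd a c _ le_rfl hac hx.le hI.2 hWc ((h _ hI).2 hx.le ?_)⟩
      exact (min_le_right _ _).trans_lt (by linarith)
    exact absurd (le_csSup hbdd hxT) (not_le.2 hx)

/-- A limit of differentiable curves is differentiable at `s` if the derivatives converge jointly
in the index and the time at `s`. -/
lemma hasDerivWithinAt_of_tendsto {ι V : Type*} [NormedAddCommGroup V] [NormedSpace ℝ V]
    {l : Filter ι} [l.NeBot] {z z' : ι → ℝ → V} {y : ℝ → V} {w : V} {I : Set ℝ}
    (hI : Convex ℝ I) {s : ℝ} (hs : s ∈ I)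
    (hz : ∀ᶠ i in l, ∀ t ∈ I, HasDerivWithinAt (z i) (z' i t) I t)
    (hlim : ∀ t ∈ I, Tendsto (fun i => z i t) l (𝓝 (y t)))
    (hw : Tendsto (fun q : ι × ℝ => z' q.1 q.2) (l ×ˢ 𝓝[I] s) (𝓝 w)) :
    HasDerivWithinAt y w I s := by
  rw [hasDerivWithinAt_iff_isLittleO, Asymptotics.isLittleO_iff]
  intro η hη
  have h1 := hw.eventually (Metric.ball_mem_nhds w hη)
  rw [eventually_prod_iff] at h1
  obtain ⟨P, hP, Q, hQ, hPQ⟩ := h1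
  obtain ⟨ρ, hρ, hρQ⟩ := Metric.mem_nhdsWithin_iff.1 hQ
  filter_upwards [self_mem_nhdsWithin, mem_nhdsWithin_of_mem_nhds (Metric.ball_mem_nhds s hρ)]
    with t htI htρ
  have h2 : ∀ᶠ i in l, ‖z i t - z i s - (t - s) • w‖ ≤ η * ‖t - s‖ := by
    filter_upwards [hz, hP] with i hi hPi
    have hconv : Convex ℝ (Metric.ball s ρ ∩ I) := (convex_ball s ρ).inter hI
    have h3 := hconv.norm_image_sub_le_of_norm_hasDerivWithin_le
      (f := fun t => z i t - t • w) (f' := fun t => z' i t - w) (C := η) (x := s) (y := t)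
      (fun u hu => ?_) (fun u hu => ?_) ⟨Metric.mem_ball_self hρ, hs⟩ ⟨htρ, htI⟩
    · convert! h3 using 2
      rw [sub_smul]
      abel
    · have := ((hi u hu.2).mono inter_subset_right).sub
        (((hasDerivAt_id u).smul_const w).hasDerivWithinAt (s := Metric.ball s ρ ∩ I))
      rw [one_smul] at this
      exact this
    · have : dist (z' i u) w < η := hPQ hPi (hρQ hu)
      rw [dist_eq_norm] at this
      exact this.le
  have h4 : Tendsto (fun i => ‖z i t - z i s - (t - s) • w‖) l
      (𝓝 ‖y t - y s - (t - s) • w‖) :=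
    (((hlim t htI).sub (hlim s hs)).sub tendsto_const_nhds).norm
  exact le_of_tendsto h4 h2

/-- Solutions of smooth autonomous differential equations are smooth. -/
lemma contDiffOn_of_hasDerivWithinAt {V : Type*} [NormedAddCommGroup V] [NormedSpace ℝ V]
    {a b : ℝ} (hab : a < b) {z : ℝ → V} {f : V → V}
    (hz : ∀ s ∈ Icc a b, HasDerivWithinAt z (f (z s)) (Icc a b) s)
    (hf : ∀ s ∈ Icc a b, ContDiffAt ℝ ∞ f (z s)) : ContDiffOn ℝ ∞ z (Icc a b) := by
  rw [contDiffOn_infty]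
  intro n
  induction n with
  | zero => exact contDiffOn_zero.2 fun s hs => (hz s hs).continuousWithinAt
  | succ n ih =>
    push_cast
    rw [contDiffOn_succ_iff_derivWithin (uniqueDiffOn_Icc hab)]
    refine ⟨fun s hs => (hz s hs).differentiableWithinAt, by simp, ?_⟩
    have h1 : ContDiffOn ℝ n (fun s => f (z s)) (Icc a b) := fun s hs =>
      ((hf s hs).of_le (by exact_mod_cast le_top)).comp_contDiffWithinAt s (ih s hs)
    exact h1.congr fun s hs => (hz s hs).derivWithin (uniqueDiffOn_Icc hab s hs)

/-- A compactly supported function with vanishing integral has a compactly supported primitive. -/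
lemma exists_primitive_of_integral_eq_zero {a b : ℝ} {ψ : ℝ → ℝ} (hψ : ContDiff ℝ ∞ ψ)
    (hc : HasCompactSupport ψ) (hs : tsupport ψ ⊆ Ioo a b) (hab : a < b)
    (hI : ∫ s in a..b, ψ s = 0) :
    ∃ η : ℝ → ℝ, ContDiff ℝ ∞ η ∧ HasCompactSupport η ∧ tsupport η ⊆ Ioo a b ∧
      ∀ s, HasDerivAt η (ψ s) s := by
  obtain ⟨a₁, b₁, ha, hb, hab₁, hsub⟩ : ∃ a₁ b₁, a < a₁ ∧ b₁ < b ∧ a₁ ≤ b₁ ∧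
      tsupport ψ ⊆ Icc a₁ b₁ := by
    rcases (tsupport ψ).eq_empty_or_nonempty with h | h
    · exact ⟨(a + b) / 2, (a + b) / 2, by linarith, by linarith, le_rfl, by simp [h]⟩
    · have hK : IsCompact (tsupport ψ) := hc
      exact ⟨sInf (tsupport ψ), sSup (tsupport ψ), (hs (hK.sInf_mem h)).1, (hs (hK.sSup_mem h)).2,
        csInf_le_csSup h hK.bddBelow hK.bddAbove,
        fun x hx => ⟨csInf_le hK.bddBelow hx, le_csSup hK.bddAbove hx⟩⟩
  have h0 : ∀ s, s ∉ Icc a₁ b₁ → ψ s = 0 := fun s h => image_eq_zero_of_notMem_tsupport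
    fun h' => h (hsub h')
  have hd : ∀ s, HasDerivAt (fun s => ∫ u in a..s, ψ u) (ψ s) s := fun s =>
    intervalIntegral.integral_hasDerivAt_right (hψ.continuous.intervalIntegrable _ _)
      (hψ.continuous.stronglyMeasurableAtFilter _ _) hψ.continuous.continuousAt
  have hsupp : Function.support (fun s => ∫ u in a..s, ψ u) ⊆ Icc a₁ b₁ := by
    intro s hs'
    by_contra h
    refine hs' ?_
    rw [mem_Icc, not_and_or, not_le, not_le] at h
    rcases h with h | h
    · refine (intervalIntegral.integral_congr (g := fun _ => 0) fun u hu => h0 u fun hu' => ?_).trans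
        intervalIntegral.integral_zero
      have := hu.2
      have h3 := hu'.1
      rcases max_cases a s with h4 | h4 <;> linarith
    · simp only
      rw [← intervalIntegral.integral_add_adjacent_intervals (b := b)
        (hψ.continuous.intervalIntegrable _ _) (hψ.continuous.intervalIntegrable _ _), hI, zero_add]
      refine (intervalIntegral.integral_congr (g := fun _ => 0) fun u hu => h0 u fun hu' => ?_).trans
        intervalIntegral.integral_zero
      have := hu.1
      have h3 := hu'.2
      rcases min_cases b s with h4 | h4 <;> linarith
  have htsupp : tsupport (fun s => ∫ u in a..s, ψ u) ⊆ Icc a₁ b₁ :=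
    closure_minimal hsupp isClosed_Icc
  refine ⟨_, ?_, isCompact_Icc.of_isClosed_subset (isClosed_tsupport _) htsupp,
    htsupp.trans fun x hx => ⟨ha.trans_le hx.1, hx.2.trans_lt hb⟩, hd⟩
  have h1 : ContDiff ℝ (∞ + 1) fun s => ∫ u in a..s, ψ u := by
    rw [contDiff_succ_iff_deriv]
    refine ⟨fun s => (hd s).differentiableAt, by simp, ?_⟩
    rwa [show deriv (fun s => ∫ u in a..s, ψ u) = ψ from funext fun s => (hd s).deriv]
  simpa using h1

/-- The lemma of du Bois-Reymond: a weak solution `u` of `u' = f` is a primitive of `f`. -/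
lemma ae_eq_add_integral_of_forall_integral_eq_zero {V : Type*} [NormedAddCommGroup V]
    [NormedSpace ℝ V] [CompleteSpace V] {a b : ℝ} (hab : a < b) {u f : ℝ → V}
    (hu : IntervalIntegrable u volume a b) (hf : IntervalIntegrable f volume a b)
    {T : Set ℝ} (hT : T.Countable) (hfc : ∀ s ∈ Ioo a b \ T, ContinuousAt f s)
    (h : ∀ η : ℝ → ℝ, ContDiff ℝ ∞ η → HasCompactSupport η → tsupport η ⊆ Ioo a b →
      ∫ s in a..b, (deriv η s • u s + η s • f s) = 0) :
    ∃ C : V, ∀ᵐ s, s ∈ Ioo a b → u s = C + ∫ r in a..s, f r := by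
  set A : ℝ → V := fun s => ∫ r in a..s, f r with hA
  have hAc : ContinuousOn A (Icc a b) := by
    have := intervalIntegral.continuousOn_primitive_interval (μ := volume) (f := f) (a := a) (b := b)
      ((intervalIntegrable_iff_integrableOn_Icc_of_le hab.le).1 hf |>.mono_set (by
        rw [uIcc_of_le hab.le]))
    rwa [uIcc_of_le hab.le] at this
  have hQ : IntervalIntegrable (fun s => u s - A s) volume a b :=
    hu.sub (hAc.intervalIntegrable_of_Icc hab.le)
  -- integration by parts
  have key : ∀ η : ℝ → ℝ, ContDiff ℝ ∞ η → HasCompactSupport η → tsupport η ⊆ Ioo a b →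
      ∫ s in a..b, deriv η s • (u s - A s) = 0 := by
    intro η h1 h2 h3
    have hη' : Continuous (deriv η) := h1.continuous_deriv (by simp)
    have hI1 : IntervalIntegrable (fun s => deriv η s • A s) volume a b :=
      (hη'.continuousOn.smul hAc).intervalIntegrable_of_Icc hab.le
    have hI2 : IntervalIntegrable (fun s => η s • f s) volume a b :=
      hf.continuousOn_smul h1.continuous.continuousOn
    have hI3 : IntervalIntegrable (fun s => deriv η s • u s) volume a b :=
      hu.continuousOn_smul hη'.continuousOn
    have e1 : ∫ s in a..b, (deriv η s • A s + η s • f s) = 0 := by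
      have h4 := integral_eq_of_hasDerivAt_off_countable_of_le (fun s => η s • A s)
        (fun s => deriv η s • A s + η s • f s) hab.le hT (h1.continuous.continuousOn.smul hAc)
        (fun s hs => ?_) (hI1.add hI2)
      · rw [h4]
        have ha : η a = 0 := image_eq_zero_of_notMem_tsupport fun h => (lt_irrefl _ (h3 h).1)
        have hb : η b = 0 := image_eq_zero_of_notMem_tsupport fun h => (lt_irrefl _ (h3 h).2)
        simp [ha, hb]
      · have h5 : HasDerivAt A (f s) s := by
          refine intervalIntegral.integral_hasDerivAt_right ?_ ?_ (hfc s hs)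
          · refine hf.mono_set ?_
            rw [uIcc_of_le hab.le, uIcc_of_le hs.1.1.le]
            exact Icc_subset_Icc_right hs.1.2.le
          · have h6 : AEStronglyMeasurable f (volume.restrict (Ioo a b)) :=
              (((intervalIntegrable_iff_integrableOn_Ioc_of_le hab.le).1 hf).mono_set
                Ioo_subset_Ioc_self).aestronglyMeasurable
            exact ⟨Ioo a b, Ioo_mem_nhds hs.1.1 hs.1.2, h6⟩
        have h7 := ((h1.differentiable (by simp)) s).hasDerivAt.smul h5
        rwa [add_comm] at h7
    have e2 : ∫ s in a..b, deriv η s • u s = -∫ s in a..b, η s • f s := by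
      have := h η h1 h2 h3
      rw [intervalIntegral.integral_add hI3 hI2] at this
      exact eq_neg_of_add_eq_zero_left this
    rw [intervalIntegral.integral_add hI1 hI2] at e1
    simp only [smul_sub]
    rw [intervalIntegral.integral_sub hI3 hI1, e2, eq_neg_of_add_eq_zero_left e1, sub_self]
  -- a test function with integral one
  obtain ⟨η₀, hη₀, hη₀c, hη₀s, hη₀I⟩ : ∃ η₀ : ℝ → ℝ, ContDiff ℝ ∞ η₀ ∧ HasCompactSupport η₀ ∧
      tsupport η₀ ⊆ Ioo a b ∧ ∫ s in a..b, η₀ s = 1 := by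
    let φ : ContDiffBump ((a + b) / 2) := ⟨(b - a) / 8, (b - a) / 4, by linarith, by linarith⟩
    have hφs : tsupport (φ.normed volume) ⊆ Ioo a b := by
      rw [φ.tsupport_normed_eq, Real.closedBall_eq_Icc]
      intro x hx
      have h1 := hx.1
      have h2 := hx.2
      simp only [φ] at h1 h2
      constructor <;> linarith
    refine ⟨φ.normed volume, φ.contDiff_normed, φ.hasCompactSupport_normed, hφs, ?_⟩
    rw [intervalIntegral.integral_of_le hab.le, ← φ.integral_normed (μ := volume)]
    refine setIntegral_eq_integral_of_forall_compl_eq_zero fun x hx => ?_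
    exact image_eq_zero_of_notMem_tsupport fun h => hx (Ioo_subset_Ioc_self (hφs h))
  set C := ∫ s in a..b, η₀ s • (u s - A s) with hC
  refine ⟨C, ?_⟩
  have hloc : LocallyIntegrableOn (fun s => u s - A s - C) (Ioo a b) := by
    refine IntegrableOn.locallyIntegrableOn ?_
    exact ((intervalIntegrable_iff_integrableOn_Ioc_of_le hab.le).1
      (hQ.sub intervalIntegrable_const)).mono_set Ioo_subset_Ioc_self
  have hz := isOpen_Ioo.ae_eq_zero_of_integral_contDiff_smul_eq_zero hloc fun ψ h1 h2 h3 => ?_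
  · filter_upwards [hz] with s hs hs'
    have := hs hs'
    rw [sub_sub, sub_eq_zero] at this
    rw [this, add_comm]
  · set c := ∫ s in a..b, ψ s with hc
    have hψi := h1.continuous.intervalIntegrable (μ := volume) a b
    have hηi := hη₀.continuous.intervalIntegrable (μ := volume) a b
    have hsup : tsupport (fun s => ψ s - c * η₀ s) ⊆ Ioo a b := by
      refine (closure_mono fun s hs => ?_ : _ ⊆ closure (tsupport ψ ∪ tsupport η₀)).trans ?_
      · by_contra h
        rw [mem_union, not_or] at h
        refine hs ?_
        simp [image_eq_zero_of_notMem_tsupport h.1, image_eq_zero_of_notMem_tsupport h.2]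
      · rw [((isClosed_tsupport ψ).union (isClosed_tsupport η₀)).closure_eq]
        exact union_subset h3 hη₀s
    have hint : ∫ s in a..b, (ψ s - c * η₀ s) = 0 := by
      rw [intervalIntegral.integral_sub hψi (hηi.const_mul c), intervalIntegral.integral_const_mul,
        hη₀I, ← hc, mul_one, sub_self]
    obtain ⟨η, e1, e2, e3, e4⟩ := exists_primitive_of_integral_eq_zero
      (h1.sub (contDiff_const.mul hη₀)) (h2.sub hη₀c.mul_left) hsup hab hint
    have := key η e1 e2 e3
    have e5 : deriv η = fun s => ψ s - c * η₀ s := funext fun s => (e4 s).deriv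
    rw [e5] at this
    have i1 : IntervalIntegrable (fun s => ψ s • (u s - A s)) volume a b :=
      hQ.continuousOn_smul h1.continuous.continuousOn
    have i2 : IntervalIntegrable (fun s => η₀ s • (u s - A s)) volume a b :=
      hQ.continuousOn_smul hη₀.continuous.continuousOn
    have e6 : ∫ s, ψ s • (u s - A s - C) = ∫ s in a..b, ψ s • (u s - A s - C) := by
      rw [intervalIntegral.integral_of_le hab.le]
      refine (setIntegral_eq_integral_of_forall_compl_eq_zero fun x hx => ?_).symm
      rw [image_eq_zero_of_notMem_tsupport fun h => hx (Ioo_subset_Ioc_self (h3 h)), zero_smul]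
    rw [e6]
    simp only [sub_smul, mul_smul] at this
    have i3 : IntervalIntegrable (fun s => c • η₀ s • (u s - A s)) volume a b := i2.smul c
    rw [intervalIntegral.integral_sub i1 i3, intervalIntegral.integral_smul, ← hC] at this
    have i4 : IntervalIntegrable (fun s => ψ s • C) volume a b :=
      (h1.continuous.smul continuous_const).intervalIntegrable _ _
    simp only [smul_sub _ _ C]
    rw [intervalIntegral.integral_sub i1 i4, intervalIntegral.integral_smul_const,
      ← hc]
    exact this

end Interval

/-! ### The Euler-Lagrange equation in a chart -/

section EulerLagrange

open MeasureTheory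

lemma intervalIntegrable_of_continuousAt_diff {V : Type*} [NormedAddCommGroup V] {a b C : ℝ}
    (hab : a ≤ b) {f : ℝ → V} {T : Set ℝ} (hT : T.Countable)
    (hf : ∀ s ∈ Ioo a b \ T, ContinuousAt f s) (hC : ∀ s ∈ Ioo a b \ T, ‖f s‖ ≤ C) :
    IntervalIntegrable f volume a b := by
  rw [intervalIntegrable_iff_integrableOn_Ioo_of_le hab]
  have hae : (Ioo a b \ T : Set ℝ) =ᵐ[volume] Ioo a b :=
    sdiff_null_ae_eq_self (hT.measure_zero _)
  rw [← integrableOn_congr_set_ae hae]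
  have hm : MeasurableSet (Ioo a b \ T) := measurableSet_Ioo.diff hT.measurableSet
  have h1 : ContinuousOn f (Ioo a b \ T) := fun s hs => (hf s hs).continuousWithinAt
  exact IntegrableOn.of_bound ((measure_mono sdiff_subset).trans_lt measure_Ioo_lt_top)
    (h1.aestronglyMeasurable hm) C ((ae_restrict_iff' hm).2 (Eventually.of_forall hC))

lemma integral_congr_Icc {V : Type*} [NormedAddCommGroup V] [NormedSpace ℝ V] {a b s : ℝ}
    {f₁ f₂ : ℝ → V} (h : ∀ᵐ s, s ∈ Ioo a b → f₁ s = f₂ s) (hs : s ∈ Icc a b) :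
    ∫ r in a..s, f₁ r = ∫ r in a..s, f₂ r := by
  refine intervalIntegral.integral_congr_ae ?_
  have hb : ∀ᵐ r : ℝ, r ≠ b := by simp [ae_iff]
  filter_upwards [h, hb] with r hr hrb hr'
  rw [uIoc_of_le hs.1] at hr'
  exact hr ⟨hr'.1, lt_of_le_of_ne (hr'.2.trans hs.2) hrb⟩

lemma hasDerivWithinAt_integral_Icc {V : Type*} [NormedAddCommGroup V] [NormedSpace ℝ V]
    [CompleteSpace V] {a b : ℝ} (hab : a ≤ b) {v : ℝ → V} (hv : ContinuousOn v (Icc a b)) {s : ℝ}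
    (hs : s ∈ Icc a b) : HasDerivWithinAt (fun s => ∫ u in a..s, v u) (v s) (Icc a b) s := by
  have h1 : Continuous (IccExtend hab ((Icc a b).domRestrict v)) :=
    (continuousOn_iff_continuous_domRestrict.1 hv).Icc_extend'
  have h2 : ∀ u ∈ Icc a b, IccExtend hab ((Icc a b).domRestrict v) u = v u := fun u hu => by
    rw [IccExtend_of_mem _ _ hu]; rfl
  have h3 : HasDerivAt (fun s => ∫ u in a..s, IccExtend hab ((Icc a b).domRestrict v) u) (v s) s := by
    rw [← h2 s hs]
    exact intervalIntegral.integral_hasDerivAt_right (h1.intervalIntegrable _ _)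
      (h1.stronglyMeasurableAtFilter _ _) h1.continuousAt
  refine h3.hasDerivWithinAt.congr (fun t ht => ?_) ?_
  all_goals
    refine intervalIntegral.integral_congr fun u hu => (h2 u ?_).symm
    rw [uIcc_of_le (by first | exact ht.1 | exact hs.1)] at hu
    first | exact ⟨hu.1, hu.2.trans ht.2⟩ | exact ⟨hu.1, hu.2.trans hs.2⟩

variable {E : Type*} [NormedAddCommGroup E] [NormedSpace ℝ E]

namespace Coeffs

variable {D : Coeffs E} {U : Set E} {x v : E} {p : E →L[ℝ] ℝ} {a b c ε : ℝ}

lemma momentum_apply_self (hD : D.IsGood U) (hz : (x, v) ∈ D.dom U) :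
    D.momentum x v v = D.F x v ^ 2 :=
  mom_apply_self (hD.inner x hz.1) (hD.l_nonneg x hz.1) hz.2

/-- Solutions of the Euler-Lagrange equation have constant speed. -/
lemma F_eq_of_eulerLagrange (hD : D.IsGood U) (hab : a < b) {x v : ℝ → E} {p : ℝ → E →L[ℝ] ℝ}
    (hdom : ∀ s ∈ Icc a b, (x s, v s) ∈ D.dom U)
    {T : Set ℝ} (hT : T.Countable) (hxT : ∀ s ∈ Ioo a b \ T, ContDiffAt ℝ ∞ x s)
    (hxd : ∀ s ∈ Icc a b, HasDerivWithinAt x (v s) (Icc a b) s)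
    (hvc : ContinuousOn v (Icc a b))
    (hpd : ∀ s ∈ Icc a b, HasDerivWithinAt p (D.force (x s) (v s)) (Icc a b) s)
    (hpm : ∀ s ∈ Icc a b, p s = D.momentum (x s) (v s)) {s : ℝ} (hs : s ∈ Icc a b) :
    D.F (x s) (v s) = D.F (x a) (v a) := by
  have hIT : ∀ s ∈ Ioo a b \ T, s ∈ Icc a b := fun s hs => Ioo_subset_Icc_self hs.1
  set e : ℝ → ℝ := fun s => 1 / 2 * D.F (x s) (v s) ^ 2 with he
  have hec : ContinuousOn e (Icc a b) := fun s hs =>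
    (hD.hasFDerivAt_energy (hdom s hs)).continuousAt.comp_continuousWithinAt
      (f := fun s => (x s, v s)) ((hxd s hs).continuousWithinAt.prodMk (hvc s hs))
  -- `p v = F²` has the derivative `force v + p v'`, and so has `F²/2`
  have hed : ∀ s ∈ Ioo a b \ T, HasDerivAt e 0 s := by
    intro s hs
    have hnb : ∀ t ∈ Ioo a b, Icc a b ∈ 𝓝 t := fun t ht => Icc_mem_nhds ht.1 ht.2
    have h1 : HasDerivAt x (v s) s := (hxd s (hIT s hs)).hasDerivAt (hnb s hs.1)
    have h2 : v =ᶠ[𝓝 s] deriv x := by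
      filter_upwards [isOpen_Ioo.mem_nhds hs.1] with t ht
      exact ((hxd t (Ioo_subset_Icc_self ht)).hasDerivAt (hnb t ht)).deriv.symm
    obtain ⟨w, hw⟩ : ∃ w, HasDerivAt v w s :=
      ⟨_, ((((hxT s hs).derivWithin (m := ∞) (by simp)).differentiableAt
        (by simp)).congr_of_eventuallyEq h2).hasDerivAt⟩
    have h3 := ((hpd s (hIT s hs)).hasDerivAt (hnb s hs.1)).clm_apply hw
    have h4 := (hD.hasFDerivAt_energy (hdom s (hIT s hs))).comp_hasDerivAt s
      (h1.prodMk hw)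
    have h5 : HasDerivAt e (D.force (x s) (v s) (v s) + D.momentum (x s) (v s) w) s := by
      refine (h4.congr_deriv ?_).congr_of_eventuallyEq (Eventually.of_forall fun _ => rfl)
      simp
    have h6 : HasDerivAt (fun s => 2 * e s)
        (D.force (x s) (v s) (v s) + D.momentum (x s) (v s) w) s := by
      rw [hpm s (hIT s hs)] at h3
      refine h3.congr_of_eventuallyEq ?_
      filter_upwards [hnb s hs.1] with t ht
      rw [hpm t ht, momentum_apply_self hD (hdom t ht)]
      ring
    have h7 := (h5.const_mul 2).unique h6
    have h8 : D.force (x s) (v s) (v s) + D.momentum (x s) (v s) w = 0 := by linarith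
    rwa [h8] at h5
  have hconst : ∀ s ∈ Icc a b, e s = e a := fun s hs => by
    have := integral_eq_of_hasDerivAt_off_countable_of_le e (fun _ => 0) hs.1 hT
      (hec.mono (Icc_subset_Icc_right hs.2))
      (fun r hr => hed r ⟨⟨hr.1.1, hr.1.2.trans_le hs.2⟩, hr.2⟩) intervalIntegrable_const
    rw [intervalIntegral.integral_zero] at this
    linarith
  have h1 := hconst s hs
  simp only [he] at h1
  have h2 := hD.F_nonneg (hdom s hs).1 (v s)
  have h3 := hD.F_nonneg (hdom a (left_mem_Icc.2 hab.le)).1 (v a)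
  exact (pow_left_inj₀ h2 h3 two_ne_zero).1 (by linarith)

variable [FiniteDimensional ℝ E]

lemma H_smul_vel_momentum (hD : D.IsGood U) (hz : (x, v) ∈ D.dom U) :
    D.H x (D.momentum x v) • D.vel x (D.momentum x v) = v := by
  rcases eq_or_ne v 0 with rfl | hv
  · rw [momentum_zero, show D.H x 0 = 0 from ham_zero, zero_smul]
  · rw [H_momentum hD hz hv, vel_momentum hD hz hv]

/-- Weakly critical curves of the energy of a Randers metric (`Λ > 0`) are of class `C¹`, solve the
Euler-Lagrange equation and have constant speed. -/
lemma exists_eulerLagrange (hD : D.IsGood U) (hl : ∀ x ∈ U, 0 < D.l x) (hab : a < b)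
    {x : ℝ → E} (hx : ContinuousOn x (Icc a b)) (hxU : ∀ s ∈ Icc a b, x s ∈ U)
    {T : Set ℝ} (hT : T.Countable) (hxT : ∀ s ∈ Ioo a b \ T, ContDiffAt ℝ ∞ x s)
    {M : ℝ} (hM : ∀ s ∈ Ioo a b \ T, ‖deriv x s‖ ≤ M)
    (hcrit : ∀ η : ℝ → ℝ, ContDiff ℝ ∞ η → HasCompactSupport η → tsupport η ⊆ Ioo a b → ∀ e : E,
      ∫ s in a..b, (D.momentum (x s) (deriv x s) (deriv η s • e) +
        D.force (x s) (deriv x s) (η s • e)) = 0) :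
    ∃ (v : ℝ → E) (p : ℝ → E →L[ℝ] ℝ) (c : ℝ), ∀ s ∈ Icc a b,
      HasDerivWithinAt x (v s) (Icc a b) s ∧
      HasDerivWithinAt p (D.force (x s) (v s)) (Icc a b) s ∧
      p s = D.momentum (x s) (v s) ∧ D.F (x s) (v s) = c := by
  have := FiniteDimensional.complete ℝ E
  have := FiniteDimensional.proper ℝ E
  have hdom : ∀ s ∈ Icc a b, ∀ v, (x s, v) ∈ D.dom U := fun s hs v =>
    ⟨hxU s hs, Or.inl (hl _ (hxU s hs))⟩
  have hIT : ∀ s ∈ Ioo a b \ T, s ∈ Icc a b := fun s hs => Ioo_subset_Icc_self hs.1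
  -- the momentum and the force along the curve are bounded, and continuous off `T`
  have hpair : ∀ s ∈ Ioo a b \ T, ContinuousAt (fun s => (x s, deriv x s)) s := fun s hs =>
    (hxT s hs).continuousAt.prodMk ((hxT s hs).derivWithin (m := 0) (by simp)).continuousAt
  have hK : IsCompact ((x '' Icc a b) ×ˢ Metric.closedBall (0 : E) M) :=
    (isCompact_Icc.image_of_continuousOn hx).prod (isCompact_closedBall 0 M)
  have hKd : ∀ z ∈ (x '' Icc a b) ×ˢ Metric.closedBall (0 : E) M, z ∈ D.dom U := by
    rintro ⟨_, v⟩ ⟨⟨s, hs, rfl⟩, -⟩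
    exact hdom s hs v
  have hKs : ∀ s ∈ Ioo a b \ T, (x s, deriv x s) ∈ (x '' Icc a b) ×ˢ Metric.closedBall (0 : E) M :=
    fun s hs => ⟨⟨s, hIT s hs, rfl⟩, by simpa using hM s hs⟩
  obtain ⟨C₁, hC₁⟩ := hK.exists_bound_of_continuousOn (f := fun z : E × E => D.momentum z.1 z.2)
    fun z hz => (hD.continuousAt_momentum (hKd z hz)).continuousWithinAt
  obtain ⟨C₂, hC₂⟩ := hK.exists_bound_of_continuousOn (f := fun z : E × E => D.force z.1 z.2)
    fun z hz => (hD.continuousAt_force (hKd z hz)).continuousWithinAt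
  set u : ℝ → E →L[ℝ] ℝ := fun s => D.momentum (x s) (deriv x s) with hu
  set f : ℝ → E →L[ℝ] ℝ := fun s => D.force (x s) (deriv x s) with hf
  have huc : ∀ s ∈ Ioo a b \ T, ContinuousAt u s := fun s hs =>
    ContinuousAt.comp (f := fun s => (x s, deriv x s)) (g := fun z : E × E => D.momentum z.1 z.2)
      (hD.continuousAt_momentum (hdom s (hIT s hs) (deriv x s))) (hpair s hs)
  have hfc : ∀ s ∈ Ioo a b \ T, ContinuousAt f s := fun s hs =>
    ContinuousAt.comp (f := fun s => (x s, deriv x s)) (g := fun z : E × E => D.force z.1 z.2)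
      (hD.continuousAt_force (hdom s (hIT s hs) (deriv x s))) (hpair s hs)
  have huI : IntervalIntegrable u volume a b :=
    intervalIntegrable_of_continuousAt_diff hab.le hT huc (C := C₁) (fun s hs => hC₁ (x s, deriv x s) (hKs s hs))
  have hfI : IntervalIntegrable f volume a b :=
    intervalIntegrable_of_continuousAt_diff hab.le hT hfc (C := C₂) (fun s hs => hC₂ (x s, deriv x s) (hKs s hs))
  have hdI : IntervalIntegrable (deriv x) volume a b :=
    intervalIntegrable_of_continuousAt_diff hab.le hT (fun s hs => (hpair s hs).snd) hM
  -- the momentum is almost everywhere a primitive of the force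
  obtain ⟨C, hC⟩ := ae_eq_add_integral_of_forall_integral_eq_zero hab huI hfI hT hfc
    fun η h1 h2 h3 => by
      have hη' : Continuous (deriv η) := h1.continuous_deriv (by simp)
      have i1 : IntervalIntegrable (fun s => deriv η s • u s + η s • f s) volume a b :=
        (huI.continuousOn_smul hη'.continuousOn).add
          (hfI.continuousOn_smul h1.continuous.continuousOn)
      ext e
      rw [ContinuousLinearMap.intervalIntegral_apply i1, zero_apply, ← hcrit η h1 h2 h3 e]
      refine intervalIntegral.integral_congr fun s _ => ?_
      simp [hu, hf]
  set p : ℝ → E →L[ℝ] ℝ := fun s => C + ∫ r in a..s, f r with hp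
  have hpc : ContinuousOn p (Icc a b) := by
    have := intervalIntegral.continuousOn_primitive_interval (μ := volume) (f := f) (a := a) (b := b)
      ((intervalIntegrable_iff_integrableOn_Icc_of_le hab.le).1 hfI |>.mono_set (by
        rw [uIcc_of_le hab.le]))
    rw [uIcc_of_le hab.le] at this
    exact continuousOn_const.add this
  -- the inverse Legendre transform of the continuous function `p` is the velocity
  set v : ℝ → E := fun s => D.H (x s) (p s) • D.vel (x s) (p s) with hv
  have hvc : ContinuousOn v (Icc a b) := fun s hs =>
    (hD.continuousAt_H_smul_vel (hxU s hs) (p s)).comp_continuousWithinAt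
      (f := fun s => (x s, p s)) ((hx s hs).prodMk (hpc s hs))
  have hvae : ∀ᵐ s, s ∈ Ioo a b → deriv x s = v s := by
    filter_upwards [hC] with s hs hs'
    have h1 := H_smul_vel_momentum hD (hdom s (Ioo_subset_Icc_self hs') (deriv x s))
    have h2 : D.momentum (x s) (deriv x s) = p s := hs hs'
    rw [h2] at h1
    exact h1.symm
  have hxv : ∀ s ∈ Icc a b, x s = x a + ∫ r in a..s, v r := by
    intro s hs
    have h1 := integral_eq_of_hasDerivAt_off_countable_of_le x (deriv x) hs.1 hT
      (hx.mono (Icc_subset_Icc_right hs.2))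
      (fun r hr => ((hxT r ⟨⟨hr.1.1, hr.1.2.trans_le hs.2⟩, hr.2⟩).differentiableAt
        (by simp)).hasDerivAt)
      (hdI.mono_set (by rw [uIcc_of_le hab.le, uIcc_of_le hs.1]; exact Icc_subset_Icc_right hs.2))
    rw [← integral_congr_Icc hvae hs, h1, add_sub_cancel]
  have hxd : ∀ s ∈ Icc a b, HasDerivWithinAt x (v s) (Icc a b) s := fun s hs =>
    ((hasDerivWithinAt_integral_Icc hab.le hvc hs).const_add (x a)).congr hxv (hxv s hs)
  have hpm : ∀ s ∈ Icc a b, p s = D.momentum (x s) (v s) := fun s hs =>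
    (mom_ham_smul_dir (hD.inner _ (hxU s hs)) (hl _ (hxU s hs)) (hD.θ_ne _ (hxU s hs)) (p s)).symm
  have hFc : ContinuousOn (fun s => D.force (x s) (v s)) (Icc a b) := fun s hs =>
    (hD.continuousAt_force (hdom s hs (v s))).comp_continuousWithinAt
      (f := fun s => (x s, v s)) ((hx s hs).prodMk (hvc s hs))
  have hpf : ∀ s ∈ Icc a b, p s = C + ∫ r in a..s, D.force (x r) (v r) := fun s hs => by
    rw [hp]
    simp only
    rw [integral_congr_Icc (f₁ := f) (f₂ := fun r => D.force (x r) (v r)) ?_ hs]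
    filter_upwards [hvae] with r hr hr'
    rw [hf]
    simp only
    rw [hr hr']
  have hpd : ∀ s ∈ Icc a b, HasDerivWithinAt p (D.force (x s) (v s)) (Icc a b) s := fun s hs =>
    ((hasDerivWithinAt_integral_Icc hab.le hFc hs).const_add C).congr hpf (hpf s hs)
  refine ⟨v, p, D.F (x a) (v a), fun s hs => ⟨hxd s hs, hpd s hs, hpm s hs, ?_⟩⟩
  exact F_eq_of_eulerLagrange hD hab (fun s hs => hdom s hs (v s)) hT hxT hxd hvc hpd hpm hs

end Coeffs

end EulerLagrange

/-! ### The first variation of the energy in a chart -/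

section Variation

open MeasureTheory

variable {E : Type*} [NormedAddCommGroup E] [NormedSpace ℝ E]

/-- The strip on which a smooth piece of a variation is defined. -/
def strip (δ a b : ℝ) : Set (ℝ × ℝ) := Ioo (-δ) δ ×ˢ Icc a b

/-- The velocity `∂X/∂s` of a variation, up to the boundary of the strip. -/
def stripVel (δ a b : ℝ) (X : ℝ × ℝ → E) (z : ℝ × ℝ) : E :=
  fderivWithin ℝ X (strip δ a b) z (0, 1)

/-- The variation field `∂X/∂r` of a variation, up to the boundary of the strip. -/
def stripVar (δ a b : ℝ) (X : ℝ × ℝ → E) (z : ℝ × ℝ) : E :=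
  fderivWithin ℝ X (strip δ a b) z (1, 0)

variable {δ a b : ℝ} {X : ℝ × ℝ → E}

lemma uniqueDiffOn_strip (δ : ℝ) (hab : a < b) : UniqueDiffOn ℝ (strip δ a b) :=
  (uniqueDiffOn_Ioo _ _).prod (uniqueDiffOn_Icc hab)

lemma contDiffOn_stripVel (hab : a < b) (hX : ContDiffOn ℝ ∞ X (strip δ a b)) :
    ContDiffOn ℝ ∞ (stripVel δ a b X) (strip δ a b) :=
  (hX.fderivWithin (uniqueDiffOn_strip δ hab) (by simp)).clm_apply contDiffOn_const

lemma contDiffOn_stripVar (hab : a < b) (hX : ContDiffOn ℝ ∞ X (strip δ a b)) :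
    ContDiffOn ℝ ∞ (stripVar δ a b X) (strip δ a b) :=
  (hX.fderivWithin (uniqueDiffOn_strip δ hab) (by simp)).clm_apply contDiffOn_const

lemma strip_mem_nhds {r s : ℝ} (hr : r ∈ Ioo (-δ) δ) (hs : s ∈ Ioo a b) :
    strip δ a b ∈ 𝓝 (r, s) :=
  prod_mem_nhds (Ioo_mem_nhds hr.1 hr.2) (Icc_mem_nhds hs.1 hs.2)

lemma hasDerivAt_left {V : Type*} [NormedAddCommGroup V] [NormedSpace ℝ V] {f : ℝ × ℝ → V}
    {f' : ℝ × ℝ →L[ℝ] V} {r s : ℝ} (hf : HasFDerivAt f f' (r, s)) :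
    HasDerivAt (fun r => f (r, s)) (f' (1, 0)) r :=
  hf.comp_hasDerivAt r ((hasDerivAt_id r).prodMk (hasDerivAt_const r s))

lemma hasDerivAt_right {V : Type*} [NormedAddCommGroup V] [NormedSpace ℝ V] {f : ℝ × ℝ → V}
    {f' : ℝ × ℝ →L[ℝ] V} {r s : ℝ} (hf : HasFDerivAt f f' (r, s)) :
    HasDerivAt (fun s => f (r, s)) (f' (0, 1)) s :=
  hf.comp_hasDerivAt s ((hasDerivAt_const s r).prodMk (hasDerivAt_id s))

lemma hasFDerivAt_strip {V : Type*} [NormedAddCommGroup V] [NormedSpace ℝ V] {f : ℝ × ℝ → V}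
    (hf : ContDiffOn ℝ ∞ f (strip δ a b)) {r s : ℝ} (hr : r ∈ Ioo (-δ) δ) (hs : s ∈ Ioo a b) :
    HasFDerivAt f (fderivWithin ℝ f (strip δ a b) (r, s)) (r, s) :=
  ((hf.differentiableOn (by simp)) _ (mem_of_mem_nhds (strip_mem_nhds hr hs))).hasFDerivWithinAt
    |>.hasFDerivAt (strip_mem_nhds hr hs)

/-- The partial derivatives in the time and in the parameter commute. -/
lemma hasDerivAt_stripVar_time (hab : a < b) (hX : ContDiffOn ℝ ∞ X (strip δ a b)) {r s : ℝ}
    (hr : r ∈ Ioo (-δ) δ) (hs : s ∈ Ioo a b) :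
    HasDerivAt (fun s => stripVar δ a b X (r, s)) (stripVar δ a b (stripVel δ a b X) (r, s)) s := by
  have h1 := hasDerivAt_right (hasFDerivAt_strip (contDiffOn_stripVar hab hX) hr hs)
  refine h1.congr_deriv ?_
  have hQ := strip_mem_nhds hr hs
  have hc : ContDiffAt ℝ ∞ X (r, s) := hX.contDiffAt hQ
  have hd : HasFDerivAt (fderiv ℝ X) (fderiv ℝ (fderiv ℝ X) (r, s)) (r, s) :=
    ((hc.fderiv_right (m := ∞) (by simp)).differentiableAt (by simp)).hasFDerivAt
  have hev : ∀ w : ℝ × ℝ, (fun z => fderivWithin ℝ X (strip δ a b) z w) =ᶠ[𝓝 (r, s)]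
      fun z => fderiv ℝ X z w := fun w => by
    filter_upwards [eventually_mem_nhds_iff.2 hQ] with z hz
    rw [fderivWithin_of_mem_nhds hz]
  have hw : ∀ w : ℝ × ℝ, HasFDerivAt (fun z => fderivWithin ℝ X (strip δ a b) z w)
      ((fderiv ℝ (fderiv ℝ X) (r, s)).flip w) (r, s) := fun w => by
    refine HasFDerivAt.congr_of_eventuallyEq ?_ (hev w)
    refine (hd.clm_apply (hasFDerivAt_const w (r, s))).congr_fderiv ?_
    ext <;> simp
  have e1 : fderivWithin ℝ (stripVar δ a b X) (strip δ a b) (r, s) =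
      (fderiv ℝ (fderiv ℝ X) (r, s)).flip (1, 0) := by
    rw [fderivWithin_of_mem_nhds hQ]
    exact (hw (1, 0)).fderiv
  have e2 : fderivWithin ℝ (stripVel δ a b X) (strip δ a b) (r, s) =
      (fderiv ℝ (fderiv ℝ X) (r, s)).flip (0, 1) := by
    rw [fderivWithin_of_mem_nhds hQ]
    exact (hw (0, 1)).fderiv
  rw [e1, stripVar, e2]
  have h2 : minSmoothness ℝ 2 ≤ ∞ := by
    rw [minSmoothness_of_isRCLikeNormedField]
    exact WithTop.coe_le_coe.2 (le_top : (2 : ℕ∞) ≤ ⊤)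
  exact (hc.isSymmSndFDerivAt h2).eq _ _

namespace Coeffs

variable {D : Coeffs E} {U : Set E}

/-- The derivative of the energy density of a variation at the time `s`. -/
lemma hasDerivAt_energy_strip (hD : D.IsGood U) (hδ : 0 < δ) (hab : a < b)
    (hX : ContDiffOn ℝ ∞ X (strip δ a b)) {s : ℝ} (hs : s ∈ Ioo a b)
    (hdom : (X (0, s), stripVel δ a b X (0, s)) ∈ D.dom U) :
    HasDerivAt (fun r => 1 / 2 * D.F (X (r, s)) (stripVel δ a b X (r, s)) ^ 2)
      (D.force (X (0, s)) (stripVel δ a b X (0, s)) (stripVar δ a b X (0, s)) +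
        D.momentum (X (0, s)) (stripVel δ a b X (0, s))
          (stripVar δ a b (stripVel δ a b X) (0, s))) 0 := by
  have h0 : (0 : ℝ) ∈ Ioo (-δ) δ := ⟨by linarith, hδ⟩
  have h1 := hasDerivAt_left (hasFDerivAt_strip hX h0 hs)
  have h2 := hasDerivAt_left (hasFDerivAt_strip (contDiffOn_stripVel hab hX) h0 hs)
  have h3 := (hD.hasFDerivAt_energy hdom).comp_hasDerivAt (0 : ℝ) (h1.prodMk h2)
  refine (h3.congr_deriv ?_).congr_of_eventuallyEq (Eventually.of_forall fun _ => rfl)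
  simp [stripVar]

/-- Differentiation under the integral sign, on a short time interval, for the energy of a
variation. -/
lemma hasDerivAt_integral_energy_strip (hD : D.IsGood U) (hδ : 0 < δ) (hab : a < b)
    (hX : ContDiffOn ℝ ∞ X (strip δ a b)) {s₀ : ℝ} (hs₀ : s₀ ∈ Icc a b)
    (hdom : (X (0, s₀), stripVel δ a b X (0, s₀)) ∈ D.dom U) {e : ℝ → ℝ → ℝ}
    (he : ∀ r ∈ Ioo (-δ) δ, ∀ s ∈ Ioo a b,
      e r s = 1 / 2 * D.F (X (r, s)) (stripVel δ a b X (r, s)) ^ 2) :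
    ∃ ρ > 0, ∀ a' b', a ≤ a' → a' ≤ b' → b' ≤ b → s₀ - ρ < a' → b' < s₀ + ρ →
      (∀ᶠ r in 𝓝 0, IntervalIntegrable (e r) volume a' b') ∧
      IntervalIntegrable (fun s => deriv (fun r => e r s) 0) volume a' b' ∧
      HasDerivAt (fun r => ∫ s in a'..b', e r s) (∫ s in a'..b', deriv (fun r => e r s) 0) 0 := by
  have h0 : (0 : ℝ) ∈ Ioo (-δ) δ := ⟨by linarith, hδ⟩
  have hQ₀ : (0, s₀) ∈ strip δ a b := ⟨h0, hs₀⟩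
  have hY := contDiffOn_stripVel hab hX
  have hXY : ContDiffOn ℝ ∞ (fun z => (X z, stripVel δ a b X z)) (strip δ a b) := hX.prodMk hY
  have hconv : Convex ℝ (strip δ a b) := (convex_Ioo _ _).prod (convex_Icc _ _)
  -- `F²/2` is strictly differentiable, hence locally Lipschitz: this gives the dominating constant
  obtain ⟨K, N, hN, hKN⟩ := (hD.hasStrictFDerivAt_energy hdom).exists_lipschitzOnWith
  obtain ⟨K', t, ht, hK't⟩ := ((hXY _ hQ₀).of_le (by simp)).exists_lipschitzOnWith hconv
  have hN' : N ∩ D.dom U ∈ 𝓝 (X (0, s₀), stripVel δ a b X (0, s₀)) :=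
    inter_mem hN (hD.isOpen_dom.mem_nhds hdom)
  have hm := inter_mem ht ((hXY _ hQ₀).continuousWithinAt hN')
  obtain ⟨ρ', hρ', hsub⟩ := Metric.mem_nhdsWithin_iff.1 hm
  set ρ := min ρ' δ with hρ
  have hρ0 : 0 < ρ := lt_min hρ' hδ
  have hgood : ∀ r ∈ Ioo (-ρ) ρ, ∀ s ∈ Icc a b, s₀ - ρ < s → s < s₀ + ρ →
      (r, s) ∈ strip δ a b ∧ (r, s) ∈ t ∧ (X (r, s), stripVel δ a b X (r, s)) ∈ N ∩ D.dom U := by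
    intro r hr s hs h1 h2
    have h3 : ρ ≤ ρ' := min_le_left _ _
    have h4 : ρ ≤ δ := min_le_right _ _
    have hst : (r, s) ∈ strip δ a b := ⟨⟨by linarith [hr.1], by linarith [hr.2]⟩, hs⟩
    have hball : (r, s) ∈ Metric.ball ((0 : ℝ), s₀) ρ' := by
      rw [Metric.mem_ball, Prod.dist_eq, max_lt_iff, Real.dist_eq, Real.dist_eq, abs_lt, abs_lt]
      exact ⟨⟨by linarith [hr.1], by linarith [hr.2]⟩, by linarith, by linarith⟩
    have := hsub ⟨hball, hst⟩
    exact ⟨hst, this.1, this.2⟩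
  refine ⟨ρ, hρ0, fun a' b' ha hab' hb hρa hρb => ?_⟩
  have hI : ∀ s ∈ Icc a' b', s ∈ Icc a b ∧ s₀ - ρ < s ∧ s < s₀ + ρ := fun s hs =>
    ⟨⟨ha.trans hs.1, hs.2.trans hb⟩, hρa.trans_le hs.1, hs.2.trans_lt hρb⟩
  have hI' : ∀ s ∈ Ioo a' b', s ∈ Ioo a b := fun s hs => ⟨ha.trans_lt hs.1, hs.2.trans_le hb⟩
  have hρr : ∀ r ∈ Ioo (-ρ) ρ, r ∈ Ioo (-δ) δ := fun r hr => by
    have h4 : ρ ≤ δ := min_le_right _ _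
    exact ⟨by linarith [hr.1], by linarith [hr.2]⟩
  have hcurve : ∀ r ∈ Ioo (-ρ) ρ,
      ContinuousOn (fun s => (X (r, s), stripVel δ a b X (r, s))) (Icc a' b') := fun r hr =>
    hXY.continuousOn.comp (Continuous.continuousOn (by fun_prop))
      fun s hs => (hgood r hr s (hI s hs).1 (hI s hs).2.1 (hI s hs).2.2).1
  have hae : ∀ᵐ s : ℝ, s ∈ uIoc a' b' → s ∈ Ioo a' b' := by
    have hb : ∀ᵐ r : ℝ, r ≠ b' := by simp [ae_iff]
    filter_upwards [hb] with r hr hr'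
    rw [uIoc_of_le hab'] at hr'
    exact ⟨hr'.1, lt_of_le_of_ne hr'.2 hr⟩
  have hcont : ∀ r ∈ Ioo (-ρ) ρ, IntervalIntegrable (e r) volume a' b' := by
    intro r hr
    have h1 : ContinuousOn (fun s => 1 / 2 * D.F (X (r, s)) (stripVel δ a b X (r, s)) ^ 2)
        (Icc a' b') := fun s hs =>
      (hD.hasFDerivAt_energy (hgood r hr s (hI s hs).1 (hI s hs).2.1
        (hI s hs).2.2).2.2.2).continuousAt.comp_continuousWithinAt
        (f := fun s => (X (r, s), stripVel δ a b X (r, s))) (hcurve r hr s hs)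
    refine (h1.intervalIntegrable_of_Icc hab').congr_ae ?_
    rw [EventuallyEq, ae_restrict_iff' measurableSet_uIoc]
    filter_upwards [hae] with s hs hs'
    exact (he r (hρr r hr) s (hI' s (hs hs'))).symm
  have h0ρ : (0 : ℝ) ∈ Ioo (-ρ) ρ := ⟨by linarith, hρ0⟩
  have hev : ∀ᶠ r in 𝓝 (0 : ℝ), IntervalIntegrable (e r) volume a' b' := by
    filter_upwards [Ioo_mem_nhds h0ρ.1 h0ρ.2] with r hr using hcont r hr
  have hderiv : ∀ s ∈ Ioo a' b', HasDerivAt (fun r => e r s)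
      (D.force (X (0, s)) (stripVel δ a b X (0, s)) (stripVar δ a b X (0, s)) +
        D.momentum (X (0, s)) (stripVel δ a b X (0, s))
          (stripVar δ a b (stripVel δ a b X) (0, s))) 0 := by
    intro s hs
    have hsI := hI s (Ioo_subset_Icc_self hs)
    refine (hasDerivAt_energy_strip hD hδ hab hX (hI' s hs)
      (hgood 0 h0ρ s hsI.1 hsI.2.1 hsI.2.2).2.2.2).congr_of_eventuallyEq ?_
    filter_upwards [Ioo_mem_nhds h0.1 h0.2] with r hr using he r hr s (hI' s hs)
  have hmeas : AEStronglyMeasurable (fun s => deriv (fun r => e r s) 0)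
      (volume.restrict (uIoc a' b')) := by
    have hg : ContinuousOn (fun s =>
        (D.force (X (0, s)) (stripVel δ a b X (0, s)) (stripVar δ a b X (0, s)) +
        D.momentum (X (0, s)) (stripVel δ a b X (0, s))
          (stripVar δ a b (stripVel δ a b X) (0, s)))) (Icc a' b') := by
      have hmap : MapsTo (fun s : ℝ => ((0 : ℝ), s)) (Icc a' b') (strip δ a b) :=
        fun s hs => ⟨h0, (hI s hs).1⟩
      have hi : ContinuousOn (fun s : ℝ => ((0 : ℝ), s)) (Icc a' b') :=
        Continuous.continuousOn (by fun_prop)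
      have h1 := (contDiffOn_stripVar hab hX).continuousOn.comp hi hmap
      have h2 := (contDiffOn_stripVar hab hY).continuousOn.comp hi hmap
      have hd : ∀ s ∈ Icc a' b', (X (0, s), stripVel δ a b X (0, s)) ∈ D.dom U := fun s hs =>
        (hgood 0 h0ρ s (hI s hs).1 (hI s hs).2.1 (hI s hs).2.2).2.2.2
      have h3 : ContinuousOn (fun s => D.force (X (0, s)) (stripVel δ a b X (0, s)))
          (Icc a' b') := fun s hs =>
        (hD.continuousAt_force (hd s hs)).comp_continuousWithinAt
          (f := fun s => (X (0, s), stripVel δ a b X (0, s))) (hcurve 0 h0ρ s hs)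
      have h4 : ContinuousOn (fun s => D.momentum (X (0, s)) (stripVel δ a b X (0, s)))
          (Icc a' b') := fun s hs =>
        (hD.continuousAt_momentum (hd s hs)).comp_continuousWithinAt
          (f := fun s => (X (0, s), stripVel δ a b X (0, s))) (hcurve 0 h0ρ s hs)
      exact (h3.clm_apply h1).add (h4.clm_apply h2)
    have h5 := (hg.mono Ioc_subset_Icc_self).aestronglyMeasurable (μ := volume) measurableSet_Ioc
    rw [← uIoc_of_le hab'] at h5
    refine h5.congr ?_
    rw [EventuallyEq, ae_restrict_iff' measurableSet_uIoc]
    filter_upwards [hae] with s hs hs'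
    exact (hderiv s (hs hs')).deriv.symm
  refine ⟨hev, intervalIntegral.hasDerivAt_integral_of_dominated_loc_of_lip
    (s := Ioo (-ρ) ρ) (bound := fun _ => (K * K' : ℝ)) (Ioo_mem_nhds h0ρ.1 h0ρ.2) ?_
    (hcont 0 h0ρ) hmeas ?_ intervalIntegrable_const ?_⟩
  · filter_upwards [hev] with r hr
    exact hr.aestronglyMeasurable_restrict_uIoc
  · filter_upwards [hae] with s hs hs'
    have hsI := hI s (Ioo_subset_Icc_self (hs hs'))
    have hK : Real.nnabs ((K : ℝ) * K') = K * (K' * 1) := by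
      ext; simp
    rw [hK]
    have hl1 : LipschitzOnWith 1 (fun r : ℝ => (r, s)) (Ioo (-ρ) ρ) :=
      (LipschitzWith.prodMk_right s).lipschitzOnWith
    have hl2 := hK't.comp hl1 fun r hr => (hgood r hr s hsI.1 hsI.2.1 hsI.2.2).2.1
    have hl3 := hKN.comp hl2 fun r hr => (hgood r hr s hsI.1 hsI.2.1 hsI.2.2).2.2.1
    refine fun r hr r' hr' => ?_
    simp only [he r (hρr r hr) s (hI' s (hs hs')), he r' (hρr r' hr') s (hI' s (hs hs'))]
    exact hl3 hr hr'
  · filter_upwards [hae] with s hs hs'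
    exact (hderiv s (hs hs')).differentiableAt.hasDerivAt

end Coeffs

end Variation

/-! ### Charts of the manifold -/

section Chart

variable {m : ℕ} {S : Type*} [TopologicalSpace S]
  [ChartedSpace (EuclideanSpace ℝ (Fin m)) S]

lemma randersKropinaDomain_eq_univ {θ : OneForm m S} {Λ : S → ℝ}
    (hΛ : ∀ x, 0 < Λ x) :
    randersKropinaDomain θ Λ = univ :=
  eq_univ_of_forall fun _ => Or.inl (hΛ _)

variable [IsManifold (𝓡 m) ∞ S]

instance instIsManifoldOne : IsManifold (𝓡 m) 1 S := .of_le (n := ∞) (by simp)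

/-- The frame of the tangent space at `z` given by the chart at `y`. -/
def frame (m : ℕ) {S : Type*} [TopologicalSpace S] [ChartedSpace (EuclideanSpace ℝ (Fin m)) S]
    [IsManifold (𝓡 m) ∞ S] (y z : S) : EuclideanSpace ℝ (Fin m) →L[ℝ] TangentSpace (𝓡 m) z :=
  (trivializationAt (EuclideanSpace ℝ (Fin m)) (TangentSpace (𝓡 m)) y).symmL ℝ z

/-- The coordinates of the tangent vector `v` in the chart at `y`. -/
def coord (y : S) (v : TangentBundle (𝓡 m) S) : EuclideanSpace ℝ (Fin m) :=
  mfderiv (𝓡 m) 𝓘(ℝ, EuclideanSpace ℝ (Fin m)) (extChartAt (𝓡 m) y) v.1 v.2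

lemma mem_baseSet {y z : S} (hz : z ∈ (extChartAt (𝓡 m) y).source) :
    z ∈ (trivializationAt (EuclideanSpace ℝ (Fin m)) (TangentSpace (𝓡 m)) y).baseSet := by
  rw [TangentBundle.trivializationAt_baseSet]
  rwa [extChartAt_source] at hz

lemma coord_eq {y z : S} (hz : z ∈ (extChartAt (𝓡 m) y).source) (v : TangentSpace (𝓡 m) z) :
    coord y ⟨z, v⟩ = (trivializationAt (EuclideanSpace ℝ (Fin m)) (TangentSpace (𝓡 m)) y
      ).continuousLinearMapAt ℝ z v := by
  rw [extChartAt_source] at hz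
  rw [TangentBundle.continuousLinearMapAt_trivializationAt hz]
  rfl

lemma frame_coord {y z : S} (hz : z ∈ (extChartAt (𝓡 m) y).source) (v : TangentSpace (𝓡 m) z) :
    frame m y z (coord y ⟨z, v⟩) = v := by
  rw [coord_eq hz, frame, Trivialization.symmL_continuousLinearMapAt _ (mem_baseSet hz)]

lemma coord_frame {y z : S} (hz : z ∈ (extChartAt (𝓡 m) y).source)
    (w : EuclideanSpace ℝ (Fin m)) : coord y ⟨z, frame m y z w⟩ = w := by
  rw [coord_eq hz, frame, Trivialization.continuousLinearMapAt_symmL _ (mem_baseSet hz)]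

lemma frame_injective {y z : S} (hz : z ∈ (extChartAt (𝓡 m) y).source) :
    Function.Injective (frame m y z) := fun u v h => by
  rw [← coord_frame hz u, h, coord_frame hz]

/-- The coefficients of a Randers-Kropina metric in the chart at `y`. Replacing `Λ` by `Λ + ε`
amounts, by definition, to applying `Coeffs.add ε`. -/
def chartCoeffs (g₀ : RMetric m S) (θ : OneForm m S) (Λ : S → ℝ) (y : S) :
    Coeffs (EuclideanSpace ℝ (Fin m)) where
  g x := ((ContinuousLinearMap.precomp ℝ (frame m y ((extChartAt (𝓡 m) y).symm x))).comp
    (g₀.inner ((extChartAt (𝓡 m) y).symm x))).comp (frame m y ((extChartAt (𝓡 m) y).symm x))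
  θ x := (θ ((extChartAt (𝓡 m) y).symm x)).comp (frame m y ((extChartAt (𝓡 m) y).symm x))
  l x := Λ ((extChartAt (𝓡 m) y).symm x)

variable {g₀ : RMetric m S} {θ : OneForm m S} {Λ : S → ℝ} {y : S}

lemma contMDiffOn_frame (y : S) (u : EuclideanSpace ℝ (Fin m)) :
    ContMDiffOn (𝓡 m) ((𝓡 m).prod 𝓘(ℝ, EuclideanSpace ℝ (Fin m))) ∞
      (fun z => TotalSpace.mk' (EuclideanSpace ℝ (Fin m)) (E := TangentSpace (𝓡 m) (M := S)) z
        (frame m y z u)) (extChartAt (𝓡 m) y).source := by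
  intro z hz
  have h1 := (trivializationAt (EuclideanSpace ℝ (Fin m)) (TangentSpace (𝓡 m)) y
    ).contMDiffAt_symmL (IB := 𝓡 m) (n := ∞) (mem_baseSet hz)
  have h2 : ContMDiffAt (𝓡 m) ((𝓡 m).prod 𝓘(ℝ, EuclideanSpace ℝ (Fin m))) ∞
      (fun z : S => TotalSpace.mk' (EuclideanSpace ℝ (Fin m))
        (E := Bundle.Trivial S (EuclideanSpace ℝ (Fin m))) z u) z := by
    rw [contMDiffAt_section]
    exact contMDiffAt_const
  exact (ContMDiffAt.clm_bundle_apply (E₁ := Bundle.Trivial S (EuclideanSpace ℝ (Fin m))) h1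
    h2).contMDiffWithinAt

/-- The coefficients of a smooth Randers-Kropina metric in a chart are smooth. -/
lemma isGood_chartCoeffs (hθ : θ.IsSmooth) (hθ_ne : ∀ x, θ x ≠ 0)
    (hΛ : ContMDiff (𝓡 m) 𝓘(ℝ, ℝ) ∞ Λ) (hΛ_nonneg : ∀ x, 0 ≤ Λ x) (y : S) :
    (chartCoeffs g₀ θ Λ y).IsGood (extChartAt (𝓡 m) y).target where
  isOpen := isOpen_extChartAt_target y
  inner x hx := by
    have hz := (extChartAt (𝓡 m) y).map_target hx
    refine ⟨fun u v => g₀.symm _ _ _, fun v hv => g₀.pos _ _ ?_⟩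
    rw [← map_zero (frame m y ((extChartAt (𝓡 m) y).symm x))]
    exact (frame_injective hz).ne hv
  θ_ne x hx := by
    have hz := (extChartAt (𝓡 m) y).map_target hx
    intro h
    refine hθ_ne ((extChartAt (𝓡 m) y).symm x) (ContinuousLinearMap.ext fun v => ?_)
    have := DFunLike.congr_fun h (coord y ⟨_, v⟩)
    simp only [chartCoeffs, ContinuousLinearMap.comp_apply, frame_coord hz] at this
    exact this
  l_nonneg x _ := hΛ_nonneg _
  g_smooth := by
    rw [contDiffOn_clm_apply]
    intro u
    rw [contDiffOn_clm_apply]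
    intro v
    have h1 : ContMDiffOn (𝓡 m) 𝓘(ℝ, ℝ) ∞ (fun z => g₀.inner z (frame m y z u) (frame m y z v))
        (extChartAt (𝓡 m) y).source := by
      intro z hz
      have := ContMDiffWithinAt.clm_bundle_apply₂ (E₃ := Bundle.Trivial S ℝ)
        (g₀.contMDiff z).contMDiffWithinAt
        (contMDiffOn_frame y u z hz) (contMDiffOn_frame y v z hz)
      simp only [contMDiffWithinAt_totalSpace] at this
      exact this.2
    exact (h1.comp (contMDiffOn_extChartAt_symm y)
      fun x hx => (extChartAt (𝓡 m) y).map_target hx).contDiffOn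
  θ_smooth := by
    rw [contDiffOn_clm_apply]
    intro u
    have h1 : ContMDiffOn (𝓡 m) 𝓘(ℝ, ℝ) ∞ (fun z => θ z (frame m y z u))
        (extChartAt (𝓡 m) y).source := by
      intro z hz
      have := ContMDiffWithinAt.clm_bundle_apply (E₂ := Bundle.Trivial S ℝ)
        (hθ z).contMDiffWithinAt (contMDiffOn_frame y u z hz)
      simp only [contMDiffWithinAt_totalSpace] at this
      exact this.2
    exact (h1.comp (contMDiffOn_extChartAt_symm y)
      fun x hx => (extChartAt (𝓡 m) y).map_target hx).contDiffOn
  l_smooth := (hΛ.comp_contMDiffOn (contMDiffOn_extChartAt_symm y)).contDiffOn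

lemma chartCoeffs_g {v : TangentBundle (𝓡 m) S} (hv : v.1 ∈ (extChartAt (𝓡 m) y).source)
    (u : EuclideanSpace ℝ (Fin m)) :
    (chartCoeffs g₀ θ Λ y).g (extChartAt (𝓡 m) y v.1) (coord y v) u =
      g₀.inner v.1 v.2 (frame m y v.1 u) := by
  obtain ⟨z, w⟩ := v
  have h : ∀ z', z' = z → g₀.inner z' (frame m y z' (coord y ⟨z, w⟩)) (frame m y z' u) =
      g₀.inner z w (frame m y z u) := by
    rintro _ rfl
    rw [frame_coord hv]
  exact h _ ((extChartAt (𝓡 m) y).left_inv hv)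

lemma chartCoeffs_θ {v : TangentBundle (𝓡 m) S} (hv : v.1 ∈ (extChartAt (𝓡 m) y).source) :
    (chartCoeffs g₀ θ Λ y).θ (extChartAt (𝓡 m) y v.1) (coord y v) = θ v.1 v.2 := by
  obtain ⟨z, w⟩ := v
  have h : ∀ z', z' = z → θ z' (frame m y z' (coord y ⟨z, w⟩)) = θ z w := by
    rintro _ rfl
    rw [frame_coord hv]
  exact h _ ((extChartAt (𝓡 m) y).left_inv hv)

lemma chartCoeffs_l {z : S} (hz : z ∈ (extChartAt (𝓡 m) y).source) :
    (chartCoeffs g₀ θ Λ y).l (extChartAt (𝓡 m) y z) = Λ z := by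
  simp only [chartCoeffs, (extChartAt (𝓡 m) y).left_inv hz]

/-- The metric in a chart. -/
lemma chartCoeffs_F {v : TangentBundle (𝓡 m) S} (hv : v.1 ∈ (extChartAt (𝓡 m) y).source) :
    (chartCoeffs g₀ θ Λ y).F (extChartAt (𝓡 m) y v.1) (coord y v) = randersKropina g₀ θ Λ v := by
  rw [Coeffs.F, speed, chartCoeffs_g hv, chartCoeffs_θ hv, chartCoeffs_l hv,
    show coord y v = coord y ⟨v.1, v.2⟩ from rfl, frame_coord hv]
  rfl

/-- The domain in a chart. -/
lemma mem_dom_iff (hΛ_nonneg : ∀ x, 0 ≤ Λ x) {v : TangentBundle (𝓡 m) S}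
    (hv : v.1 ∈ (extChartAt (𝓡 m) y).source) :
    (extChartAt (𝓡 m) y v.1, coord y v) ∈
      (chartCoeffs g₀ θ Λ y).dom (extChartAt (𝓡 m) y).target ↔ v ∈ randersKropinaDomain θ Λ := by
  simp only [Coeffs.dom, mem_ofPred_eq, chartCoeffs_θ hv, chartCoeffs_l hv,
    (extChartAt (𝓡 m) y).map_source hv, true_and, randersKropinaDomain]
  have := hΛ_nonneg v.1
  constructor
  · rintro (h | h)
    · exact Or.inl h
    · rcases this.eq_or_lt with h0 | h0
      · exact Or.inr ⟨h0.symm, h⟩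
      · exact Or.inl h0
  · rintro (h | h)
    · exact Or.inl h
    · exact Or.inr h.2

lemma randers_eq (hΛ_nonneg : ∀ x, 0 ≤ Λ x) {ε : ℝ} (hε : 0 < ε) :
    randers g₀ θ Λ ε = randersKropina g₀ θ fun z => Λ z + ε := by
  ext v
  have hG : 0 ≤ g₀.inner v.1 v.2 v.2 := by
    rcases eq_or_ne v.2 0 with h | h
    · simp [h]
    · exact (g₀.pos _ _ h).le
  have h0 : g₀.inner v.1 v.2 v.2 = 0 → θ v.1 v.2 = 0 := fun h => by
    rcases eq_or_ne v.2 0 with h' | h'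
    · simp [h']
    · exact absurd h (g₀.pos _ _ h').ne'
  exact rkFun_eq_randers (add_pos_of_nonneg_of_pos (hΛ_nonneg v.1) hε) hG h0

/-! ### Velocities in a chart -/

variable {γ : ℝ → S} {s : ℝ} {I : Set ℝ}

lemma mdifferentiableAt_chart {z : S} (hz : z ∈ (extChartAt (𝓡 m) y).source) :
    MDifferentiableAt (𝓡 m) 𝓘(ℝ, EuclideanSpace ℝ (Fin m)) (extChartAt (𝓡 m) y) z :=
  mdifferentiableAt_extChartAt (by rwa [extChartAt_source] at hz)

lemma coord_mfderivWithin (hγ : MDifferentiableWithinAt 𝓘(ℝ, ℝ) (𝓡 m) γ I s)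
    (hI : UniqueDiffWithinAt ℝ I s) (hs : γ s ∈ (extChartAt (𝓡 m) y).source) :
    coord y ⟨γ s, mfderivWithin 𝓘(ℝ, ℝ) (𝓡 m) γ I s (1 : ℝ)⟩ =
      derivWithin (fun s => extChartAt (𝓡 m) y (γ s)) I s := by
  have h := mfderiv_comp_mfderivWithin s (mdifferentiableAt_chart hs) hγ
    hI.uniqueMDiffWithinAt
  rw [mfderivWithin_eq_fderivWithin] at h
  exact (DFunLike.congr_fun h (1 : ℝ)).symm

lemma coord_velocity (hγ : MDifferentiableAt 𝓘(ℝ, ℝ) (𝓡 m) γ s)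
    (hs : γ s ∈ (extChartAt (𝓡 m) y).source) :
    coord y (velocity m γ s) = deriv (fun s => extChartAt (𝓡 m) y (γ s)) s := by
  have h := coord_mfderivWithin (I := univ) (mdifferentiableWithinAt_univ.2 hγ)
    uniqueDiffWithinAt_univ hs
  rwa [mfderivWithin_univ, derivWithin_univ] at h

end Chart

/-! ### Partitions -/

section Partition

variable {N : ℕ} {t : Fin (N + 1) → ℝ} {s : ℝ}

lemma _root_.IsUnitPartition.lt (ht : IsUnitPartition t) (i : Fin N) : t i.castSucc < t i.succ :=
  ht.1 i.castSucc_lt_succ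

lemma _root_.IsUnitPartition.nonneg (ht : IsUnitPartition t) (i : Fin (N + 1)) : 0 ≤ t i := by
  rw [← ht.2.1]
  exact ht.1.monotone (Fin.zero_le i)

lemma _root_.IsUnitPartition.le_one (ht : IsUnitPartition t) (i : Fin (N + 1)) : t i ≤ 1 := by
  rw [← ht.2.2]
  exact ht.1.monotone (Fin.le_last i)

lemma _root_.IsUnitPartition.exists_mem_Ioc (ht : IsUnitPartition t) (hs : s ∈ Ioc (0 : ℝ) 1) :
    ∃ i : Fin N, s ∈ Ioc (t i.castSucc) (t i.succ) := by
  have h : ∀ k : Fin (N + 1), s ≤ t k → ∃ i : Fin N, s ∈ Ioc (t i.castSucc) (t i.succ) := by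
    intro k
    induction k using Fin.induction with
    | zero => exact fun h => absurd (ht.2.1 ▸ h) (not_le.2 hs.1)
    | succ i ih =>
      intro h
      rcases le_or_gt s (t i.castSucc) with h' | h'
      · exact ih h'
      · exact ⟨i, h', h⟩
  exact h (Fin.last N) (ht.2.2 ▸ hs.2)

lemma _root_.IsUnitPartition.exists_mem_Ico (ht : IsUnitPartition t) (hs : s ∈ Ico (0 : ℝ) 1) :
    ∃ i : Fin N, s ∈ Ico (t i.castSucc) (t i.succ) := by
  have h : ∀ k : Fin (N + 1), s < t k → ∃ i : Fin N, s ∈ Ico (t i.castSucc) (t i.succ) := by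
    intro k
    induction k using Fin.induction with
    | zero => exact fun h => absurd (ht.2.1 ▸ h) (not_lt.2 hs.1)
    | succ i ih =>
      intro h
      rcases lt_or_ge s (t i.castSucc) with h' | h'
      · exact ih h'
      · exact ⟨i, h', h⟩
  exact h (Fin.last N) (ht.2.2 ▸ hs.2)

/-- An additive property of intervals that holds for all short intervals in the pieces of a
partition holds for all intervals. -/
lemma _root_.IsUnitPartition.induction (ht : IsUnitPartition t) (W : ℝ → ℝ → Prop)
    (hadd : ∀ x y z, 0 ≤ x → x ≤ y → y ≤ z → z ≤ 1 → W x y → W y z → W x z)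
    (hloc : ∀ i : Fin N, ∀ s ∈ Icc (t i.castSucc) (t i.succ), ∃ ρ > 0, ∀ x y,
      t i.castSucc ≤ x → x ≤ y → y ≤ t i.succ → s - ρ < x → y < s + ρ → W x y)
    {a b : ℝ} (ha : 0 ≤ a) (hab : a ≤ b) (hb : b ≤ 1) : W a b := by
  have hss : ∀ s ∈ Icc (0 : ℝ) 1, W s s := by
    intro s hs
    have h : ∃ i : Fin N, s ∈ Icc (t i.castSucc) (t i.succ) := by
      rcases hs.1.eq_or_lt with h | h
      · obtain ⟨i, hi⟩ := ht.exists_mem_Ico (s := s) ⟨hs.1, by linarith⟩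
        exact ⟨i, Ico_subset_Icc_self hi⟩
      · obtain ⟨i, hi⟩ := ht.exists_mem_Ioc ⟨h, hs.2⟩
        exact ⟨i, Ioc_subset_Icc_self hi⟩
    obtain ⟨i, hi⟩ := h
    obtain ⟨ρ, hρ, h⟩ := hloc i s hi
    exact h s s hi.1 le_rfl hi.2 (by linarith) (by linarith)
  refine interval_induction hab W
    (fun x y z h1 h2 h3 h4 => hadd x y z (ha.trans h1) h2 h3 (h4.trans hb)) fun s hs => ?_
  have hs1 : s ∈ Icc (0 : ℝ) 1 := ⟨ha.trans hs.1, hs.2.trans hb⟩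
  have hl : ∃ δ > 0, ∀ x ∈ Icc a b, s - δ < x → x ≤ s → W x s := by
    rcases hs1.1.eq_or_lt with h | h
    · refine ⟨1, one_pos, fun x hx _ hxs => ?_⟩
      obtain rfl : x = s := le_antisymm hxs (by linarith [hx.1])
      exact hss x hs1
    · obtain ⟨i, hi⟩ := ht.exists_mem_Ioc ⟨h, hs1.2⟩
      obtain ⟨ρ, hρ, h⟩ := hloc i s (Ioc_subset_Icc_self hi)
      refine ⟨min ρ (s - t i.castSucc), lt_min hρ (by linarith [hi.1]), fun x _ h1 h2 => ?_⟩
      have e1 := min_le_left ρ (s - t i.castSucc)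
      have e2 := min_le_right ρ (s - t i.castSucc)
      exact h x s (by linarith) h2 hi.2 (by linarith) (by linarith)
  have hr : ∃ δ > 0, ∀ x ∈ Icc a b, s ≤ x → x < s + δ → W s x := by
    rcases hs1.2.eq_or_lt with h | h
    · refine ⟨1, one_pos, fun x hx hxs _ => ?_⟩
      obtain rfl : x = s := le_antisymm (by linarith [hx.2]) hxs
      exact hss x hs1
    · obtain ⟨i, hi⟩ := ht.exists_mem_Ico ⟨hs1.1, h⟩
      obtain ⟨ρ, hρ, h⟩ := hloc i s (Ico_subset_Icc_self hi)
      refine ⟨min ρ (t i.succ - s), lt_min hρ (by linarith [hi.2]), fun x _ h1 h2 => ?_⟩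
      have e1 := min_le_left ρ (t i.succ - s)
      have e2 := min_le_right ρ (t i.succ - s)
      exact h s x hi.1 h1 (by linarith) (by linarith) (by linarith)
  obtain ⟨δ₁, h1, h1'⟩ := hl
  obtain ⟨δ₂, h2, h2'⟩ := hr
  refine ⟨min δ₁ δ₂, lt_min h1 h2, fun x hx => ⟨fun h => h1' x hx ?_, fun h h' => h2' x hx h ?_⟩⟩
  · linarith [min_le_left δ₁ δ₂]
  · linarith [min_le_right δ₁ δ₂]

end Partition

/-! ### The first variation of the energy -/

section FirstVariation

open MeasureTheory

variable {m : ℕ} {S : Type*} [TopologicalSpace S]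
  [ChartedSpace (EuclideanSpace ℝ (Fin m)) S]
  {δ a b : ℝ} {H : ℝ → ℝ → S} {y : S} {r s : ℝ}

lemma contMDiffOn_slice
    (hH : ContMDiffOn 𝓘(ℝ, ℝ × ℝ) (𝓡 m) ∞ (fun p : ℝ × ℝ => H p.1 p.2) (strip δ a b))
    (hr : r ∈ Ioo (-δ) δ) : ContMDiffOn 𝓘(ℝ, ℝ) (𝓡 m) ∞ (H r) (Icc a b) := by
  have h1 : ContMDiff 𝓘(ℝ, ℝ) 𝓘(ℝ, ℝ × ℝ) ∞ fun s : ℝ => (r, s) :=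
    ContDiff.contMDiff (by fun_prop)
  exact hH.comp h1.contMDiffOn fun s hs => ⟨hr, hs⟩

lemma contMDiffOn_slice_left
    (hH : ContMDiffOn 𝓘(ℝ, ℝ × ℝ) (𝓡 m) ∞ (fun p : ℝ × ℝ => H p.1 p.2) (strip δ a b))
    (hs : s ∈ Icc a b) : ContMDiffOn 𝓘(ℝ, ℝ) (𝓡 m) ∞ (fun r => H r s) (Ioo (-δ) δ) := by
  have h1 : ContMDiff 𝓘(ℝ, ℝ) 𝓘(ℝ, ℝ × ℝ) ∞ fun r : ℝ => (r, s) :=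
    ContDiff.contMDiff (by fun_prop)
  exact hH.comp h1.contMDiffOn fun r hr => ⟨hr, hs⟩

/-- A variation read in a chart. -/
def chartStrip (m : ℕ) {S : Type*} [TopologicalSpace S]
    [ChartedSpace (EuclideanSpace ℝ (Fin m)) S] (y : S) (H : ℝ → ℝ → S) (z : ℝ × ℝ) : EuclideanSpace ℝ (Fin m) :=
  extChartAt (𝓡 m) y (H z.1 z.2)

/-- Short pieces of a variation lie in a chart. -/
lemma exists_strip_subset_source (hδ : 0 < δ)
    (hH : ContMDiffOn 𝓘(ℝ, ℝ × ℝ) (𝓡 m) ∞ (fun p : ℝ × ℝ => H p.1 p.2) (strip δ a b))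
    (hs : s ∈ Icc a b) (hy : H 0 s ∈ (extChartAt (𝓡 m) y).source) :
    ∃ ρ > 0, ρ ≤ δ ∧ ∀ x z, a ≤ x → z ≤ b → s - ρ < x → z < s + ρ →
      strip ρ x z ⊆ strip δ a b ∧ ∀ p ∈ strip ρ x z, H p.1 p.2 ∈ (extChartAt (𝓡 m) y).source := by
  have h1 := (hH.continuousOn (0, s) ⟨⟨by simpa using hδ, hδ⟩, hs⟩)
    (extChartAt_source_mem_nhds' hy)
  obtain ⟨ρ, hρ, hsub⟩ := Metric.mem_nhdsWithin_iff.1 h1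
  have e1 := min_le_left ρ δ
  have e2 := min_le_right ρ δ
  refine ⟨min ρ δ, lt_min hρ hδ, e2, fun x z hx hz hxs hzs => ?_⟩
  have h2 : strip (min ρ δ) x z ⊆ strip δ a b := fun p hp =>
    ⟨⟨by linarith [hp.1.1], by linarith [hp.1.2]⟩, hx.trans hp.2.1, hp.2.2.trans hz⟩
  refine ⟨h2, fun p hp => hsub ⟨?_, h2 hp⟩⟩
  rw [Metric.mem_ball, Prod.dist_eq, max_lt_iff, Real.dist_eq, Real.dist_eq, abs_lt, abs_lt]
  exact ⟨⟨by linarith [hp.1.1], by linarith [hp.1.2]⟩, by linarith [hp.2.1], by linarith [hp.2.2]⟩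

variable [IsManifold (𝓡 m) ∞ S]

lemma contDiffOn_chartStrip
    (hH : ContMDiffOn 𝓘(ℝ, ℝ × ℝ) (𝓡 m) ∞ (fun p : ℝ × ℝ => H p.1 p.2) (strip δ a b))
    (hy : ∀ z ∈ strip δ a b, H z.1 z.2 ∈ (extChartAt (𝓡 m) y).source) :
    ContDiffOn ℝ ∞ (chartStrip m y H) (strip δ a b) := by
  refine ContMDiffOn.contDiffOn ?_
  refine (contMDiffOn_extChartAt (x := y)).comp hH fun z hz => ?_
  rw [← extChartAt_source (𝓡 m)]
  exact hy z hz

lemma hasDerivWithinAt_stripVel {X : ℝ × ℝ → EuclideanSpace ℝ (Fin m)}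
    (hX : ContDiffOn ℝ ∞ X (strip δ a b)) (hr : r ∈ Ioo (-δ) δ) (hs : s ∈ Icc a b) :
    HasDerivWithinAt (fun s => X (r, s)) (stripVel δ a b X (r, s)) (Icc a b) s :=
  ((hX.differentiableOn (by simp) (r, s) ⟨hr, hs⟩).hasFDerivWithinAt).comp_hasDerivWithinAt s
    ((hasDerivWithinAt_const s _ r).prodMk (hasDerivWithinAt_id s _)) fun _ hs' => ⟨hr, hs'⟩

lemma hasDerivAt_stripVar {X : ℝ × ℝ → EuclideanSpace ℝ (Fin m)}
    (hX : ContDiffOn ℝ ∞ X (strip δ a b)) (hr : r ∈ Ioo (-δ) δ) (hs : s ∈ Icc a b) :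
    HasDerivAt (fun r => X (r, s)) (stripVar δ a b X (r, s)) r := by
  have h : HasDerivWithinAt (fun r => X (r, s)) (stripVar δ a b X (r, s)) (Ioo (-δ) δ) r :=
    ((hX.differentiableOn (by simp) (r, s) ⟨hr, hs⟩).hasFDerivWithinAt
    ).comp_hasDerivWithinAt r ((hasDerivWithinAt_id r (Ioo (-δ) δ)).prodMk
      (hasDerivWithinAt_const r _ s)) fun _ hr' => ⟨hr', hs⟩
  exact h.hasDerivAt (Ioo_mem_nhds hr.1 hr.2)

lemma coord_velocity_eq_stripVel
    (hH : ContMDiffOn 𝓘(ℝ, ℝ × ℝ) (𝓡 m) ∞ (fun p : ℝ × ℝ => H p.1 p.2) (strip δ a b))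
    (hy : ∀ z ∈ strip δ a b, H z.1 z.2 ∈ (extChartAt (𝓡 m) y).source)
    (hr : r ∈ Ioo (-δ) δ) (hs : s ∈ Ioo a b) :
    coord y (velocity m (H r) s) = stripVel δ a b (chartStrip m y H) (r, s) := by
  have hs' := Ioo_subset_Icc_self hs
  have h1 : MDifferentiableAt 𝓘(ℝ, ℝ) (𝓡 m) (H r) s :=
    ((contMDiffOn_slice hH hr).contMDiffAt (Icc_mem_nhds hs.1 hs.2)).mdifferentiableAt (by simp)
  rw [coord_velocity h1 (hy (r, s) ⟨hr, hs'⟩)]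
  exact ((hasDerivWithinAt_stripVel (contDiffOn_chartStrip hH hy) hr hs').hasDerivAt
    (Icc_mem_nhds hs.1 hs.2)).deriv

lemma coord_rightVelocity_eq_stripVel
    (hH : ContMDiffOn 𝓘(ℝ, ℝ × ℝ) (𝓡 m) ∞ (fun p : ℝ × ℝ => H p.1 p.2) (strip δ a b))
    (hy : ∀ z ∈ strip δ a b, H z.1 z.2 ∈ (extChartAt (𝓡 m) y).source)
    (hr : r ∈ Ioo (-δ) δ) (hs : s ∈ Ico a b) :
    coord y (rightVelocity m (H r) s) = stripVel δ a b (chartStrip m y H) (r, s) := by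
  have hs' := Ico_subset_Icc_self hs
  have hm : Icc a b ∈ 𝓝[Ici s] s := Icc_mem_nhdsGE_of_mem hs
  have h1 : MDifferentiableWithinAt 𝓘(ℝ, ℝ) (𝓡 m) (H r) (Ici s) s :=
    ((contMDiffOn_slice hH hr s hs').mdifferentiableWithinAt (by simp)).mono_of_mem_nhdsWithin hm
  have hu : UniqueDiffWithinAt ℝ (Ici s) s := uniqueDiffOn_Ici s s self_mem_Ici
  rw [rightVelocity, coord_mfderivWithin h1 hu (hy (r, s) ⟨hr, hs'⟩)]
  exact ((hasDerivWithinAt_stripVel (contDiffOn_chartStrip hH hy) hr hs').mono_of_mem_nhdsWithin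
    hm).derivWithin hu

lemma coord_leftVelocity_eq_stripVel
    (hH : ContMDiffOn 𝓘(ℝ, ℝ × ℝ) (𝓡 m) ∞ (fun p : ℝ × ℝ => H p.1 p.2) (strip δ a b))
    (hy : ∀ z ∈ strip δ a b, H z.1 z.2 ∈ (extChartAt (𝓡 m) y).source)
    (hr : r ∈ Ioo (-δ) δ) (hs : s ∈ Ioc a b) :
    coord y (leftVelocity m (H r) s) = stripVel δ a b (chartStrip m y H) (r, s) := by
  have hs' := Ioc_subset_Icc_self hs
  have hm : Icc a b ∈ 𝓝[Iic s] s := Icc_mem_nhdsLE_of_mem hs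
  have h1 : MDifferentiableWithinAt 𝓘(ℝ, ℝ) (𝓡 m) (H r) (Iic s) s :=
    ((contMDiffOn_slice hH hr s hs').mdifferentiableWithinAt (by simp)).mono_of_mem_nhdsWithin hm
  have hu : UniqueDiffWithinAt ℝ (Iic s) s := uniqueDiffOn_Iic s s self_mem_Iic
  rw [leftVelocity, coord_mfderivWithin h1 hu (hy (r, s) ⟨hr, hs'⟩)]
  exact ((hasDerivWithinAt_stripVel (contDiffOn_chartStrip hH hy) hr hs').mono_of_mem_nhdsWithin
    hm).derivWithin hu

variable {g₀ : RMetric m S} {θ : OneForm m S} {Λ : S → ℝ}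

/-- The energy density of the curves of a variation. -/
def density (F : TangentBundle (𝓡 m) S → ℝ) (H : ℝ → ℝ → S) (r s : ℝ) : ℝ :=
  1 / 2 * F (velocity m (H r) s) ^ 2

/-- Differentiation under the integral sign on `[a,b]` is permitted. -/
def DiffUnderIntegral (e : ℝ → ℝ → ℝ) (a b : ℝ) : Prop :=
  (∀ᶠ r in 𝓝 0, IntervalIntegrable (e r) volume a b) ∧
    IntervalIntegrable (fun s => deriv (fun r => e r s) 0) volume a b ∧
    HasDerivAt (fun r => ∫ s in a..b, e r s) (∫ s in a..b, deriv (fun r => e r s) 0) 0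

lemma DiffUnderIntegral.trans {e : ℝ → ℝ → ℝ} {a b c : ℝ} (h1 : DiffUnderIntegral e a b)
    (h2 : DiffUnderIntegral e b c) : DiffUnderIntegral e a c := by
  refine ⟨?_, h1.2.1.trans h2.2.1, ?_⟩
  · filter_upwards [h1.1, h2.1] with r h1 h2 using h1.trans h2
  · rw [← intervalIntegral.integral_add_adjacent_intervals h1.2.1 h2.2.1]
    refine (h1.2.2.add h2.2.2).congr_of_eventuallyEq ?_
    filter_upwards [h1.1, h2.1] with r h1 h2
    exact (intervalIntegral.integral_add_adjacent_intervals h1 h2).symm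

/-- Near each time, on a piece where the variation is smooth, the energy is differentiated in a chart. -/
lemma diffUnderIntegral_piece (hθ : θ.IsSmooth) (hθ_ne : ∀ x, θ x ≠ 0)
    (hΛ : ContMDiff (𝓡 m) 𝓘(ℝ, ℝ) ∞ Λ) (hΛ_nonneg : ∀ x, 0 ≤ Λ x) (hδ : 0 < δ) (hab : a < b)
    (hH : ContMDiffOn 𝓘(ℝ, ℝ × ℝ) (𝓡 m) ∞ (fun p : ℝ × ℝ => H p.1 p.2) (strip δ a b))
    (hs : s ∈ Icc a b) (hl : a < s → leftVelocity m (H 0) s ∈ randersKropinaDomain θ Λ)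
    (hr : s < b → rightVelocity m (H 0) s ∈ randersKropinaDomain θ Λ) :
    ∃ ρ > 0, ∀ x z, a ≤ x → x ≤ z → z ≤ b → s - ρ < x → z < s + ρ →
      DiffUnderIntegral (density (randersKropina g₀ θ Λ) H) x z := by
  obtain ⟨ρ, hρ, hρδ, hsub⟩ := exists_strip_subset_source hδ hH hs (mem_extChartAt_source (H 0 s))
  set y := H 0 s with hy
  set a₁ := max a (s - ρ / 2) with ha₁
  set b₁ := min b (s + ρ / 2) with hb₁
  have hab₁ : a₁ < b₁ := by
    rw [max_lt_iff, lt_min_iff, lt_min_iff]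
    exact ⟨⟨hab, by linarith [hs.1]⟩, by linarith [hs.2], by linarith⟩
  have hs₁ : s ∈ Icc a₁ b₁ :=
    ⟨max_le hs.1 (by linarith), le_min hs.2 (by linarith)⟩
  have haa : s - ρ / 2 ≤ a₁ := le_max_right _ _
  have hbb : b₁ ≤ s + ρ / 2 := min_le_right _ _
  obtain ⟨hst, hsrc⟩ := hsub a₁ b₁ (le_max_left _ _) (min_le_left _ _) (by linarith) (by linarith)
  have hH₁ := hH.mono hst
  have h0 : (0 : ℝ) ∈ Ioo (-ρ) ρ := ⟨by linarith, hρ⟩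
  have hD := isGood_chartCoeffs (g₀ := g₀) hθ hθ_ne hΛ hΛ_nonneg y
  have hdom : (chartStrip m y H (0, s), stripVel ρ a₁ b₁ (chartStrip m y H) (0, s)) ∈
      (chartCoeffs g₀ θ Λ y).dom (extChartAt (𝓡 m) y).target := by
    have hsy : (velocity m (H 0) s).1 ∈ (extChartAt (𝓡 m) y).source := mem_extChartAt_source y
    rcases hs₁.2.eq_or_lt with h | h
    · have h' : a₁ < s := h ▸ hab₁
      rw [← coord_leftVelocity_eq_stripVel hH₁ hsrc h0 ⟨h', hs₁.2⟩]
      exact (mem_dom_iff (v := leftVelocity m (H 0) s) hΛ_nonneg hsy).2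
        (hl ((le_max_left _ _).trans_lt h'))
    · rw [← coord_rightVelocity_eq_stripVel hH₁ hsrc h0 ⟨hs₁.1, h⟩]
      exact (mem_dom_iff (v := rightVelocity m (H 0) s) hΛ_nonneg hsy).2
        (hr (h.trans_le (min_le_left _ _)))
  have he : ∀ r ∈ Ioo (-ρ) ρ, ∀ s ∈ Ioo a₁ b₁, density (randersKropina g₀ θ Λ) H r s =
      1 / 2 * (chartCoeffs g₀ θ Λ y).F (chartStrip m y H (r, s))
        (stripVel ρ a₁ b₁ (chartStrip m y H) (r, s)) ^ 2 := by
    intro r hr s hs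
    rw [density, ← coord_velocity_eq_stripVel hH₁ hsrc hr hs]
    exact congrArg (fun c => 1 / 2 * c ^ 2) (chartCoeffs_F (v := velocity m (H r) s)
      (hsrc (r, s) ⟨hr, Ioo_subset_Icc_self hs⟩)).symm
  obtain ⟨ρ', hρ', h⟩ := Coeffs.hasDerivAt_integral_energy_strip hD hρ hab₁
    (contDiffOn_chartStrip hH₁ hsrc) hs₁ hdom he
  have e1 := min_le_left ρ' (ρ / 2)
  have e2 := min_le_right ρ' (ρ / 2)
  refine ⟨min ρ' (ρ / 2), lt_min hρ' (by linarith), fun x z hx hxz hz hxs hzs => ?_⟩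
  exact h x z (max_le hx (by linarith)) hxz (le_min hz (by linarith)) (by linarith) (by linarith)

/-- The first variation of the energy. -/
lemma diffUnderIntegral_of_isVariation (hθ : θ.IsSmooth) (hθ_ne : ∀ x, θ x ≠ 0)
    (hΛ : ContMDiff (𝓡 m) 𝓘(ℝ, ℝ) ∞ Λ) (hΛ_nonneg : ∀ x, 0 ≤ Λ x) {x₀ x₁ : S} {γ : ℝ → S}
    (hH : IsVariation (randersKropinaDomain θ Λ) x₀ x₁ γ δ H) :
    DiffUnderIntegral (density (randersKropina g₀ θ Λ) H) 0 1 := by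
  obtain ⟨N, t, ht, hp⟩ := hH.smooth
  have hmem := hH.mem 0 ⟨by linarith [hH.pos], hH.pos⟩
  refine ht.induction (DiffUnderIntegral (density (randersKropina g₀ θ Λ) H))
    (fun x y z _ _ _ _ h1 h2 => h1.trans h2) (fun i s hs => ?_) le_rfl zero_le_one le_rfl
  exact diffUnderIntegral_piece (a := t i.castSucc) (b := t i.succ) (H := H) hθ hθ_ne hΛ hΛ_nonneg hH.pos (ht.lt i) (hp i) hs
    (fun h => hmem.2.2.2.1 s ⟨(ht.nonneg _).trans_lt h, hs.2.trans (ht.le_one _)⟩)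
    (fun h => hmem.2.2.2.2 s ⟨(ht.nonneg _).trans hs.1, h.trans_le (ht.le_one _)⟩)

lemma hasDerivAt_energy_of_isVariation (hθ : θ.IsSmooth) (hθ_ne : ∀ x, θ x ≠ 0)
    (hΛ : ContMDiff (𝓡 m) 𝓘(ℝ, ℝ) ∞ Λ) (hΛ_nonneg : ∀ x, 0 ≤ Λ x) {x₀ x₁ : S} {γ : ℝ → S}
    (hH : IsVariation (randersKropinaDomain θ Λ) x₀ x₁ γ δ H) :
    HasDerivAt (fun r => energy (randersKropina g₀ θ Λ) (H r))
      (∫ s in (0 : ℝ)..1, deriv (fun r => density (randersKropina g₀ θ Λ) H r s) 0) 0 := by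
  refine (diffUnderIntegral_of_isVariation hθ hθ_ne hΛ hΛ_nonneg hH).2.2.congr_of_eventuallyEq
    (Eventually.of_forall fun r => ?_)
  simp only [density, energy]
  rw [intervalIntegral.integral_const_mul]

end FirstVariation

/-! ### Critical curves of Randers metrics -/

section Randers

open MeasureTheory

variable {m : ℕ} {S : Type*} [TopologicalSpace S]
  [ChartedSpace (EuclideanSpace ℝ (Fin m)) S] {γ γ' : ℝ → S} {y : S}
  {a b δ : ℝ} {η : ℝ → ℝ} {e : EuclideanSpace ℝ (Fin m)}

lemma velocity_congr {s : ℝ} (h : γ =ᶠ[𝓝 s] γ') : velocity m γ s = velocity m γ' s := by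
  have h1 : mfderiv 𝓘(ℝ, ℝ) (𝓡 m) γ s = mfderiv 𝓘(ℝ, ℝ) (𝓡 m) γ' s := h.mfderiv_eq
  have h2 : @Eq (EuclideanSpace ℝ (Fin m)) (mfderiv 𝓘(ℝ, ℝ) (𝓡 m) γ s (1 : ℝ))
    (mfderiv 𝓘(ℝ, ℝ) (𝓡 m) γ' s (1 : ℝ)) := DFunLike.congr_fun h1 (1 : ℝ)
  exact TotalSpace.ext h.eq_of_nhds (heq_of_eq h2)

/-- The curve `γ`, moved in the chart at `y` by `r η e` on the interval `(a,b)`. -/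
def shift (y : S) (γ : ℝ → S) (a b : ℝ) (η : ℝ → ℝ) (e : EuclideanSpace ℝ (Fin m))
    (r s : ℝ) : S :=
  open Classical in
  if s ∈ Ioo a b then (extChartAt (𝓡 m) y).symm (extChartAt (𝓡 m) y (γ s) + (r * η s) • e)
  else γ s

lemma shift_of_mem {r s : ℝ} (hs : s ∈ Ioo a b) : shift y γ a b η e r s =
    (extChartAt (𝓡 m) y).symm (extChartAt (𝓡 m) y (γ s) + (r * η s) • e) := if_pos hs

lemma shift_of_notMem {r s : ℝ} (hs : s ∉ Ioo a b) : shift y γ a b η e r s = γ s := if_neg hs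

lemma shift_of_mul_eq_zero (hγ : ∀ s ∈ Icc a b, γ s ∈ (extChartAt (𝓡 m) y).source)
    {r s : ℝ} (h : r * η s = 0) : shift y γ a b η e r s = γ s := by
  by_cases hs : s ∈ Ioo a b
  · rw [shift_of_mem hs, h, zero_smul, add_zero,
      (extChartAt (𝓡 m) y).left_inv (hγ s (Ioo_subset_Icc_self hs))]
  · exact shift_of_notMem hs

lemma exists_shift_mem_target (hγc : ContinuousOn γ (Icc a b))
    (hγ : ∀ s ∈ Icc a b, γ s ∈ (extChartAt (𝓡 m) y).source) (hη : Continuous η) :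
    ∃ δ > 0, ∀ r ∈ Ioo (-δ) δ, ∀ s ∈ Icc a b,
      extChartAt (𝓡 m) y (γ s) + (r * η s) • e ∈ (extChartAt (𝓡 m) y).target := by
  have hx : ContinuousOn (fun s => extChartAt (𝓡 m) y (γ s)) (Icc a b) :=
    (continuousOn_extChartAt y).comp hγc hγ
  obtain ⟨ρ, hρ, hsub⟩ := (isCompact_Icc.image_of_continuousOn hx).exists_thickening_subset_open
    (isOpen_extChartAt_target y) (by
      rintro _ ⟨s, hs, rfl⟩
      exact (extChartAt (𝓡 m) y).map_source (hγ s hs))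
  obtain ⟨C, hC⟩ := isCompact_Icc.exists_bound_of_continuousOn (hη.continuousOn (s := Icc a b))
  have hA : 0 < |C| * ‖e‖ + 1 := by positivity
  refine ⟨ρ / (|C| * ‖e‖ + 1), by positivity, fun r hr s hs => hsub ?_⟩
  refine Metric.mem_thickening_iff.2 ⟨_, ⟨s, hs, rfl⟩, ?_⟩
  rw [dist_eq_norm, add_sub_cancel_left, norm_smul, norm_mul]
  have h1 : ‖r‖ < ρ / (|C| * ‖e‖ + 1) := abs_lt.2 hr
  calc ‖r‖ * ‖η s‖ * ‖e‖ ≤ ‖r‖ * |C| * ‖e‖ := by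
        gcongr
        exact (hC s hs).trans (le_abs_self C)
    _ ≤ ‖r‖ * (|C| * ‖e‖ + 1) := by nlinarith [norm_nonneg r]
    _ < ρ := (lt_div_iff₀ hA).1 h1

variable [IsManifold (𝓡 m) ∞ S]

lemma contMDiffOn_shift {n : ℕ∞ω} (hn : n ≤ ∞)
    (hγ : ∀ s ∈ Icc a b, γ s ∈ (extChartAt (𝓡 m) y).source)
    (hη : ContDiff ℝ ∞ η) (hηab : tsupport η ⊆ Ioo a b)
    (hδ : ∀ r ∈ Ioo (-δ) δ, ∀ s ∈ Icc a b,
      extChartAt (𝓡 m) y (γ s) + (r * η s) • e ∈ (extChartAt (𝓡 m) y).target)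
    {I : Set ℝ} (hγI : ContMDiffOn 𝓘(ℝ, ℝ) (𝓡 m) n γ I) :
    ContMDiffOn 𝓘(ℝ, ℝ × ℝ) (𝓡 m) n (fun p : ℝ × ℝ => shift y γ a b η e p.1 p.2)
      (Ioo (-δ) δ ×ˢ I) := by
  rintro ⟨r, s⟩ ⟨hr, hs⟩
  have hsnd : ContMDiffWithinAt 𝓘(ℝ, ℝ × ℝ) 𝓘(ℝ, ℝ) n (fun p : ℝ × ℝ => p.2)
      (Ioo (-δ) δ ×ˢ I) (r, s) := contDiff_snd.contMDiff.contMDiffAt.contMDiffWithinAt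
  have hγs : ContMDiffWithinAt 𝓘(ℝ, ℝ × ℝ) (𝓡 m) n (fun p : ℝ × ℝ => γ p.2)
      (Ioo (-δ) δ ×ˢ I) (r, s) :=
    ContMDiffWithinAt.comp (t := I) (r, s) (hγI s hs) hsnd fun p hp => hp.2
  by_cases hsab : s ∈ Ioo a b
  · have hmem : ∀ᶠ p : ℝ × ℝ in 𝓝[Ioo (-δ) δ ×ˢ I] (r, s), p.2 ∈ Ioo a b :=
      mem_nhdsWithin_of_mem_nhds (continuous_snd.continuousAt (Ioo_mem_nhds hsab.1 hsab.2))
    have h1 : ContMDiffWithinAt 𝓘(ℝ, ℝ × ℝ) 𝓘(ℝ, EuclideanSpace ℝ (Fin m)) n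
        (fun p : ℝ × ℝ => extChartAt (𝓡 m) y (γ p.2)) (Ioo (-δ) δ ×ˢ I) (r, s) := by
      have h2 := hγ s (Ioo_subset_Icc_self hsab)
      rw [extChartAt_source] at h2
      exact ((contMDiffAt_extChartAt' (n := ∞) h2).of_le hn).comp_contMDiffWithinAt (r, s) hγs
    have h2 : ContDiffWithinAt ℝ n
        (fun p : ℝ × ℝ => extChartAt (𝓡 m) y (γ p.2) + (p.1 * η p.2) • e)
        (Ioo (-δ) δ ×ˢ I) (r, s) := by
      refine h1.contDiffWithinAt.add ?_
      exact (((contDiff_fst.mul (hη.comp contDiff_snd)).smul contDiff_const).of_le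
        hn).contDiffAt.contDiffWithinAt
    have h3 : ContMDiffAt 𝓘(ℝ, EuclideanSpace ℝ (Fin m)) (𝓡 m) n (extChartAt (𝓡 m) y).symm
        (extChartAt (𝓡 m) y (γ s) + (r * η s) • e) :=
      ((contMDiffOn_extChartAt_symm (n := ∞) y).contMDiffAt
        ((isOpen_extChartAt_target y).mem_nhds
          (hδ r hr s (Ioo_subset_Icc_self hsab)))).of_le hn
    refine (h3.comp_contMDiffWithinAt (f := fun p : ℝ × ℝ =>
      extChartAt (𝓡 m) y (γ p.2) + (p.1 * η p.2) • e) (r, s)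
      h2.contMDiffWithinAt).congr_of_eventuallyEq ?_ (shift_of_mem hsab)
    filter_upwards [hmem] with p hp using shift_of_mem hp
  · have hst : s ∉ tsupport η := fun h => hsab (hηab h)
    have h0 : ∀ᶠ p : ℝ × ℝ in 𝓝[Ioo (-δ) δ ×ˢ I] (r, s),
        shift y γ a b η e p.1 p.2 = γ p.2 := by
      have h1 : ∀ᶠ p : ℝ × ℝ in 𝓝 (r, s), η p.2 = 0 :=
        continuous_snd.continuousAt.eventually (notMem_tsupport_iff_eventuallyEq.1 hst)
      filter_upwards [mem_nhdsWithin_of_mem_nhds h1] with p hp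
      exact shift_of_mul_eq_zero hγ (by rw [hp, mul_zero])
    exact hγs.congr_of_eventuallyEq h0 (shift_of_notMem hsab)

lemma isVariation_shift {x₀ x₁ : S} (hγP : γ ∈ admissiblePaths (m := m) univ x₀ x₁)
    (ha : 0 ≤ a) (hb : b ≤ 1)
    (hγ : ∀ s ∈ Icc a b, γ s ∈ (extChartAt (𝓡 m) y).source)
    (hη : ContDiff ℝ ∞ η) (hηab : tsupport η ⊆ Ioo a b) (hδ0 : 0 < δ)
    (hδ : ∀ r ∈ Ioo (-δ) δ, ∀ s ∈ Icc a b,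
      extChartAt (𝓡 m) y (γ s) + (r * η s) • e ∈ (extChartAt (𝓡 m) y).target) :
    IsVariation (m := m) univ x₀ x₁ γ δ (shift y γ a b η e) := by
  obtain ⟨⟨hc, N, t, ht, hp⟩, h0, h1, -, -⟩ := hγP
  have hs : ∀ i : Fin N, ContMDiffOn 𝓘(ℝ, ℝ × ℝ) (𝓡 m) ∞
      (fun p : ℝ × ℝ => shift y γ a b η e p.1 p.2)
      (Ioo (-δ) δ ×ˢ Icc (t i.castSucc) (t i.succ)) := fun i =>
    contMDiffOn_shift le_rfl hγ hη hηab hδ (hp i)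
  refine ⟨hδ0, fun s _ => shift_of_mul_eq_zero hγ (zero_mul _), fun r hr => ⟨⟨?_, N, t, ht,
    fun i => contMDiffOn_slice (hs i) hr⟩, ?_, ?_, fun _ _ => mem_univ _, fun _ _ => mem_univ _⟩,
    N, t, ht, hs⟩
  · have h2 := (contMDiffOn_shift (n := 0) (by simp) hγ hη hηab hδ
      (contMDiffOn_zero_iff.2 hc)).continuousOn
    exact h2.comp (f := fun s => (r, s)) (Continuous.continuousOn (by fun_prop))
      fun s hs => ⟨hr, hs⟩
  · rw [shift_of_notMem fun h => absurd h.1 (not_lt.2 ha), h0]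
  · rw [shift_of_notMem fun h => absurd h.2 (not_lt.2 hb), h1]

variable {g₀ : RMetric m S} {θ : OneForm m S} {Λ : S → ℝ}

/-- The energy density of a shifted curve. -/
lemma hasDerivAt_density_shift (hD : (chartCoeffs g₀ θ Λ y).IsGood (extChartAt (𝓡 m) y).target)
    (hl : ∀ x ∈ (extChartAt (𝓡 m) y).target, 0 < (chartCoeffs g₀ θ Λ y).l x)
    (hγ : ∀ s ∈ Icc a b, γ s ∈ (extChartAt (𝓡 m) y).source)
    (hη : ContDiff ℝ ∞ η) (hηab : tsupport η ⊆ Ioo a b) (hδ0 : 0 < δ)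
    (hδ : ∀ r ∈ Ioo (-δ) δ, ∀ s ∈ Icc a b,
      extChartAt (𝓡 m) y (γ s) + (r * η s) • e ∈ (extChartAt (𝓡 m) y).target)
    {s : ℝ} (hs : s ∈ Ioo a b) {V : Set ℝ} (hV : V ∈ 𝓝 s)
    (hγV : ContMDiffOn 𝓘(ℝ, ℝ) (𝓡 m) ∞ γ V)
    {x : ℝ → EuclideanSpace ℝ (Fin m)} (hx : x = fun s => extChartAt (𝓡 m) y (γ s)) :
    HasDerivAt (fun r => density (randersKropina g₀ θ Λ) (shift y γ a b η e) r s)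
      ((chartCoeffs g₀ θ Λ y).momentum (x s) (deriv x s) (deriv η s • e) +
        (chartCoeffs g₀ θ Λ y).force (x s) (deriv x s) (η s • e)) 0 := by
  set D := chartCoeffs g₀ θ Λ y with hDdef
  have hs' := Ioo_subset_Icc_self hs
  have hxs : ContDiffAt ℝ ∞ x s := by
    have h2 := hγ s hs'
    rw [extChartAt_source] at h2
    rw [hx]
    exact ((contMDiffAt_extChartAt' (n := ∞) h2).comp s (hγV.contMDiffAt hV)).contDiffAt
  have h1 : ∀ r ∈ Ioo (-δ) δ, density (randersKropina g₀ θ Λ) (shift y γ a b η e) r s =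
      1 / 2 * D.F (x s + (r * η s) • e) (deriv x s + (r * deriv η s) • e) ^ 2 := by
    intro r hr
    have hsm : ContMDiffAt 𝓘(ℝ, ℝ) (𝓡 m) ∞ (shift y γ a b η e r) s := by
      have h2 : ContMDiffOn 𝓘(ℝ, ℝ) 𝓘(ℝ, ℝ × ℝ) ∞ (fun s : ℝ => (r, s)) V :=
        (ContDiff.contMDiff (by fun_prop)).contMDiffOn
      exact ((contMDiffOn_shift le_rfl hγ hη hηab hδ hγV).comp h2
        fun s hs => ⟨hr, hs⟩).contMDiffAt hV
    have hval : ∀ s ∈ Ioo a b,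
        extChartAt (𝓡 m) y (shift y γ a b η e r s) = x s + (r * η s) • e := fun s hs => by
      rw [shift_of_mem hs, (extChartAt (𝓡 m) y).right_inv (hδ r hr s (Ioo_subset_Icc_self hs)), hx]
    have hsrc : shift y γ a b η e r s ∈ (extChartAt (𝓡 m) y).source := by
      rw [shift_of_mem hs]
      exact (extChartAt (𝓡 m) y).map_target (hδ r hr s hs')
    have hvel : coord y (velocity m (shift y γ a b η e r) s) =
        deriv x s + (r * deriv η s) • e := by
      rw [coord_velocity (hsm.mdifferentiableAt (by simp)) hsrc]
      have h3 : HasDerivAt (fun s => x s + (r * η s) • e) (deriv x s + (r * deriv η s) • e) s :=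
        (hxs.differentiableAt (by simp)).hasDerivAt.add
          ((((hη.differentiable (by simp)) s).hasDerivAt.const_mul r).smul_const e)
      refine (h3.congr_of_eventuallyEq ?_).deriv
      filter_upwards [Ioo_mem_nhds hs.1 hs.2] with s hs using hval s hs
    rw [density, ← hvel, ← hval s hs]
    exact congrArg (fun c => 1 / 2 * c ^ 2)
      (chartCoeffs_F (v := velocity m (shift y γ a b η e r) s) hsrc).symm
  have hxU : x s ∈ (extChartAt (𝓡 m) y).target := by
    rw [hx]
    exact (extChartAt (𝓡 m) y).map_source (hγ s hs')
  have hz : (x s + ((0 : ℝ) * η s) • e, deriv x s + ((0 : ℝ) * deriv η s) • e) ∈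
      D.dom (extChartAt (𝓡 m) y).target := by
    simp only [zero_mul, zero_smul, _root_.add_zero]
    exact ⟨hxU, Or.inl (hl _ hxU)⟩
  have h4 : HasDerivAt (fun r => (x s + (r * η s) • e, deriv x s + (r * deriv η s) • e))
      (η s • e, deriv η s • e) (0 : ℝ) := by
    have h5 : ∀ (c : ℝ) (u : EuclideanSpace ℝ (Fin m)),
        HasDerivAt (fun r => u + (r * c) • e) (c • e) (0 : ℝ) := fun c u => by
      simpa using (((hasDerivAt_id (0 : ℝ)).mul_const c).smul_const e).const_add u
    exact (h5 _ _).prodMk (h5 _ _)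
  have h6 := (hD.hasFDerivAt_energy hz).comp_hasDerivAt (0 : ℝ) h4
  refine (h6.congr_deriv ?_).congr_of_eventuallyEq ?_
  · simp [add_comm]
  · filter_upwards [Ioo_mem_nhds (neg_lt_zero.2 hδ0) hδ0] with r hr using h1 r hr

/-- In charts, critical curves of Randers metrics are of class `C¹`, have constant speed and solve
the Euler-Lagrange equation. -/
lemma exists_eulerLagrange_of_isFinslerGeodesic (hθ : θ.IsSmooth) (hθ_ne : ∀ x, θ x ≠ 0)
    (hΛ : ContMDiff (𝓡 m) 𝓘(ℝ, ℝ) ∞ Λ) (hΛ_pos : ∀ x, 0 < Λ x) {x₀ x₁ : S}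
    (hγ : IsFinslerGeodesic univ (randersKropina g₀ θ Λ) x₀ x₁ γ)
    (ha : 0 ≤ a) (hab : a < b) (hb : b ≤ 1)
    (hγU : ∀ s ∈ Icc a b, γ s ∈ (extChartAt (𝓡 m) y).source)
    {x : ℝ → EuclideanSpace ℝ (Fin m)} (hx : x = fun s => extChartAt (𝓡 m) y (γ s)) :
    ∃ (v : ℝ → EuclideanSpace ℝ (Fin m)) (p : ℝ → EuclideanSpace ℝ (Fin m) →L[ℝ] ℝ) (c : ℝ),
      ∀ s ∈ Icc a b,
        HasDerivWithinAt x (v s) (Icc a b) s ∧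
        HasDerivWithinAt p ((chartCoeffs g₀ θ Λ y).force (x s) (v s)) (Icc a b) s ∧
        p s = (chartCoeffs g₀ θ Λ y).momentum (x s) (v s) ∧
        (chartCoeffs g₀ θ Λ y).F (x s) (v s) = c := by
  have hΛ_nonneg : ∀ x, 0 ≤ Λ x := fun x => (hΛ_pos x).le
  have hD := isGood_chartCoeffs (g₀ := g₀) hθ hθ_ne hΛ hΛ_nonneg y
  have hl : ∀ x ∈ (extChartAt (𝓡 m) y).target, 0 < (chartCoeffs g₀ θ Λ y).l x :=
    fun x _ => hΛ_pos _
  obtain ⟨hγP, hcrit⟩ := hγ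
  obtain ⟨⟨hc, N, t, ht, hp⟩, -⟩ := id hγP
  have hI : Icc a b ⊆ Icc (0 : ℝ) 1 := Icc_subset_Icc ha hb
  have hxc : ContinuousOn x (Icc a b) := by
    rw [hx]
    exact (continuousOn_extChartAt y).comp (hc.mono hI) hγU
  have hxU : ∀ s ∈ Icc a b, x s ∈ (extChartAt (𝓡 m) y).target := fun s hs => by
    rw [hx]
    exact (extChartAt (𝓡 m) y).map_source (hγU s hs)
  have hpiece : ∀ s ∈ Ioo a b \ range t, ∃ i : Fin N, s ∈ Ioo (t i.castSucc) (t i.succ) := by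
    intro s hs
    obtain ⟨i, hi⟩ := ht.exists_mem_Ioc (s := s) ⟨ha.trans_lt hs.1.1, hs.1.2.le.trans hb⟩
    exact ⟨i, hi.1, lt_of_le_of_ne hi.2 fun h => hs.2 ⟨_, h.symm⟩⟩
  have hγs : ∀ s ∈ Ioo a b \ range t, ContMDiffAt 𝓘(ℝ, ℝ) (𝓡 m) ∞ γ s := fun s hs => by
    obtain ⟨i, hi⟩ := hpiece s hs
    exact (hp i).contMDiffAt (Icc_mem_nhds hi.1 hi.2)
  have hxs : ∀ s ∈ Ioo a b \ range t, ContDiffAt ℝ ∞ x s := fun s hs => by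
    have h2 := hγU s (Ioo_subset_Icc_self hs.1)
    rw [extChartAt_source] at h2
    rw [hx]
    exact ((contMDiffAt_extChartAt' (n := ∞) h2).comp s (hγs s hs)).contDiffAt
  -- the velocity is bounded on each of the finitely many smooth pieces
  have hbound : ∀ i : Fin N, ∃ M, ∀ s ∈ Ioo a b, s ∈ Ioo (t i.castSucc) (t i.succ) →
      ‖deriv x s‖ ≤ M := by
    intro i
    set c := max a (t i.castSucc)
    set d := min b (t i.succ)
    rcases lt_or_ge c d with hcd | hcd
    · have h1 : ContDiffOn ℝ ∞ x (Icc c d) := by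
        rw [hx]
        refine ContMDiffOn.contDiffOn ((contMDiffOn_extChartAt (x := y)).comp ((hp i).mono
          (Icc_subset_Icc (le_max_right _ _) (min_le_right _ _))) fun s hs => ?_)
        rw [← extChartAt_source (𝓡 m)]
        exact hγU s ⟨(le_max_left _ _).trans hs.1, hs.2.trans (min_le_left _ _)⟩
      obtain ⟨M, hM⟩ := isCompact_Icc.exists_bound_of_continuousOn
        (h1.continuousOn_derivWithin (uniqueDiffOn_Icc hcd) (by simp))
      refine ⟨M, fun s hs hs' => ?_⟩
      have h2 : s ∈ Ioo c d := ⟨max_lt hs.1 hs'.1, lt_min hs.2 hs'.2⟩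
      rw [← derivWithin_of_mem_nhds (Icc_mem_nhds h2.1 h2.2)]
      exact hM s (Ioo_subset_Icc_self h2)
    · exact ⟨0, fun s hs hs' => absurd ((max_lt hs.1 hs'.1).trans (lt_min hs.2 hs'.2))
        (not_lt.2 hcd)⟩
  choose M hM using hbound
  obtain ⟨M', hM'⟩ := (finite_range M).bddAbove
  refine Coeffs.exists_eulerLagrange hD hl hab hxc hxU (T := range t) (finite_range t).countable hxs
    (M := M') (fun s hs => ?_) fun η hη hηc hηab e => ?_
  · obtain ⟨i, hi⟩ := hpiece s hs
    exact (hM i s hs.1 hi).trans (hM' ⟨i, rfl⟩)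
  · obtain ⟨δ, hδ0, hδ⟩ := exists_shift_mem_target (e := e) (hc.mono hI) hγU hη.continuous
    have hV := isVariation_shift (e := e) hγP ha hb hγU hη hηab hδ0 hδ
    have h1 := hcrit δ _ hV
    rw [← randersKropinaDomain_eq_univ (θ := θ) hΛ_pos] at hV
    have h2 := h1.unique (hasDerivAt_energy_of_isVariation (g₀ := g₀) hθ hθ_ne hΛ hΛ_nonneg hV)
    -- outside `(a, b)` the variation is constant
    have h3 : ∀ s ∉ Ioo a b,
        deriv (fun r => density (randersKropina g₀ θ Λ) (shift y γ a b η e) r s) 0 = 0 := by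
      intro s hs
      have h4 : ∀ r, velocity m (shift y γ a b η e r) s = velocity m γ s := fun r => by
        refine velocity_congr ?_
        filter_upwards [notMem_tsupport_iff_eventuallyEq.1 fun h => hs (hηab h)] with s' hs'
        exact shift_of_mul_eq_zero hγU (by rw [hs', Pi.zero_apply, mul_zero])
      simp only [density, h4, deriv_const]
    rw [intervalIntegral.integral_of_le zero_le_one,
      setIntegral_eq_of_subset_of_forall_sdiff_eq_zero measurableSet_Ioc
        (Ioc_subset_Ioc ha hb) (fun s hs => h3 s fun h => hs.2 (Ioo_subset_Ioc_self h)),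
      ← intervalIntegral.integral_of_le hab.le] at h2
    rw [h2]
    refine intervalIntegral.integral_congr_ae ?_
    have h5 := ((finite_range t).union (finite_singleton b)).countable.ae_notMem (volume : Measure ℝ)
    filter_upwards [h5] with s hs hs'
    rw [uIoc_of_le hab.le] at hs'
    have hs1 : s ∈ Ioo a b := ⟨hs'.1, lt_of_le_of_ne hs'.2 fun h => hs (Or.inr h)⟩
    obtain ⟨i, hi⟩ := hpiece s ⟨hs1, fun h => hs (Or.inl h)⟩
    exact (hasDerivAt_density_shift hD hl hγU hη hηab hδ0 hδ hs1 (Icc_mem_nhds hi.1 hi.2) (hp i)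
      hx).deriv.symm

end Randers

/-! ### Solutions of the Euler-Lagrange equation -/

section Extremal

open MeasureTheory

/-- The Hamiltonian equation is smooth away from zero momenta, so its solutions are smooth; a solution
with a zero velocity has speed zero and is constant. -/
lemma Coeffs.contDiffOn_of_eulerLagrange {E : Type*} [NormedAddCommGroup E] [NormedSpace ℝ E]
    [FiniteDimensional ℝ E] {D : Coeffs E} {U : Set E} (hD : D.IsGood U) {a b c : ℝ} (hab : a < b)
    {x v : ℝ → E} {p : ℝ → E →L[ℝ] ℝ} (hdom : ∀ s ∈ Icc a b, (x s, v s) ∈ D.dom U)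
    (hx : ∀ s ∈ Icc a b, HasDerivWithinAt x (v s) (Icc a b) s)
    (hp : ∀ s ∈ Icc a b, HasDerivWithinAt p (D.force (x s) (v s)) (Icc a b) s)
    (hpm : ∀ s ∈ Icc a b, p s = D.momentum (x s) (v s))
    (hF : ∀ s ∈ Icc a b, D.F (x s) (v s) = c) : ContDiffOn ℝ ∞ x (Icc a b) := by
  by_cases hv : ∀ s ∈ Icc a b, v s ≠ 0
  · have h1 : ContDiffOn ℝ ∞ (fun s => (x s, p s)) (Icc a b) := by
      refine contDiffOn_of_hasDerivWithinAt hab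
        (f := fun z : E × (E →L[ℝ] ℝ) => (c • D.vel z.1 z.2, c • D.drift z.1 z.2))
        (fun s hs => ?_) fun s hs => ?_
      · have h2 := vel_momentum hD (hdom s hs) (hv s hs)
        have h3 := force_eq_drift hD (hdom s hs) (hv s hs)
        rw [hF s hs, ← hpm s hs] at h2 h3
        have h4 := (hx s hs).prodMk (hp s hs)
        rw [h3] at h4
        rw [← h2] at h4
        exact h4
      · have hp0 : p s ≠ 0 := by
          rw [hpm s hs]
          exact momentum_ne_zero hD (hdom s hs) (hv s hs)
        have hi : ContDiffAt ℝ ∞ (fun z : E × (E →L[ℝ] ℝ) => ((0 : ℝ), z)) (x s, p s) := by fun_prop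
        have h5 := (hD.contDiffAt_vel (y := (0, x s, p s)) (hdom s hs).1 le_rfl hp0).comp
          (x s, p s) hi
        have h6 := (hD.contDiffAt_drift (y := (0, x s, p s)) (hdom s hs).1 le_rfl hp0).comp
          (x s, p s) hi
        have h7 := (contDiffAt_const (c := c)).smul h5
        have h8 := (contDiffAt_const (c := c)).smul h6
        have h9 := h7.prodMk h8
        refine h9.congr_of_eventuallyEq (Eventually.of_forall fun z => ?_)
        simp [Coeffs.add_zero]
    exact h1.fst
  · push Not at hv
    obtain ⟨s₀, hs₀, hv₀⟩ := hv
    have hc : c = 0 := by rw [← hF s₀ hs₀, hv₀, Coeffs.F, speed_zero]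
    have hv' : ∀ s ∈ Icc a b, v s = 0 := fun s hs => by
      by_contra h
      have := F_pos hD (hdom s hs) h
      rw [hF s hs, hc] at this
      exact lt_irrefl _ this
    have hconst : ∀ s ∈ Icc a b, x s = x a := by
      refine constant_of_has_deriv_right_zero (fun s hs => (hx s hs).continuousWithinAt)
        fun s hs => ?_
      have h1 := hx s (Ico_subset_Icc_self hs)
      rw [hv' s (Ico_subset_Icc_self hs)] at h1
      exact h1.mono_of_mem_nhdsWithin (Icc_mem_nhdsGE_of_mem hs)
    exact contDiffOn_const.congr hconst

variable {m : ℕ} {S : Type*} [TopologicalSpace S]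
  [ChartedSpace (EuclideanSpace ℝ (Fin m)) S] [IsManifold (𝓡 m) ∞ S] {γ γ' : ℝ → S} {y : S}
  {a b c s : ℝ} {g₀ : RMetric m S} {θ : OneForm m S} {Λ : S → ℝ}

/-- On `[a,b]` the curve `γ` lies in the chart at `y`, has speed `c` and solves the Euler-Lagrange
equation. -/
def IsExtremal (g₀ : RMetric m S) (θ : OneForm m S) (Λ : S → ℝ) (y : S) (γ : ℝ → S)
    (c a b : ℝ) : Prop :=
  (∀ s ∈ Icc a b, γ s ∈ (extChartAt (𝓡 m) y).source) ∧
  ∃ (v : ℝ → EuclideanSpace ℝ (Fin m)) (p : ℝ → EuclideanSpace ℝ (Fin m) →L[ℝ] ℝ),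
    ∀ s ∈ Icc a b,
      HasDerivWithinAt (fun s => extChartAt (𝓡 m) y (γ s)) (v s) (Icc a b) s ∧
      HasDerivWithinAt p ((chartCoeffs g₀ θ Λ y).force (extChartAt (𝓡 m) y (γ s)) (v s))
        (Icc a b) s ∧
      p s = (chartCoeffs g₀ θ Λ y).momentum (extChartAt (𝓡 m) y (γ s)) (v s) ∧
      (chartCoeffs g₀ θ Λ y).F (extChartAt (𝓡 m) y (γ s)) (v s) = c ∧
      (extChartAt (𝓡 m) y (γ s), v s) ∈
        (chartCoeffs g₀ θ Λ y).dom (extChartAt (𝓡 m) y).target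

/-- Around every point of `[0,1]` the curve `γ` solves the Euler-Lagrange equation, with
speed `c`. -/
def IsExtremalCurve (g₀ : RMetric m S) (θ : OneForm m S) (Λ : S → ℝ) (γ : ℝ → S) (c : ℝ) : Prop :=
  ∀ s ∈ Icc (0 : ℝ) 1, ∃ (y : S) (a b : ℝ), a < b ∧ 0 ≤ a ∧ b ≤ 1 ∧ Icc a b ∈ 𝓝[Icc 0 1] s ∧
    IsExtremal g₀ θ Λ y γ c a b

lemma IsExtremal.congr (h : IsExtremal g₀ θ Λ y γ c a b) (hγ : EqOn γ' γ (Icc a b)) :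
    IsExtremal g₀ θ Λ y γ' c a b := by
  obtain ⟨hs, v, p, h⟩ := h
  refine ⟨fun s hs' => by rw [hγ hs']; exact hs s hs', v, p, fun s hs' => ?_⟩
  rw [hγ hs']
  refine ⟨(h s hs').1.congr (fun s hs => by rw [hγ hs]) (by rw [hγ hs']), (h s hs').2⟩

lemma IsExtremalCurve.congr (h : IsExtremalCurve g₀ θ Λ γ c) (hγ : EqOn γ' γ (Icc 0 1)) :
    IsExtremalCurve g₀ θ Λ γ' c := fun s hs => by
  obtain ⟨y, a, b, hab, ha, hb, hn, h⟩ := h s hs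
  exact ⟨y, a, b, hab, ha, hb, hn, h.congr (hγ.mono (Icc_subset_Icc ha hb))⟩

/-- The momentum `∂(F²/2)/∂v` at `v`, applied to `w`. -/
def pairing (g₀ : RMetric m S) (θ : OneForm m S) (Λ : S → ℝ) (z : S)
    (v w : TangentSpace (𝓡 m) z) : ℝ :=
  randersKropina g₀ θ Λ ⟨z, v⟩ / √(Λ z * g₀.inner z v v + θ z v ^ 2) *
    (g₀.inner z v w + randersKropina g₀ θ Λ ⟨z, v⟩ * θ z w)

lemma momentum_coord {z : S} (hz : z ∈ (extChartAt (𝓡 m) y).source) (v w : TangentSpace (𝓡 m) z) :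
    (chartCoeffs g₀ θ Λ y).momentum (extChartAt (𝓡 m) y z) (coord y ⟨z, v⟩) (coord y ⟨z, w⟩) =
      pairing g₀ θ Λ z v w := by
  have h1 : ∀ u : EuclideanSpace ℝ (Fin m), (chartCoeffs g₀ θ Λ y).g (extChartAt (𝓡 m) y z)
      (coord y ⟨z, v⟩) u = g₀.inner z v (frame m y z u) := fun u =>
    chartCoeffs_g (v := ⟨z, v⟩) hz u
  have h2 : ∀ v, (chartCoeffs g₀ θ Λ y).θ (extChartAt (𝓡 m) y z) (coord y ⟨z, v⟩) = θ z v :=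
    fun v => chartCoeffs_θ (v := ⟨z, v⟩) hz
  have h3 : speed ((chartCoeffs g₀ θ Λ y).g (extChartAt (𝓡 m) y z))
      ((chartCoeffs g₀ θ Λ y).θ (extChartAt (𝓡 m) y z))
      ((chartCoeffs g₀ θ Λ y).l (extChartAt (𝓡 m) y z)) (coord y ⟨z, v⟩) =
      randersKropina g₀ θ Λ ⟨z, v⟩ := chartCoeffs_F (v := ⟨z, v⟩) hz
  rw [Coeffs.momentum, mom, h3, root, smul_apply, add_apply, smul_apply, h1, h1, h2, h2,
    chartCoeffs_l hz, frame_coord hz, frame_coord hz, pairing, smul_eq_mul, smul_eq_mul]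

lemma IsExtremal.contMDiffOn (h : IsExtremal g₀ θ Λ y γ c a b)
    (hD : (chartCoeffs g₀ θ Λ y).IsGood (extChartAt (𝓡 m) y).target) (hab : a < b) :
    ContMDiffOn 𝓘(ℝ, ℝ) (𝓡 m) ∞ γ (Icc a b) := by
  obtain ⟨hs, v, p, h⟩ := h
  have h1 := Coeffs.contDiffOn_of_eulerLagrange hD hab (fun s hs => (h s hs).2.2.2.2)
    (fun s hs => (h s hs).1) (fun s hs => (h s hs).2.1) (fun s hs => (h s hs).2.2.1)
    (fun s hs => (h s hs).2.2.2.1)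
  refine ((contMDiffOn_extChartAt_symm y).comp h1.contMDiffOn
    fun s hs' => (extChartAt (𝓡 m) y).map_source (hs s hs')).congr fun s hs' => ?_
  exact ((extChartAt (𝓡 m) y).left_inv (hs s hs')).symm

end Extremal

/-! ### Solutions of the Euler-Lagrange equation are geodesics -/

section Extremal

open MeasureTheory

variable {m : ℕ} {S : Type*} [TopologicalSpace S]
  [ChartedSpace (EuclideanSpace ℝ (Fin m)) S] [IsManifold (𝓡 m) ∞ S] {γ γ' : ℝ → S} {y : S}
  {a b c s : ℝ} {g₀ : RMetric m S} {θ : OneForm m S} {Λ : S → ℝ}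

lemma pairing_zero {z : S} (v : TangentSpace (𝓡 m) z) : pairing g₀ θ Λ z v 0 = 0 := by
  simp [pairing]

lemma lt_of_Icc_mem_nhdsWithin_left (h : Icc a b ∈ 𝓝[Icc (0 : ℝ) 1] s) (hs : s ∈ Ioc (0 : ℝ) 1) :
    s ∈ Ioc a b := by
  refine ⟨?_, (mem_of_mem_nhdsWithin (Ioc_subset_Icc_self hs) h).2⟩
  obtain ⟨ρ, hρ, hsub⟩ := Metric.mem_nhdsWithin_iff.1 h
  have h1 : max 0 (s - ρ / 2) < s := max_lt hs.1 (by linarith)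
  have h2 := hsub (a := max 0 (s - ρ / 2)) ⟨?_, le_max_left _ _, h1.le.trans hs.2⟩
  · exact h2.1.trans_lt h1
  · rw [Metric.mem_ball, Real.dist_eq, abs_lt]
    exact ⟨by linarith [le_max_right 0 (s - ρ / 2)], by linarith⟩

lemma lt_of_Icc_mem_nhdsWithin_right (h : Icc a b ∈ 𝓝[Icc (0 : ℝ) 1] s) (hs : s ∈ Ico (0 : ℝ) 1) :
    s ∈ Ico a b := by
  refine ⟨(mem_of_mem_nhdsWithin (Ico_subset_Icc_self hs) h).1, ?_⟩
  obtain ⟨ρ, hρ, hsub⟩ := Metric.mem_nhdsWithin_iff.1 h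
  have h1 : s < min 1 (s + ρ / 2) := lt_min hs.2 (by linarith)
  have h2 := hsub (a := min 1 (s + ρ / 2)) ⟨?_, hs.1.trans h1.le, min_le_left _ _⟩
  · exact h1.trans_le h2.2
  · rw [Metric.mem_ball, Real.dist_eq, abs_lt]
    exact ⟨by linarith, by linarith [min_le_right 1 (s + ρ / 2)]⟩

lemma coord_velocity_of_hasDerivWithinAt (hγ : ContMDiffOn 𝓘(ℝ, ℝ) (𝓡 m) ∞ γ (Icc a b))
    {v : EuclideanSpace ℝ (Fin m)} (hs : s ∈ Ioo a b)
    (hsrc : γ s ∈ (extChartAt (𝓡 m) y).source)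
    (hv : HasDerivWithinAt (fun s => extChartAt (𝓡 m) y (γ s)) v (Icc a b) s) :
    coord y (velocity m γ s) = v := by
  have h1 := Icc_mem_nhds hs.1 hs.2
  rw [coord_velocity ((hγ.contMDiffAt h1).mdifferentiableAt (by simp)) hsrc]
  exact (hv.hasDerivAt h1).deriv

lemma coord_leftVelocity_of_hasDerivWithinAt (hγ : ContMDiffOn 𝓘(ℝ, ℝ) (𝓡 m) ∞ γ (Icc a b))
    {v : EuclideanSpace ℝ (Fin m)} (hs : s ∈ Ioc a b)
    (hsrc : γ s ∈ (extChartAt (𝓡 m) y).source)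
    (hv : HasDerivWithinAt (fun s => extChartAt (𝓡 m) y (γ s)) v (Icc a b) s) :
    coord y (leftVelocity m γ s) = v := by
  have hm : Icc a b ∈ 𝓝[Iic s] s := Icc_mem_nhdsLE_of_mem hs
  have hu : UniqueDiffWithinAt ℝ (Iic s) s := uniqueDiffOn_Iic s s self_mem_Iic
  have h1 := ((hγ s (Ioc_subset_Icc_self hs)).mdifferentiableWithinAt
    (by simp)).mono_of_mem_nhdsWithin hm
  rw [leftVelocity, coord_mfderivWithin h1 hu hsrc]
  exact (hv.mono_of_mem_nhdsWithin hm).derivWithin hu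

lemma coord_rightVelocity_of_hasDerivWithinAt (hγ : ContMDiffOn 𝓘(ℝ, ℝ) (𝓡 m) ∞ γ (Icc a b))
    {v : EuclideanSpace ℝ (Fin m)} (hs : s ∈ Ico a b)
    (hsrc : γ s ∈ (extChartAt (𝓡 m) y).source)
    (hv : HasDerivWithinAt (fun s => extChartAt (𝓡 m) y (γ s)) v (Icc a b) s) :
    coord y (rightVelocity m γ s) = v := by
  have hm : Icc a b ∈ 𝓝[Ici s] s := Icc_mem_nhdsGE_of_mem hs
  have hu : UniqueDiffWithinAt ℝ (Ici s) s := uniqueDiffOn_Ici s s self_mem_Ici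
  have h1 := ((hγ s (Ico_subset_Icc_self hs)).mdifferentiableWithinAt
    (by simp)).mono_of_mem_nhdsWithin hm
  rw [rightVelocity, coord_mfderivWithin h1 hu hsrc]
  exact (hv.mono_of_mem_nhdsWithin hm).derivWithin hu

variable (hθ : θ.IsSmooth) (hθ_ne : ∀ x, θ x ≠ 0)
    (hΛ : ContMDiff (𝓡 m) 𝓘(ℝ, ℝ) ∞ Λ) (hΛ_nonneg : ∀ x, 0 ≤ Λ x)

include hθ hθ_ne hΛ hΛ_nonneg

lemma IsExtremalCurve.contMDiffOn (h : IsExtremalCurve g₀ θ Λ γ c) :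
    ContMDiffOn 𝓘(ℝ, ℝ) (𝓡 m) ∞ γ (Icc 0 1) := by
  intro s hs
  obtain ⟨y, a, b, hab, -, -, hn, h⟩ := h s hs
  exact (h.contMDiffOn (isGood_chartCoeffs hθ hθ_ne hΛ hΛ_nonneg y) hab s
    (mem_of_mem_nhdsWithin hs hn)).mono_of_mem_nhdsWithin hn

lemma IsExtremal.speed_eq (h : IsExtremal g₀ θ Λ y γ c a b) (hs : s ∈ Ioo a b) :
    randersKropina g₀ θ Λ (velocity m γ s) = c := by
  have hγ := h.contMDiffOn (isGood_chartCoeffs hθ hθ_ne hΛ hΛ_nonneg y) (hs.1.trans hs.2)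
  obtain ⟨hsrc, v, p, h⟩ := h
  have hs' := Ioo_subset_Icc_self hs
  rw [← chartCoeffs_F (y := y) (v := velocity m γ s) (hsrc s hs'),
    coord_velocity_of_hasDerivWithinAt hγ hs (hsrc s hs') (h s hs').1]
  exact (h s hs').2.2.2.1

lemma IsExtremalCurve.speed_eq (h : IsExtremalCurve g₀ θ Λ γ c) (hs : s ∈ Ioo (0 : ℝ) 1) :
    randersKropina g₀ θ Λ (velocity m γ s) = c := by
  obtain ⟨y, a, b, hab, -, -, hn, h⟩ := h s (Ioo_subset_Icc_self hs)
  exact h.speed_eq hθ hθ_ne hΛ hΛ_nonneg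
    ⟨(lt_of_Icc_mem_nhdsWithin_left hn (Ioo_subset_Ioc_self hs)).1,
      (lt_of_Icc_mem_nhdsWithin_right hn (Ioo_subset_Ico_self hs)).2⟩

lemma IsExtremalCurve.finslerLength_eq (h : IsExtremalCurve g₀ θ Λ γ c) :
    finslerLength (randersKropina g₀ θ Λ) γ = c := by
  rw [finslerLength, intervalIntegral.integral_of_le zero_le_one, integral_Ioc_eq_integral_Ioo,
    setIntegral_congr_fun measurableSet_Ioo fun s hs => h.speed_eq hθ hθ_ne hΛ hΛ_nonneg hs]
  simp

lemma IsExtremalCurve.energy_eq (h : IsExtremalCurve g₀ θ Λ γ c) :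
    energy (randersKropina g₀ θ Λ) γ = 1 / 2 * c ^ 2 := by
  rw [energy, intervalIntegral.integral_of_le zero_le_one, integral_Ioc_eq_integral_Ioo,
    setIntegral_congr_fun (g := fun _ => c ^ 2) measurableSet_Ioo fun s hs => by
      simp only [h.speed_eq hθ hθ_ne hΛ hΛ_nonneg hs]]
  simp

lemma IsExtremalCurve.mem_admissiblePaths (h : IsExtremalCurve g₀ θ Λ γ c) :
    γ ∈ admissiblePaths (randersKropinaDomain θ Λ) (γ 0) (γ 1) := by
  have hγ := h.contMDiffOn hθ hθ_ne hΛ hΛ_nonneg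
  refine ⟨⟨hγ.continuousOn, 1, ![0, 1], ⟨?_, rfl, rfl⟩, fun i => ?_⟩, rfl, rfl, fun s hs => ?_,
    fun s hs => ?_⟩
  · rw [Fin.strictMono_iff_lt_succ]
    intro i
    fin_cases i
    simp
  · fin_cases i
    exact hγ
  · obtain ⟨y, a, b, hab, -, -, hn, h⟩ := h s (Ioc_subset_Icc_self hs)
    have hγ' := h.contMDiffOn (isGood_chartCoeffs hθ hθ_ne hΛ hΛ_nonneg y) hab
    obtain ⟨hsrc, v, p, h⟩ := h
    have hs1 := lt_of_Icc_mem_nhdsWithin_left hn hs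
    have hs2 := Ioc_subset_Icc_self hs1
    refine (mem_dom_iff (g₀ := g₀) (y := y) (v := leftVelocity m γ s) hΛ_nonneg (hsrc s hs2)).1 ?_
    rw [coord_leftVelocity_of_hasDerivWithinAt hγ' hs1 (hsrc s hs2) (h s hs2).1]
    exact (h s hs2).2.2.2.2
  · obtain ⟨y, a, b, hab, -, -, hn, h⟩ := h s (Ico_subset_Icc_self hs)
    have hγ' := h.contMDiffOn (isGood_chartCoeffs hθ hθ_ne hΛ hΛ_nonneg y) hab
    obtain ⟨hsrc, v, p, h⟩ := h
    have hs1 := lt_of_Icc_mem_nhdsWithin_right hn hs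
    have hs2 := Ico_subset_Icc_self hs1
    refine (mem_dom_iff (g₀ := g₀) (y := y) (v := rightVelocity m γ s) hΛ_nonneg (hsrc s hs2)).1 ?_
    rw [coord_rightVelocity_of_hasDerivWithinAt hγ' hs1 (hsrc s hs2) (h s hs2).1]
    exact (h s hs2).2.2.2.2

/-- The boundary term of the first variation formula at the time `s`. -/
def boundaryTerm (g₀ : RMetric m S) (θ : OneForm m S) (Λ : S → ℝ) (H : ℝ → ℝ → S) (s : ℝ) : ℝ :=
  pairing g₀ θ Λ (H 0 s) (velocity m (H 0) s).2 (velocity m (fun r => H r s) 0).2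

/-- The first variation formula on a short interval. -/
lemma integral_deriv_density_eq {δ u w : ℝ} {H : ℝ → ℝ → S} (hδ : 0 < δ)
    (h : IsExtremal g₀ θ Λ y (H 0) c a b)
    (huw : u < w) (hua : a ≤ u) (hwb : w ≤ b)
    (hu : u = 0 ∨ a < u) (hw : w = 1 ∨ w < b)
    (hH : ContMDiffOn 𝓘(ℝ, ℝ × ℝ) (𝓡 m) ∞ (fun p : ℝ × ℝ => H p.1 p.2) (strip δ u w))
    (hsrc : ∀ p ∈ strip δ u w, H p.1 p.2 ∈ (extChartAt (𝓡 m) y).source)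
    (hint : IntervalIntegrable
      (fun s => deriv (fun r => density (randersKropina g₀ θ Λ) H r s) 0) volume u w)
    {x₀ x₁ : S} (hx₀ : ∀ r ∈ Ioo (-δ) δ, H r 0 = x₀) (hx₁ : ∀ r ∈ Ioo (-δ) δ, H r 1 = x₁) :
    ∫ s in u..w, deriv (fun r => density (randersKropina g₀ θ Λ) H r s) 0 =
      boundaryTerm g₀ θ Λ H w - boundaryTerm g₀ θ Λ H u := by
  have hD := isGood_chartCoeffs (g₀ := g₀) hθ hθ_ne hΛ hΛ_nonneg y
  have hγ := h.contMDiffOn hD (hua.trans_lt (huw.trans_le hwb))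
  obtain ⟨hs, v, p, h⟩ := h
  set D := chartCoeffs g₀ θ Λ y
  set X := chartStrip m y H with hX
  have hXs := contDiffOn_chartStrip hH hsrc
  have hI : Icc u w ⊆ Icc a b := Icc_subset_Icc hua hwb
  have h0 : (0 : ℝ) ∈ Ioo (-δ) δ := ⟨by linarith, hδ⟩
  have hvel : ∀ s ∈ Ioo u w, stripVel δ u w X (0, s) = v s := fun s hs' => by
    rw [← coord_velocity_eq_stripVel hH hsrc h0 hs']
    exact coord_velocity_of_hasDerivWithinAt hγ ⟨hua.trans_lt hs'.1, hs'.2.trans_le hwb⟩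
      (hs s (hI (Ioo_subset_Icc_self hs'))) (h s (hI (Ioo_subset_Icc_self hs'))).1
  -- the boundary term in the chart
  have hβ : ∀ s ∈ Icc u w, boundaryTerm g₀ θ Λ H s = p s (stripVar δ u w X (0, s)) := by
    intro s hs'
    have h1 := (contMDiffOn_slice_left hH hs').contMDiffAt (Ioo_mem_nhds h0.1 h0.2)
    have h2 := hasDerivAt_stripVar hXs h0 hs'
    have h3 : coord y (velocity m (fun r => H r s) 0) = stripVar δ u w X (0, s) := by
      rw [coord_velocity (h1.mdifferentiableAt (by simp)) (hsrc (0, s) ⟨h0, hs'⟩)]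
      exact h2.deriv
    by_cases hsab : s ∈ Ioo a b
    · rw [(h s (hI hs')).2.2.1, ← h3, ← coord_velocity_of_hasDerivWithinAt hγ hsab
        (hs s (hI hs')) (h s (hI hs')).1]
      exact (momentum_coord (hs s (hI hs')) _ _).symm
    · -- at the end points of `[0,1]` the variation field vanishes
      have h4 : ∃ z, ∀ r ∈ Ioo (-δ) δ, H r s = z := by
        rcases hs'.1.eq_or_lt with rfl | h5
        · rcases hu with rfl | hu
          · exact ⟨x₀, hx₀⟩
          · exact absurd ⟨hu, huw.trans_le hwb⟩ hsab
        · rcases hs'.2.eq_or_lt with rfl | h6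
          · rcases hw with rfl | hw
            · exact ⟨x₁, hx₁⟩
            · exact absurd ⟨hua.trans_lt huw, hw⟩ hsab
          · exact absurd ⟨hua.trans_lt h5, h6.trans_le hwb⟩ hsab
      obtain ⟨z, hz⟩ := h4
      have h5 : stripVar δ u w X (0, s) = 0 := by
        rw [← h2.deriv]
        refine ((hasDerivAt_const (0 : ℝ) (extChartAt (𝓡 m) y z)).congr_of_eventuallyEq ?_).deriv
        filter_upwards [Ioo_mem_nhds h0.1 h0.2] with r hr
        rw [chartStrip, hz r hr]
      have h6 : (velocity m (fun r => H r s) 0).2 = (0 : TangentSpace (𝓡 m) (H 0 s)) := by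
        have := frame_coord (y := y) (hs s (hI hs')) (velocity m (fun r => H r s) 0).2
        rw [← this, show coord y ⟨H 0 s, (velocity m (fun r => H r s) 0).2⟩ =
          coord y (velocity m (fun r => H r s) 0) from rfl, h3, h5, map_zero]
      rw [boundaryTerm, h6, h5, map_zero]
      exact pairing_zero (velocity m (H 0) s).2
  rw [hβ w (right_mem_Icc.2 huw.le), hβ u (left_mem_Icc.2 huw.le)]
  refine intervalIntegral.integral_eq_sub_of_hasDerivAt_of_le huw.le
    (f := fun s => p s (stripVar δ u w X (0, s))) ?_ (fun s hs' => ?_) hint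
  · have h1 : ContinuousOn p (Icc u w) := fun s hs' =>
      ((h s (hI hs')).2.1.continuousWithinAt).mono hI
    exact h1.clm_apply ((contDiffOn_stripVar huw hXs).continuousOn.comp
      (Continuous.continuousOn (by fun_prop)) fun s hs' => ⟨h0, hs'⟩)
  · have hs'' := hI (Ioo_subset_Icc_self hs')
    have hdom : (X (0, s), stripVel δ u w X (0, s)) ∈ D.dom (extChartAt (𝓡 m) y).target := by
      rw [hvel s hs']
      exact (h s hs'').2.2.2.2
    have h1 : HasDerivAt (fun r => density (randersKropina g₀ θ Λ) H r s) _ 0 :=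
      (Coeffs.hasDerivAt_energy_strip hD hδ huw hXs hs' hdom).congr_of_eventuallyEq (by
        filter_upwards [Ioo_mem_nhds h0.1 h0.2] with r hr
        rw [density, ← coord_velocity_eq_stripVel hH hsrc hr hs']
        exact congrArg (fun c => 1 / 2 * c ^ 2) (chartCoeffs_F (v := velocity m (H r) s)
          (hsrc (r, s) ⟨hr, Ioo_subset_Icc_self hs'⟩)).symm)
    rw [h1.deriv]
    have h2 : HasDerivAt p (D.force (X (0, s)) (v s)) s :=
      (h s hs'').2.1.hasDerivAt (Icc_mem_nhds (hua.trans_lt hs'.1) (hs'.2.trans_le hwb))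
    have h3 := h2.clm_apply (hasDerivAt_stripVar_time huw hXs h0 hs')
    refine h3.congr_deriv ?_
    rw [hvel s hs', (h s hs'').2.2.1]
    rfl

/-- Solutions of the Euler-Lagrange equation are critical points of the energy. -/
lemma IsExtremalCurve.isFinslerGeodesic (h : IsExtremalCurve g₀ θ Λ γ c) :
    IsFinslerGeodesic (randersKropinaDomain θ Λ) (randersKropina g₀ θ Λ) (γ 0) (γ 1) γ := by
  refine ⟨h.mem_admissiblePaths hθ hθ_ne hΛ hΛ_nonneg, fun δ H hH => ?_⟩
  have h1 := hasDerivAt_energy_of_isVariation (g₀ := g₀) hθ hθ_ne hΛ hΛ_nonneg hH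
  have h2 := (diffUnderIntegral_of_isVariation (g₀ := g₀) hθ hθ_ne hΛ hΛ_nonneg hH).2.1
  have h0 : (0 : ℝ) ∈ Ioo (-δ) δ := ⟨by linarith [hH.pos], hH.pos⟩
  have h3 := h.congr (γ' := H 0) hH.eq_zero
  obtain ⟨N, t, ht, hp⟩ := hH.smooth
  have hint : ∀ u w, 0 ≤ u → u ≤ w → w ≤ 1 → IntervalIntegrable
      (fun s => deriv (fun r => density (randersKropina g₀ θ Λ) H r s) 0) volume u w :=
    fun u w hu huw hw => h2.mono_set (by
      rw [uIcc_of_le huw, uIcc_of_le zero_le_one]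
      exact Icc_subset_Icc hu hw)
  have hx₀ : ∀ r ∈ Ioo (-δ) δ, H r 0 = γ 0 := fun r hr => (hH.mem r hr).2.1
  have hx₁ : ∀ r ∈ Ioo (-δ) δ, H r 1 = γ 1 := fun r hr => (hH.mem r hr).2.2.1
  -- the boundary terms add up over a partition
  have h4 := ht.induction (fun u w =>
    ∫ s in u..w, deriv (fun r => density (randersKropina g₀ θ Λ) H r s) 0 =
      boundaryTerm g₀ θ Λ H w - boundaryTerm g₀ θ Λ H u) (fun x y z hx hxy hyz hz e1 e2 => by
    rw [← intervalIntegral.integral_add_adjacent_intervals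
      (hint x y hx hxy (hyz.trans hz)) (hint y z (hx.trans hxy) hyz hz), e1, e2]
    ring) (fun i s hs => ?_) le_rfl zero_le_one le_rfl
  -- the variation field vanishes where the end points are fixed
  · have hend : ∀ s, (∃ z, ∀ r ∈ Ioo (-δ) δ, H r s = z) → boundaryTerm g₀ θ Λ H s = 0 := by
      rintro s ⟨z, hz⟩
      have h5 : HasMFDerivAt 𝓘(ℝ, ℝ) (𝓡 m) (fun r => H r s) 0
          (0 : TangentSpace 𝓘(ℝ, ℝ) (0 : ℝ) →L[ℝ] TangentSpace (𝓡 m) (H 0 s)) := by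
        refine (hasMFDerivAt_const z (0 : ℝ)).congr_of_eventuallyEq ?_
        filter_upwards [Ioo_mem_nhds h0.1 h0.2] with r hr using hz r hr
      have h6 : (velocity m (fun r => H r s) 0).2 = (0 : TangentSpace (𝓡 m) (H 0 s)) := by
        rw [velocity, h5.mfderiv]
        rfl
      rw [boundaryTerm, h6]
      exact pairing_zero (velocity m (H 0) s).2
    rw [h4, hend 0 ⟨_, hx₀⟩, hend 1 ⟨_, hx₁⟩, sub_zero] at h1
    exact h1
  · have hs01 : s ∈ Icc (0 : ℝ) 1 := ⟨(ht.nonneg _).trans hs.1, hs.2.trans (ht.le_one _)⟩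
    obtain ⟨y, a, b, hab, ha, hb, hn, h5⟩ := h3 s hs01
    obtain ⟨ρ₁, hρ₁, hsub₁⟩ := Metric.mem_nhdsWithin_iff.1 hn
    obtain ⟨ρ₂, hρ₂, hρδ, hsub₂⟩ := exists_strip_subset_source hH.pos (hp i) hs
      (h5.1 s (mem_of_mem_nhdsWithin hs01 hn))
    have e1 := min_le_left (ρ₁ / 2) ρ₂
    have e2 := min_le_right (ρ₁ / 2) ρ₂
    refine ⟨min (ρ₁ / 2) ρ₂, lt_min (half_pos hρ₁) hρ₂, fun u w hu huw hw hus hws => ?_⟩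
    rcases huw.eq_or_lt with rfl | huw'
    · simp
    have hu0 : 0 ≤ u := (ht.nonneg _).trans hu
    have hw1 : w ≤ 1 := hw.trans (ht.le_one _)
    have hball : ∀ r, s - ρ₁ < r → r < s + ρ₁ → r ∈ Icc (0 : ℝ) 1 → r ∈ Icc a b := by
      intro r h1 h2 h3
      refine hsub₁ ⟨?_, h3⟩
      rw [Metric.mem_ball, Real.dist_eq, abs_lt]
      exact ⟨by linarith, by linarith⟩
    have hu' := hball u (by linarith) (by linarith) ⟨hu0, huw.trans hw1⟩
    have hw' := hball w (by linarith) (by linarith) ⟨hu0.trans huw, hw1⟩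
    obtain ⟨hst, hsrc⟩ := hsub₂ u w hu hw (by linarith) (by linarith)
    refine integral_deriv_density_eq hθ hθ_ne hΛ hΛ_nonneg hρ₂ h5 huw' hu'.1 hw'.2 ?_ ?_
      ((hp i).mono hst) hsrc (hint u w hu0 huw hw1)
      (fun r hr => hx₀ r ⟨by linarith [hr.1], by linarith [hr.2]⟩)
      (fun r hr => hx₁ r ⟨by linarith [hr.1], by linarith [hr.2]⟩)
    · rcases hu0.eq_or_lt with h | h
      · exact Or.inl h.symm
      · refine Or.inr (lt_of_lt_of_le' (b := max 0 (u - ρ₁ / 2)) ?_ ?_)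
        · exact max_lt h (by linarith)
        · exact (hball _ (by linarith [le_max_right 0 (u - ρ₁ / 2)])
            (by linarith [max_lt h (show u - ρ₁ / 2 < u by linarith)])
            ⟨le_max_left _ _, by linarith [max_lt h (show u - ρ₁ / 2 < u by linarith)]⟩).1
    · rcases hw1.eq_or_lt with h | h
      · exact Or.inl h
      · refine Or.inr (lt_of_lt_of_le (b := min 1 (w + ρ₁ / 2)) ?_ ?_)
        · exact lt_min h (by linarith)
        · exact (hball _ (by linarith [lt_min h (show w < w + ρ₁ / 2 by linarith)])
            (by linarith [min_le_right 1 (w + ρ₁ / 2)])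
            ⟨by linarith [lt_min h (show w < w + ρ₁ / 2 by linarith)], min_le_left _ _⟩).2

end Extremal

/-! ### Lengths, distances and the compact set containing the geodesics -/

section Length

open MeasureTheory

variable {m : ℕ} {S : Type*} [TopologicalSpace S]
  [ChartedSpace (EuclideanSpace ℝ (Fin m)) S] {γ : ℝ → S}

lemma isPiecewiseSmooth_of_contMDiffOn (hγ : ContMDiffOn 𝓘(ℝ, ℝ) (𝓡 m) ∞ γ (Icc 0 1)) :
    IsPiecewiseSmooth m γ := by
  refine ⟨hγ.continuousOn, 1, ![0, 1], ⟨?_, rfl, rfl⟩, fun i => ?_⟩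
  · rw [Fin.strictMono_iff_lt_succ]
    intro i
    fin_cases i
    simp
  · fin_cases i
    exact hγ

/-- The distance is bounded by the speed of a connecting curve. -/
lemma pathDist_le_of_speed_le {F : TangentBundle (𝓡 m) S → ℝ} (hF : ∀ v, 0 ≤ F v)
    (hγ : ContMDiffOn 𝓘(ℝ, ℝ) (𝓡 m) ∞ γ (Icc 0 1)) {C : ℝ}
    (hC : ∀ u ∈ Ioo (0 : ℝ) 1, F (velocity m γ u) ≤ C) : pathDist F (γ 0) (γ 1) ≤ C := by
  have h1 : BddBelow (finslerLength F '' admissiblePaths (univ : Set (TangentBundle (𝓡 m) S)) (γ 0) (γ 1)) := by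
    refine ⟨0, ?_⟩
    rintro _ ⟨γ', -, rfl⟩
    exact intervalIntegral.integral_nonneg zero_le_one fun s _ => hF _
  have h2 : γ ∈ admissiblePaths (m := m) univ (γ 0) (γ 1) :=
    ⟨isPiecewiseSmooth_of_contMDiffOn hγ, rfl, rfl, fun _ _ => mem_univ _, fun _ _ => mem_univ _⟩
  refine (csInf_le h1 ⟨γ, h2, rfl⟩).trans ((le_abs_self _).trans ?_)
  have h3 : ∀ᵐ u : ℝ, u ∈ uIoc 0 1 → ‖F (velocity m γ u)‖ ≤ C := by
    filter_upwards [(countable_singleton (1 : ℝ)).ae_notMem volume] with u hu hu'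
    rw [uIoc_of_le zero_le_one] at hu'
    rw [Real.norm_eq_abs, abs_of_nonneg (hF _)]
    exact hC u ⟨hu'.1, lt_of_le_of_ne hu'.2 hu⟩
  have h4 := intervalIntegral.norm_integral_le_of_norm_le_const_ae h3
  simpa [finslerLength] using h4

lemma contMDiffOn_affine (hγ : ContMDiffOn 𝓘(ℝ, ℝ) (𝓡 m) ∞ γ (Icc 0 1)) {α β : ℝ} (hα : 0 ≤ α)
    (hβ : 0 ≤ β) (hαβ : α + β ≤ 1) :
    ContMDiffOn 𝓘(ℝ, ℝ) (𝓡 m) ∞ (fun u => γ (α + β * u)) (Icc 0 1) := by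
  have h1 : ContMDiff 𝓘(ℝ, ℝ) 𝓘(ℝ, ℝ) ∞ fun u : ℝ => α + β * u := ContDiff.contMDiff (by fun_prop)
  refine hγ.comp h1.contMDiffOn fun u hu => ⟨?_, ?_⟩
  · exact add_nonneg hα (mul_nonneg hβ hu.1)
  · nlinarith [hu.2]

lemma velocity_affine {α β u : ℝ} (hγ : MDifferentiableAt 𝓘(ℝ, ℝ) (𝓡 m) γ (α + β * u)) :
    velocity m (fun u => γ (α + β * u)) u =
      ⟨γ (α + β * u), β • mfderiv 𝓘(ℝ, ℝ) (𝓡 m) γ (α + β * u) (1 : ℝ)⟩ := by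
  have h1 : HasDerivAt (fun u : ℝ => α + β * u) β u := by
    simpa using ((hasDerivAt_id u).const_mul β).const_add α
  have h2 := (hγ.hasMFDerivAt.comp u h1.hasFDerivAt.hasMFDerivAt).mfderiv
  set L : ℝ →L[ℝ] TangentSpace (𝓡 m) (γ (α + β * u)) :=
    mfderiv 𝓘(ℝ, ℝ) (𝓡 m) γ (α + β * u) with hL
  have h3 : mfderiv 𝓘(ℝ, ℝ) (𝓡 m) (fun u => γ (α + β * u)) u (1 : ℝ) = L ((1 : ℝ) • β) :=
    DFunLike.congr_fun h2 (1 : ℝ)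
  have h4 : L ((1 : ℝ) • β) = β • L 1 := by
    rw [one_smul, ← map_smul, smul_eq_mul, mul_one]
  rw [velocity, h3, h4]
  rfl

lemma chart_interval {s : ℝ} (hγ : ContinuousOn γ (Icc 0 1)) (hs : s ∈ Icc (0 : ℝ) 1) :
    ∃ δ > 0, ∀ s' ∈ Icc (0 : ℝ) 1, |s' - s| ≤ δ →
      γ s' ∈ (extChartAt (𝓡 m) (γ s)).source := by
  obtain ⟨ρ, hρ, hsub⟩ := Metric.mem_nhdsWithin_iff.1
    ((hγ s hs) (extChartAt_source_mem_nhds (I := 𝓡 m) (γ s)))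
  refine ⟨ρ / 2, half_pos hρ, fun s' hs' h => hsub ⟨?_, hs'⟩⟩
  rw [Metric.mem_ball, Real.dist_eq]
  linarith

variable [IsManifold (𝓡 m) ∞ S] {g₀ : RMetric m S} {θ : OneForm m S} {Λ Λ' : S → ℝ}

lemma inner_self_nonneg (g₀ : RMetric m S) (v : TangentBundle (𝓡 m) S) :
    0 ≤ g₀.inner v.1 v.2 v.2 := by
  rcases eq_or_ne v.2 0 with h | h
  · simp [h]
  · exact (g₀.pos _ _ h).le

lemma randersKropina_nonneg (hΛ_nonneg : ∀ x, 0 ≤ Λ x) (v : TangentBundle (𝓡 m) S) :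
    0 ≤ randersKropina g₀ θ Λ v :=
  rkFun_nonneg (hΛ_nonneg v.1) (inner_self_nonneg g₀ v)

lemma randersKropina_anti (hΛ_pos : ∀ x, 0 < Λ x) (h : ∀ x, Λ x ≤ Λ' x)
    (v : TangentBundle (𝓡 m) S) : randersKropina g₀ θ Λ' v ≤ randersKropina g₀ θ Λ v :=
  rkFun_anti (hΛ_pos v.1) (h v.1) (inner_self_nonneg g₀ v)

lemma randersKropina_smul {a : ℝ} (ha : 0 ≤ a) (z : S) (v : TangentSpace (𝓡 m) z) :
    randersKropina g₀ θ Λ ⟨z, a • v⟩ = a * randersKropina g₀ θ Λ ⟨z, v⟩ := by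
  rcases ha.eq_or_lt with rfl | ha
  · simp [randersKropina]
  · simp only [randersKropina, map_smul, smul_apply, smul_eq_mul]
    have h1 : √(Λ z * (a * (a * g₀.inner z v v)) + (a * θ z v) ^ 2) =
        a * √(Λ z * g₀.inner z v v + θ z v ^ 2) := by
      rw [show Λ z * (a * (a * g₀.inner z v v)) + (a * θ z v) ^ 2 =
        a ^ 2 * (Λ z * g₀.inner z v v + θ z v ^ 2) by ring, Real.sqrt_mul (by positivity),
        Real.sqrt_sq ha.le]
    rw [h1, show -(a * θ z v) + a * √(Λ z * g₀.inner z v v + θ z v ^ 2) =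
      a * (-(θ z v) + √(Λ z * g₀.inner z v v + θ z v ^ 2)) by ring,
      mul_div_mul_left _ _ ha.ne', mul_div_assoc]

/-- Geodesics of Randers metrics solve the Euler-Lagrange equation, with constant speed. -/
lemma exists_speed (hθ : θ.IsSmooth) (hθ_ne : ∀ x, θ x ≠ 0)
    (hΛ : ContMDiff (𝓡 m) 𝓘(ℝ, ℝ) ∞ Λ) (hΛ_pos : ∀ x, 0 < Λ x) {x₀ x₁ : S}
    (hγ : IsFinslerGeodesic univ (randersKropina g₀ θ Λ) x₀ x₁ γ) :
    ∃ c, 0 ≤ c ∧ ∀ (y : S) (a b : ℝ), 0 ≤ a → a < b → b ≤ 1 →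
      (∀ s ∈ Icc a b, γ s ∈ (extChartAt (𝓡 m) y).source) → IsExtremal g₀ θ Λ y γ c a b := by
  have hΛ_nonneg : ∀ x, 0 ≤ Λ x := fun x => (hΛ_pos x).le
  have hloc : ∀ (y : S) (a b : ℝ), 0 ≤ a → a < b → b ≤ 1 →
      (∀ s ∈ Icc a b, γ s ∈ (extChartAt (𝓡 m) y).source) →
      ∃ c, IsExtremal g₀ θ Λ y γ c a b := by
    intro y a b ha hab hb hsrc
    obtain ⟨v, p, c, h⟩ := exists_eulerLagrange_of_isFinslerGeodesic hθ hθ_ne hΛ hΛ_pos hγ ha hab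
      hb hsrc rfl
    exact ⟨c, hsrc, v, p, fun s hs => ⟨(h s hs).1, (h s hs).2.1, (h s hs).2.2.1, (h s hs).2.2.2,
      (extChartAt (𝓡 m) y).map_source (hsrc s hs), Or.inl (hΛ_pos _)⟩⟩
  have hconst : ∃ c, ∀ s ∈ Icc (0 : ℝ) 1 ∩ Ioo 0 1,
      randersKropina g₀ θ Λ (velocity m γ s) = c := by
    refine interval_induction zero_le_one (fun u w => ∃ c, ∀ s ∈ Icc u w ∩ Ioo 0 1,
      randersKropina g₀ θ Λ (velocity m γ s) = c) (fun u x w hu hux hxw hw => ?_) fun s hs => ?_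
    · rintro ⟨c, hc⟩ ⟨c', hc'⟩
      by_cases hx : x ∈ Ioo (0 : ℝ) 1
      · have : c = c' := (hc x ⟨right_mem_Icc.2 hux, hx⟩).symm.trans
          (hc' x ⟨left_mem_Icc.2 hxw, hx⟩)
        subst this
        refine ⟨c, fun s hs => ?_⟩
        rcases le_total s x with h | h
        · exact hc s ⟨⟨hs.1.1, h⟩, hs.2⟩
        · exact hc' s ⟨⟨h, hs.1.2⟩, hs.2⟩
      · rcases (hu.trans hux).eq_or_lt with h | h
        · exact ⟨c', fun s hs => hc' s ⟨⟨h ▸ hs.2.1.le, hs.1.2⟩, hs.2⟩⟩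
        · have h' : x = 1 := le_antisymm (hxw.trans hw) (not_lt.1 fun h' => hx ⟨h, h'⟩)
          exact ⟨c, fun s hs => hc s ⟨⟨hs.1.1, h' ▸ hs.2.2.le⟩, hs.2⟩⟩
    · obtain ⟨δ, hδ, hsrc⟩ := chart_interval (m := m) hγ.1.1.1 hs
      have hab : max 0 (s - δ) < min 1 (s + δ) := by
        rw [max_lt_iff, lt_min_iff, lt_min_iff]
        exact ⟨⟨one_pos, by linarith [hs.1]⟩, by linarith [hs.2], by linarith⟩
      obtain ⟨c, hc⟩ := hloc (γ s) _ _ (le_max_left _ _) hab (min_le_left _ _) fun s' hs' =>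
        hsrc s' ⟨(le_max_left _ _).trans hs'.1, hs'.2.trans (min_le_left _ _)⟩ (abs_le.2
          ⟨by linarith [(le_max_right 0 (s - δ)).trans hs'.1],
            by linarith [hs'.2.trans (min_le_right 1 (s + δ))]⟩)
      have hv : ∀ s' ∈ Ioo (0 : ℝ) 1, s - δ < s' → s' < s + δ →
          randersKropina g₀ θ Λ (velocity m γ s') = c := fun s' h1 h2 h3 =>
        hc.speed_eq hθ hθ_ne hΛ hΛ_nonneg ⟨max_lt h1.1 h2, lt_min h1.2 h3⟩
      refine ⟨δ, hδ, fun x hx => ⟨fun h1 h2 => ⟨c, fun s' hs' => hv s' hs'.2 ?_ ?_⟩,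
        fun h1 h2 => ⟨c, fun s' hs' => hv s' hs'.2 ?_ ?_⟩⟩⟩
      · exact h1.trans_le hs'.1.1
      · linarith [hs'.1.2]
      · linarith [hs'.1.1]
      · exact hs'.1.2.trans_lt h2
  obtain ⟨c, hc⟩ := hconst
  have hhalf : (1 / 2 : ℝ) ∈ Icc (0 : ℝ) 1 ∩ Ioo 0 1 := by norm_num
  refine ⟨c, ?_, fun y a b ha hab hb hsrc => ?_⟩
  · rw [← hc _ hhalf]
    exact randersKropina_nonneg hΛ_nonneg _
  · obtain ⟨c', hc'⟩ := hloc y a b ha hab hb hsrc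
    have hmid : (a + b) / 2 ∈ Ioo a b := ⟨by linarith, by linarith⟩
    have hmid' : (a + b) / 2 ∈ Ioo (0 : ℝ) 1 := ⟨by linarith, by linarith⟩
    have h1 := hc'.speed_eq hθ hθ_ne hΛ hΛ_nonneg hmid
    rw [hc _ ⟨Ioo_subset_Icc_self hmid', hmid'⟩] at h1
    rwa [h1]

/-- A curve that is a solution of the Euler-Lagrange equation in every chart. -/
lemma isExtremalCurve_of_forall {c : ℝ} (hγ : ContinuousOn γ (Icc 0 1))
    (h : ∀ (y : S) (a b : ℝ), 0 ≤ a → a < b → b ≤ 1 →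
      (∀ s ∈ Icc a b, γ s ∈ (extChartAt (𝓡 m) y).source) → IsExtremal g₀ θ Λ y γ c a b) :
    IsExtremalCurve g₀ θ Λ γ c := by
  intro s hs
  obtain ⟨δ, hδ, hsrc⟩ := chart_interval (m := m) hγ hs
  have hab : max 0 (s - δ) < min 1 (s + δ) := by
    rw [max_lt_iff, lt_min_iff, lt_min_iff]
    exact ⟨⟨one_pos, by linarith [hs.1]⟩, by linarith [hs.2], by linarith⟩
  refine ⟨γ s, max 0 (s - δ), min 1 (s + δ), hab, le_max_left _ _, min_le_left _ _, ?_,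
    h _ _ _ (le_max_left _ _) hab (min_le_left _ _) fun s' hs' =>
        hsrc s' ⟨(le_max_left _ _).trans hs'.1, hs'.2.trans (min_le_left _ _)⟩ (abs_le.2
          ⟨by linarith [(le_max_right 0 (s - δ)).trans hs'.1],
            by linarith [hs'.2.trans (min_le_right 1 (s + δ))]⟩)⟩
  filter_upwards [self_mem_nhdsWithin, mem_nhdsWithin_of_mem_nhds
    (Ioo_mem_nhds (show s - δ < s by linarith) (show s < s + δ by linarith))] with s' h1 h2
  exact ⟨max_le h1.1 h2.1.le, le_min h1.2 h2.2.le⟩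

/-- A restriction of a curve of constant speed bounds the distance for every smaller metric. -/
lemma pathDist_affine_le {F : TangentBundle (𝓡 m) S → ℝ} (hF : ∀ v, 0 ≤ F v)
    (hF' : ∀ v, F v ≤ randersKropina g₀ θ Λ v)
    (hγ : ContMDiffOn 𝓘(ℝ, ℝ) (𝓡 m) ∞ γ (Icc 0 1)) {c : ℝ} (hc : 0 ≤ c)
    (hγc : ∀ s ∈ Ioo (0 : ℝ) 1, randersKropina g₀ θ Λ (velocity m γ s) = c)
    {α β : ℝ} (hα : 0 ≤ α) (hβ : 0 < β) (hαβ : α + β ≤ 1) :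
    pathDist F (γ α) (γ (α + β)) ≤ c := by
  have h1 : ∀ u ∈ Ioo (0 : ℝ) 1, F (velocity m (fun u => γ (α + β * u)) u) ≤ c := by
    intro u hu
    have hu' : α + β * u ∈ Ioo (0 : ℝ) 1 :=
      ⟨by nlinarith [hu.1, mul_pos hβ hu.1], by nlinarith [hu.2]⟩
    have h2 : MDifferentiableAt 𝓘(ℝ, ℝ) (𝓡 m) γ (α + β * u) :=
      (hγ.contMDiffAt (Icc_mem_nhds hu'.1 hu'.2)).mdifferentiableAt (by simp)
    refine (hF' _).trans ?_
    rw [velocity_affine h2, randersKropina_smul hβ.le]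
    calc _ = β * c := by rw [← hγc _ hu']; rfl
      _ ≤ c := by nlinarith
  have h2 := pathDist_le_of_speed_le hF (contMDiffOn_affine hγ hα hβ.le hαβ) h1
  simpa using h2

end Length

/-! ### Limits of geodesics in a chart -/

section Limit

lemma exists_tendsto_of_mem_isCompact {ι X : Type*} [TopologicalSpace X] {K : Set X}
    (hK : IsCompact K) (u : Ultrafilter ι) {f : ι → X} (hf : ∀ᶠ i in (u : Filter ι), f i ∈ K) :
    ∃ x ∈ K, Tendsto f u (𝓝 x) := by
  obtain ⟨x, hx, h⟩ := hK.ultrafilter_le_nhds (u.map f) (le_principal_iff.2 hf)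
  exact ⟨x, hx, h⟩

lemma tendsto_prod_of_uniform {V : Type*} [NormedAddCommGroup V] {l : Filter ℝ} {I : Set ℝ} {s : ℝ}
    {f : ℝ → ℝ → V} {K : ℝ} {w : V} (h1 : Tendsto (fun ε => f ε s) l (𝓝 w))
    (h2 : ∀ᶠ ε in l, ∀ t ∈ I, ‖f ε t - f ε s‖ ≤ K * ‖t - s‖) :
    Tendsto (fun z : ℝ × ℝ => f z.1 z.2) (l ×ˢ 𝓝[I] s) (𝓝 w) := by
  have h3 : Tendsto (fun z : ℝ × ℝ => K * ‖z.2 - s‖) (l ×ˢ 𝓝[I] s) (𝓝 0) := by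
    have h4 : Tendsto (fun t : ℝ => K * ‖t - s‖) (𝓝[I] s) (𝓝 0) := by
      have : Continuous fun t : ℝ => K * ‖t - s‖ := by fun_prop
      simpa using this.continuousAt.tendsto.mono_left (nhdsWithin_le_nhds (a := s) (s := I))
    exact h4.comp tendsto_snd
  have h5 : Tendsto (fun z : ℝ × ℝ => f z.1 z.2 - f z.1 s) (l ×ˢ 𝓝[I] s) (𝓝 0) := by
    refine squeeze_zero_norm' ?_ h3
    have h6 : ∀ᶠ t in 𝓝[I] s, t ∈ I := self_mem_nhdsWithin
    filter_upwards [h2.prod_mk h6] with z hz using hz.1 z.2 hz.2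
  have h7 := h5.add (h1.comp (tendsto_fst (f := l) (g := 𝓝[I] s)))
  simpa using h7

namespace Coeffs

variable {E : Type*} [NormedAddCommGroup E] [NormedSpace ℝ E] [FiniteDimensional ℝ E]
  {D : Coeffs E} {U B : Set E} {a b c C M ε s₀ : ℝ}

/-- A bound for the Hamiltonian vector fields of the metrics `F_ε` over `B`. -/
def IsBound (D : Coeffs E) (B : Set E) (C : ℝ) : Prop :=
  ∀ ε ∈ Icc (0 : ℝ) 1, ∀ x ∈ B, ∀ p : E →L[ℝ] ℝ, p ≠ 0 →
    ‖(D.add ε).vel x p‖ ≤ C ∧ ‖(D.add ε).drift x p‖ ≤ C * ‖p‖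

lemma norm_le_of_F_eq (hD : D.IsGood U) (hC : D.IsBound B C) (hC0 : 0 ≤ C) (hε : ε ∈ Icc (0 : ℝ) 1)
    {x v : E} (hx : x ∈ B) (hz : (x, v) ∈ (D.add ε).dom U) (hF : (D.add ε).F x v = c) :
    ‖v‖ ≤ C * c := by
  have hDε := hD.add hε.1
  have hc : 0 ≤ c := hF ▸ hDε.F_nonneg hz.1 v
  rcases eq_or_ne v 0 with rfl | hv
  · rw [norm_zero]
    positivity
  · have h1 := vel_momentum hDε hz hv
    rw [hF] at h1
    rw [← h1, norm_smul, Real.norm_of_nonneg hc, mul_comm]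
    gcongr
    exact (hC ε hε x hx _ (momentum_ne_zero hDε hz hv)).1

/-- Solutions of the Euler-Lagrange equation as solutions of the Hamiltonian equation, with a
normalized momentum. -/
lemma exists_normalized (hD : D.IsGood U) (hC : D.IsBound B C) (hC0 : 0 ≤ C)
    (hε : ε ∈ Icc (0 : ℝ) 1) (hs₀ : s₀ ∈ Icc a b) (hc : 0 < c) (hcM : c ≤ M)
    (hMC : M * C * (b - a) ≤ 1 / 4) {x v : ℝ → E} {p : ℝ → E →L[ℝ] ℝ}
    (hxB : ∀ s ∈ Icc a b, x s ∈ B) (hdom : ∀ s ∈ Icc a b, (x s, v s) ∈ (D.add ε).dom U)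
    (hx : ∀ s ∈ Icc a b, HasDerivWithinAt x (v s) (Icc a b) s)
    (hp : ∀ s ∈ Icc a b, HasDerivWithinAt p ((D.add ε).force (x s) (v s)) (Icc a b) s)
    (hpm : ∀ s ∈ Icc a b, p s = (D.add ε).momentum (x s) (v s))
    (hF : ∀ s ∈ Icc a b, (D.add ε).F (x s) (v s) = c) :
    ∃ (q : ℝ → E →L[ℝ] ℝ) (k : ℝ), ∀ s ∈ Icc a b, 1 / 2 ≤ ‖q s‖ ∧ ‖q s‖ ≤ 2 ∧
      HasDerivWithinAt x (c • (D.add ε).vel (x s) (q s)) (Icc a b) s ∧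
      HasDerivWithinAt q (c • (D.add ε).drift (x s) (q s)) (Icc a b) s ∧
      (D.add ε).H (x s) (q s) = k := by
  have hDε := hD.add hε.1
  have hv : ∀ s ∈ Icc a b, v s ≠ 0 := fun s hs h => by
    have h1 := hF s hs
    rw [h, F, speed_zero] at h1
    exact hc.ne h1
  have hp0 : ∀ s ∈ Icc a b, p s ≠ 0 := fun s hs => by
    rw [hpm s hs]
    exact momentum_ne_zero hDε (hdom s hs) (hv s hs)
  set lam := ‖p s₀‖⁻¹ with hlam
  have hlam0 : 0 < lam := inv_pos.2 (norm_pos_iff.2 (hp0 s₀ hs₀))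
  set q : ℝ → E →L[ℝ] ℝ := fun s => lam • p s with hq
  have hq0 : ∀ s ∈ Icc a b, q s ≠ 0 := fun s hs => smul_ne_zero hlam0.ne' (hp0 s hs)
  have hqd : ∀ s ∈ Icc a b,
      HasDerivWithinAt q (c • (D.add ε).drift (x s) (q s)) (Icc a b) s := fun s hs => by
    have h1 := (hp s hs).const_smul lam
    rw [force_eq_drift hDε (hdom s hs) (hv s hs), hF s hs, ← hpm s hs, smul_comm,
      ← drift_smul hlam0] at h1
    exact h1
  have hqs₀ : ‖q s₀‖ = 1 := by
    rw [hq]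
    simp only
    rw [norm_smul, Real.norm_of_nonneg hlam0.le, hlam,
      inv_mul_cancel₀ (norm_ne_zero_iff.2 (hp0 s₀ hs₀))]
  -- comparing with the maximum of `‖q‖` replaces Grönwall's inequality
  obtain ⟨s₁, hs₁, hmax⟩ := isCompact_Icc.exists_isMaxOn ⟨s₀, hs₀⟩
    (f := fun s => ‖q s‖) fun s hs => (hqd s hs).continuousWithinAt.norm
  have hmax' : ∀ s ∈ Icc a b, ‖q s‖ ≤ ‖q s₁‖ := fun s hs => hmax hs
  have hM0 : 0 ≤ M := hc.le.trans hcM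
  have hdiff : ∀ s ∈ Icc a b, ‖q s - q s₀‖ ≤ ‖q s₁‖ / 4 := fun s hs => by
    have h1 : ∀ s ∈ Icc a b, ‖c • (D.add ε).drift (x s) (q s)‖ ≤ M * (C * ‖q s₁‖) := fun s hs => by
      rw [norm_smul, Real.norm_of_nonneg hc.le]
      have h2 := (hC ε hε (x s) (hxB s hs) (q s) (hq0 s hs)).2
      have h3 : C * ‖q s‖ ≤ C * ‖q s₁‖ := by
        gcongr
        exact hmax' s hs
      exact mul_le_mul hcM (h2.trans h3) (norm_nonneg _) hM0
    have h2 := (convex_Icc a b).norm_image_sub_le_of_norm_hasDerivWithin_le hqd h1 hs₀ hs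
    have h3 : ‖s - s₀‖ ≤ b - a := by
      rw [Real.norm_eq_abs, abs_le]
      constructor <;> linarith [hs.1, hs.2, hs₀.1, hs₀.2]
    calc ‖q s - q s₀‖ ≤ M * (C * ‖q s₁‖) * ‖s - s₀‖ := h2
      _ ≤ M * (C * ‖q s₁‖) * (b - a) := by gcongr
      _ = M * C * (b - a) * ‖q s₁‖ := by ring
      _ ≤ 1 / 4 * ‖q s₁‖ := by gcongr
      _ = ‖q s₁‖ / 4 := by ring
  have hs₁le : ‖q s₁‖ ≤ 4 / 3 := by
    have h1 := hdiff s₁ hs₁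
    have h2 := norm_le_norm_add_norm_sub' (q s₁) (q s₀)
    rw [hqs₀] at h2
    linarith
  refine ⟨q, lam * c, fun s hs => ⟨?_, (hmax' s hs).trans (by linarith), ?_, hqd s hs, ?_⟩⟩
  · have h2 := norm_le_norm_add_norm_sub (q s) (q s₀)
    rw [hqs₀] at h2
    linarith [hdiff s hs]
  · have h1 := vel_momentum hDε (hdom s hs) (hv s hs)
    rw [hF s hs, ← hpm s hs, ← vel_smul (D := D.add ε) hlam0] at h1
    have h2 := hx s hs
    rw [← h1] at h2
    exact h2
  · rw [hq, H_smul hlam0.le, hpm s hs, H_momentum hDε (hdom s hs) (hv s hs), hF s hs]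

/-- Geodesics of the metrics `F_ε` subconverge, as solutions of the Hamiltonian equation, to
solutions for the limit metric. The limit of the Hamiltonian may be zero. -/
lemma exists_limit (hD : D.IsGood U) (hB : IsCompact B) (hBU : B ⊆ U) (hC : D.IsBound B C)
    (hC0 : 0 ≤ C) {u : Ultrafilter ℝ} (hu : (u : Filter ℝ) ≤ 𝓝 0)
    (hu1 : ∀ᶠ ε in (u : Filter ℝ), ε ∈ Icc (0 : ℝ) 1) (hs₀ : s₀ ∈ Icc a b)
    (hMC : M * C * (b - a) ≤ 1 / 4) {c : ℝ → ℝ} {c₀ : ℝ} (hc : Tendsto c u (𝓝 c₀))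
    (hcM : ∀ᶠ ε in (u : Filter ℝ), 0 < c ε ∧ c ε ≤ M) {x : ℝ → ℝ → E}
    (hx : ∀ᶠ ε in (u : Filter ℝ), ∃ (v : ℝ → E) (p : ℝ → E →L[ℝ] ℝ), ∀ s ∈ Icc a b,
      x ε s ∈ B ∧ (x ε s, v s) ∈ (D.add ε).dom U ∧ HasDerivWithinAt (x ε) (v s) (Icc a b) s ∧
      HasDerivWithinAt p ((D.add ε).force (x ε s) (v s)) (Icc a b) s ∧
      p s = (D.add ε).momentum (x ε s) (v s) ∧ (D.add ε).F (x ε s) (v s) = c ε) :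
    ∃ (X y : ℝ → E) (q : ℝ → E →L[ℝ] ℝ) (k : ℝ), ∀ s ∈ Icc a b, X s ∈ B ∧ q s ≠ 0 ∧
      Tendsto (fun ε => x ε s) u (𝓝 (X s)) ∧
      Tendsto (fun ε => (c ε)⁻¹ • (x ε s - x ε s₀)) u (𝓝 (y s)) ∧
      HasDerivWithinAt X (c₀ • D.vel (X s) (q s)) (Icc a b) s ∧
      HasDerivWithinAt q (c₀ • D.drift (X s) (q s)) (Icc a b) s ∧
      HasDerivWithinAt y (D.vel (X s) (q s)) (Icc a b) s ∧ D.H (X s) (q s) = k := by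
  have := FiniteDimensional.proper ℝ E
  have hnorm : ∀ᶠ ε in (u : Filter ℝ), ∃ (q : ℝ → E →L[ℝ] ℝ) (k : ℝ), ∀ s ∈ Icc a b,
      x ε s ∈ B ∧ 1 / 2 ≤ ‖q s‖ ∧ ‖q s‖ ≤ 2 ∧
      HasDerivWithinAt (x ε) (c ε • (D.add ε).vel (x ε s) (q s)) (Icc a b) s ∧
      HasDerivWithinAt q (c ε • (D.add ε).drift (x ε s) (q s)) (Icc a b) s ∧
      (D.add ε).H (x ε s) (q s) = k := by
    filter_upwards [hu1, hcM, hx] with ε h1 h2 ⟨v, p, h3⟩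
    obtain ⟨q, k, h4⟩ := exists_normalized hD hC hC0 h1 hs₀ h2.1 h2.2 hMC (fun s hs => (h3 s hs).1)
      (fun s hs => (h3 s hs).2.1) (fun s hs => (h3 s hs).2.2.1) (fun s hs => (h3 s hs).2.2.2.1)
      (fun s hs => (h3 s hs).2.2.2.2.1) (fun s hs => (h3 s hs).2.2.2.2.2)
    exact ⟨q, k, fun s hs => ⟨(h3 s hs).1, h4 s hs⟩⟩
  classical
  choose! Q k hQ using fun (ε : ℝ) (h : ∃ (q : ℝ → E →L[ℝ] ℝ) (k : ℝ), ∀ s ∈ Icc a b,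
      x ε s ∈ B ∧ 1 / 2 ≤ ‖q s‖ ∧ ‖q s‖ ≤ 2 ∧
      HasDerivWithinAt (x ε) (c ε • (D.add ε).vel (x ε s) (q s)) (Icc a b) s ∧
      HasDerivWithinAt q (c ε • (D.add ε).drift (x ε s) (q s)) (Icc a b) s ∧
      (D.add ε).H (x ε s) (q s) = k) => h
  have hgood := hnorm.mono hQ
  have hab : 0 ≤ b - a := by linarith [hs₀.1, hs₀.2]
  have hM0 : 0 ≤ M := by
    obtain ⟨ε, h⟩ := hcM.exists
    exact h.1.le.trans h.2
  set A : Set (E →L[ℝ] ℝ) := {q | 1 / 2 ≤ ‖q‖ ∧ ‖q‖ ≤ 2} with hA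
  have hAc : IsCompact A := by
    refine Metric.isCompact_of_isClosed_isBounded ?_ ?_
    · exact (isClosed_le continuous_const continuous_norm).inter
        (isClosed_le continuous_norm continuous_const)
    · exact (Metric.isBounded_closedBall (x := (0 : E →L[ℝ] ℝ)) (r := 2)).subset
        fun q (hq : q ∈ A) => by simpa using hq.2
  have hAne : ∀ q ∈ A, q ≠ 0 := by
    rintro q hq rfl
    have := hq.1
    norm_num at this
  -- the limits
  have hX : ∀ s ∈ Icc a b, ∃ X ∈ B, Tendsto (fun ε => x ε s) u (𝓝 X) := fun s hs =>
    exists_tendsto_of_mem_isCompact hB u (hgood.mono fun ε h => (h s hs).1)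
  choose! X hXB hX using hX
  have hq : ∀ s ∈ Icc a b, ∃ q ∈ A, Tendsto (fun ε => Q ε s) u (𝓝 q) := fun s hs =>
    exists_tendsto_of_mem_isCompact hAc u (hgood.mono fun ε h => ⟨(h s hs).2.1, (h s hs).2.2.1⟩)
  choose! q hqA hq using hq
  have hε0 : Tendsto (fun ε : ℝ => ε) u (𝓝 0) := hu
  -- equicontinuity
  set L := M * C + M * (C * 2) with hL
  have hCC : 0 ≤ C * 2 := by linarith
  have hxL : ∀ᶠ ε in (u : Filter ℝ), ∀ s ∈ Icc a b, ∀ t ∈ Icc a b,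
      ‖x ε t - x ε s‖ ≤ c ε * C * ‖t - s‖ ∧ ‖Q ε t - Q ε s‖ ≤ M * (C * 2) * ‖t - s‖ := by
    filter_upwards [hgood, hcM, hu1] with ε h1 h2 h3 s hs t ht
    refine ⟨(convex_Icc a b).norm_image_sub_le_of_norm_hasDerivWithin_le
      (fun s hs => (h1 s hs).2.2.2.1) (fun s hs => ?_) hs ht,
      (convex_Icc a b).norm_image_sub_le_of_norm_hasDerivWithin_le
      (fun s hs => (h1 s hs).2.2.2.2.1) (fun s hs => ?_) hs ht⟩
    · have h4 := (hC ε h3 _ (h1 s hs).1 _ (hAne _ ⟨(h1 s hs).2.1, (h1 s hs).2.2.1⟩)).1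
      rw [norm_smul, Real.norm_of_nonneg h2.1.le]
      exact mul_le_mul_of_nonneg_left h4 h2.1.le
    · have h4 := (hC ε h3 _ (h1 s hs).1 _ (hAne _ ⟨(h1 s hs).2.1, (h1 s hs).2.2.1⟩)).2
      rw [norm_smul, Real.norm_of_nonneg h2.1.le]
      have h5 : C * ‖Q ε s‖ ≤ C * 2 := mul_le_mul_of_nonneg_left (h1 s hs).2.2.1 hC0
      exact mul_le_mul h2.2 (h4.trans h5) (norm_nonneg _) hM0
  have hy : ∀ s ∈ Icc a b, ∃ y ∈ Metric.closedBall (0 : E) (C * (b - a)),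
      Tendsto (fun ε => (c ε)⁻¹ • (x ε s - x ε s₀)) u (𝓝 y) := fun s hs =>
    exists_tendsto_of_mem_isCompact (isCompact_closedBall _ _) u (by
      filter_upwards [hxL, hcM] with ε h1 h2
      have h3 : ‖s - s₀‖ ≤ b - a := by
        rw [Real.norm_eq_abs, abs_le]
        constructor <;> linarith [hs.1, hs.2, hs₀.1, hs₀.2]
      rw [mem_closedBall_zero_iff, norm_smul, norm_inv, Real.norm_of_nonneg h2.1.le]
      calc (c ε)⁻¹ * ‖x ε s - x ε s₀‖ ≤ (c ε)⁻¹ * (c ε * C * (b - a)) := by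
            have := (h1 s₀ hs₀ s hs).1
            have h4 : 0 ≤ c ε * C := mul_nonneg h2.1.le hC0
            have h5 : 0 ≤ (c ε)⁻¹ := inv_nonneg.2 h2.1.le
            exact mul_le_mul_of_nonneg_left
              (this.trans (mul_le_mul_of_nonneg_left h3 h4)) h5
        _ = C * (b - a) := by
            rw [mul_assoc, inv_mul_cancel_left₀ h2.1.ne'])
  choose! y _ hy using hy
  have hjoint : ∀ s ∈ Icc a b, Tendsto (fun z : ℝ × ℝ => (z.1, x z.1 z.2, Q z.1 z.2))
      ((u : Filter ℝ) ×ˢ 𝓝[Icc a b] s) (𝓝 (0, X s, q s)) := by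
    intro s hs
    refine Tendsto.prodMk_nhds (hε0.comp tendsto_fst) (Tendsto.prodMk_nhds ?_ ?_)
    · refine tendsto_prod_of_uniform (K := M * C) (hX s hs) ?_
      filter_upwards [hxL, hcM] with ε h1 h2 t ht
      refine (h1 s hs t ht).1.trans ?_
      have := h2.2
      gcongr
    · refine tendsto_prod_of_uniform (K := M * (C * 2)) (hq s hs) ?_
      filter_upwards [hxL] with ε h1 t ht using (h1 s hs t ht).2
  have hvel : ∀ s ∈ Icc a b, Tendsto (fun z : ℝ × ℝ => (D.add z.1).vel (x z.1 z.2) (Q z.1 z.2))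
      ((u : Filter ℝ) ×ˢ 𝓝[Icc a b] s) (𝓝 (D.vel (X s) (q s))) := fun s hs => by
    have h1 := (hD.contDiffAt_vel (y := (0, X s, q s)) (hBU (hXB s hs)) le_rfl
      (hAne _ (hqA s hs))).continuousAt.tendsto.comp (hjoint s hs)
    simpa [Function.comp_def, add_zero] using h1
  have hdrift : ∀ s ∈ Icc a b,
      Tendsto (fun z : ℝ × ℝ => (D.add z.1).drift (x z.1 z.2) (Q z.1 z.2))
      ((u : Filter ℝ) ×ˢ 𝓝[Icc a b] s) (𝓝 (D.drift (X s) (q s))) := fun s hs => by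
    have h1 := (hD.contDiffAt_drift (y := (0, X s, q s)) (hBU (hXB s hs)) le_rfl
      (hAne _ (hqA s hs))).continuousAt.tendsto.comp (hjoint s hs)
    simpa [Function.comp_def, add_zero] using h1
  have hH : ∀ s ∈ Icc a b, Tendsto k u (𝓝 (D.H (X s) (q s))) := fun s hs => by
    have h0 : Tendsto (fun ε => (ε, x ε s, Q ε s)) u (𝓝 (0, X s, q s)) :=
      hε0.prodMk_nhds ((hX s hs).prodMk_nhds (hq s hs))
    have h1 := (hD.contDiffAt_H (y := (0, X s, q s)) (hBU (hXB s hs)) le_rfl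
      (hAne _ (hqA s hs))).continuousAt.tendsto.comp h0
    simp only [add_zero] at h1
    refine h1.congr' ?_
    filter_upwards [hgood] with ε h using (h s hs).2.2.2.2.2
  have hcs : ∀ s, Tendsto (fun z : ℝ × ℝ => c z.1) ((u : Filter ℝ) ×ˢ 𝓝[Icc a b] s) (𝓝 c₀) :=
    fun s => hc.comp tendsto_fst
  refine ⟨X, y, q, D.H (X s₀) (q s₀), fun s hs => ⟨hXB s hs, hAne _ (hqA s hs), hX s hs, hy s hs,
    ?_, ?_, ?_, tendsto_nhds_unique (hH s hs) (hH s₀ hs₀)⟩⟩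
  · refine hasDerivWithinAt_of_tendsto (convex_Icc a b) hs (z := x)
      (z' := fun ε s => c ε • (D.add ε).vel (x ε s) (Q ε s)) ?_ hX ((hcs s).smul (hvel s hs))
    filter_upwards [hgood] with ε h t ht using (h t ht).2.2.2.1
  · refine hasDerivWithinAt_of_tendsto (convex_Icc a b) hs (z := Q)
      (z' := fun ε s => c ε • (D.add ε).drift (x ε s) (Q ε s)) ?_ hq ((hcs s).smul (hdrift s hs))
    filter_upwards [hgood] with ε h t ht using (h t ht).2.2.2.2.1
  · refine hasDerivWithinAt_of_tendsto (convex_Icc a b) hs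
      (z := fun ε s => (c ε)⁻¹ • (x ε s - x ε s₀))
      (z' := fun ε s => (D.add ε).vel (x ε s) (Q ε s)) ?_ hy (hvel s hs)
    filter_upwards [hgood, hcM] with ε h h2 t ht
    have h3 := ((h t ht).2.2.2.1.sub_const (x ε s₀)).const_smul (c ε)⁻¹
    rwa [smul_smul, inv_mul_cancel₀ h2.1.ne', one_smul] at h3

end Coeffs

end Limit

/-! ### Confinement to a chart -/

section Confinement

open Metric

lemma eq_of_eventually_eq {X : Type*} {γ : ℝ → X}
    (h : ∀ s ∈ Icc (0 : ℝ) 1, ∀ᶠ t in 𝓝[Icc 0 1] s, γ t = γ s) {s : ℝ}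
    (hs : s ∈ Icc (0 : ℝ) 1) : γ s = γ 0 := by
  refine interval_induction hs.1 (fun u w => γ w = γ u)
    (fun u x w _ _ _ _ h1 h2 => h2.trans h1) fun t ht => ?_
  obtain ⟨ρ, hρ, hsub⟩ := mem_nhdsWithin_iff.1 (h t ⟨ht.1, ht.2.trans hs.2⟩)
  refine ⟨ρ, hρ, fun x hx => ⟨fun h1 h2 => ?_, fun h1 h2 => ?_⟩⟩
  · refine (hsub ⟨?_, hx.1, hx.2.trans hs.2⟩).symm
    rw [mem_ball, Real.dist_eq, abs_lt]
    constructor <;> linarith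
  · refine hsub ⟨?_, hx.1, hx.2.trans hs.2⟩
    rw [mem_ball, Real.dist_eq, abs_lt]
    constructor <;> linarith

variable {m : ℕ} {S : Type*} [TopologicalSpace S]
  [ChartedSpace (EuclideanSpace ℝ (Fin m)) S] {γ : ℝ → S} {y : S}
  {a b c s₀ C M r ε : ℝ} {xc : EuclideanSpace ℝ (Fin m)}

/-- Compact sets in a chart are closed in the manifold. -/
lemma isClosed_image_closedBall [T2Space S] (hball : closedBall xc r ⊆ (extChartAt (𝓡 m) y).target) :
    IsClosed ((extChartAt (𝓡 m) y).symm '' closedBall xc r) :=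
  ((isCompact_closedBall xc r).image_of_continuousOn
    ((continuousOn_extChartAt_symm y).mono hball)).isClosed

lemma mem_image_closedBall_iff (hball : closedBall xc r ⊆ (extChartAt (𝓡 m) y).target) {z : S} :
    z ∈ (extChartAt (𝓡 m) y).symm '' closedBall xc r ↔
      z ∈ (extChartAt (𝓡 m) y).source ∧ extChartAt (𝓡 m) y z ∈ closedBall xc r := by
  constructor
  · rintro ⟨x, hx, rfl⟩
    rw [(extChartAt (𝓡 m) y).right_inv (hball hx)]
    exact ⟨(extChartAt (𝓡 m) y).map_target (hball hx), hx⟩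
  · rintro ⟨h1, h2⟩
    exact ⟨_, h2, (extChartAt (𝓡 m) y).left_inv h1⟩

variable [IsManifold (𝓡 m) ∞ S] {g₀ : RMetric m S} {θ : OneForm m S} {Λ : S → ℝ}

/-- In every chart, the continuous curve `γ` solves the Euler-Lagrange equation, with speed `c`. -/
def SolvesEulerLagrange (g₀ : RMetric m S) (θ : OneForm m S) (Λ : S → ℝ) (γ : ℝ → S) (c : ℝ) :
    Prop :=
  ContinuousOn γ (Icc 0 1) ∧ ∀ (y : S) (a b : ℝ), 0 ≤ a → a < b → b ≤ 1 →
    (∀ s ∈ Icc a b, γ s ∈ (extChartAt (𝓡 m) y).source) → IsExtremal g₀ θ Λ y γ c a b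

/-- A curve of speed at most `M` stays in a ball of the chart during the time that the bound `M * C`
for its coordinate velocity in the ball permits. -/
lemma SolvesEulerLagrange.mem_chart [T2Space S]
    (hD : (chartCoeffs g₀ θ Λ y).IsGood (extChartAt (𝓡 m) y).target)
    (hε : ε ∈ Icc (0 : ℝ) 1) (hγ : SolvesEulerLagrange g₀ θ (fun z => Λ z + ε) γ c) (hcM : c ≤ M)
    (hr : 0 < r) (hball : closedBall xc r ⊆ (extChartAt (𝓡 m) y).target)
    (hC : (chartCoeffs g₀ θ Λ y).IsBound (closedBall xc r) C) (hC0 : 0 ≤ C)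
    (ha : 0 ≤ a) (hb : b ≤ 1) (hs₀ : s₀ ∈ Icc a b) (hM : 0 ≤ M) (hMC : M * C * (b - a) ≤ r / 4)
    (hsrc : γ s₀ ∈ (extChartAt (𝓡 m) y).source)
    (hx : extChartAt (𝓡 m) y (γ s₀) ∈ closedBall xc (r / 4)) {s : ℝ} (hs : s ∈ Icc a b) :
    γ s ∈ (extChartAt (𝓡 m) y).source ∧ extChartAt (𝓡 m) y (γ s) ∈ closedBall xc (r / 2) := by
  set O : Set S := (extChartAt (𝓡 m) y).source ∩ extChartAt (𝓡 m) y ⁻¹' ball xc r with hO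
  have hOo : IsOpen O :=
    (continuousOn_extChartAt y).isOpen_inter_preimage (isOpen_extChartAt_source y) isOpen_ball
  have hγc : ContinuousOn γ (Icc a b) := hγ.1.mono (Icc_subset_Icc ha hb)
  have hball' : closedBall xc (r / 2) ⊆ (extChartAt (𝓡 m) y).target :=
    (closedBall_subset_closedBall (by linarith)).trans hball
  -- the velocity bound applies as long as the curve has not left the ball
  have hstep : ∀ t ∈ Icc a b, (∀ t' ∈ uIcc s₀ t, γ t' ∈ O) →
      extChartAt (𝓡 m) y (γ t) ∈ closedBall xc (r / 2) := by
    intro t ht hO'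
    have hdist : dist (extChartAt (𝓡 m) y (γ t)) (extChartAt (𝓡 m) y (γ s₀)) ≤ r / 4 := by
      rcases eq_or_ne s₀ t with rfl | hne
      · rw [dist_self]
        positivity
      · have hlt : min s₀ t < max s₀ t := min_lt_max.2 hne
        obtain ⟨-, v, p, h⟩ := hγ.2 y _ _ (ha.trans (le_min hs₀.1 ht.1)) hlt
          ((max_le hs₀.2 ht.2).trans hb) fun t' ht' => (hO' t' ht').1
        have h1 := (convex_Icc (min s₀ t) (max s₀ t)).norm_image_sub_le_of_norm_hasDerivWithin_le
          (C := C * M) (fun t' ht' => (h t' ht').1) (fun t' ht' => ?_) left_mem_uIcc right_mem_uIcc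
        · rw [dist_eq_norm]
          have h2 : ‖t - s₀‖ ≤ b - a := by
            rw [Real.norm_eq_abs, abs_le]
            constructor <;> linarith [ht.1, ht.2, hs₀.1, hs₀.2]
          calc _ ≤ C * M * ‖t - s₀‖ := h1
            _ ≤ C * M * (b - a) := by gcongr
            _ ≤ r / 4 := by linarith
        · refine (Coeffs.norm_le_of_F_eq hD hC hC0 hε (ball_subset_closedBall (hO' t' ht').2)
            (h t' ht').2.2.2.2 (h t' ht').2.2.2.1).trans ?_
          gcongr
    rw [mem_closedBall] at hx ⊢
    linarith [dist_triangle (extChartAt (𝓡 m) y (γ t)) (extChartAt (𝓡 m) y (γ s₀)) xc]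
  have hall : ∀ t ∈ Icc a b, γ t ∈ O := by
    by_contra! hne
    set Z : Set ℝ := Icc a b ∩ γ ⁻¹' Oᶜ with hZ
    have hZc : IsCompact Z := isCompact_Icc.of_isClosed_subset
      (hγc.preimage_isClosed_of_isClosed isClosed_Icc hOo.isClosed_compl) inter_subset_left
    obtain ⟨t, ht, hmin⟩ := hZc.exists_isMinOn (f := fun t => |t - s₀|)
      (by obtain ⟨t, h1, h2⟩ := hne; exact ⟨t, h1, h2⟩) (by fun_prop)
    have hseg : ∀ w ∈ Icc (0 : ℝ) 1, s₀ + w * (t - s₀) ∈ Icc a b := fun w hw => by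
      constructor <;> nlinarith [hw.1, hw.2, ht.1.1, ht.1.2, hs₀.1, hs₀.2]
    have hK : MapsTo (fun w : ℝ => γ (s₀ + w * (t - s₀))) (Ico 0 1)
        ((extChartAt (𝓡 m) y).symm '' closedBall xc (r / 2)) := by
      intro w hw
      have hw' := hseg w (Ico_subset_Icc_self hw)
      have hO' : ∀ t' ∈ uIcc s₀ (s₀ + w * (t - s₀)), γ t' ∈ O := by
        intro t' ht'
        by_contra hnot
        have h1 : |t - s₀| ≤ |t' - s₀| := hmin ⟨uIcc_subset_Icc hs₀ hw' ht', hnot⟩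
        have h2 : |t' - s₀| ≤ w * |t - s₀| := by
          have := abs_sub_left_of_mem_uIcc ht'
          rwa [add_sub_cancel_left, abs_mul, abs_of_nonneg hw.1] at this
        have h3 : 0 < |t - s₀| := by
          rw [abs_pos, sub_ne_zero]
          rintro rfl
          refine ht.2 ⟨hsrc, ?_⟩
          rw [mem_preimage]
          exact closedBall_subset_ball (by linarith) hx
        nlinarith [hw.2]
      exact (mem_image_closedBall_iff hball').2 ⟨(hO' _ right_mem_uIcc).1, hstep _ hw' hO'⟩
    have hcont : ContinuousWithinAt (fun w : ℝ => γ (s₀ + w * (t - s₀))) (Ico 0 1) 1 := by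
      have h1 : ContinuousOn (fun w : ℝ => γ (s₀ + w * (t - s₀))) (Icc 0 1) :=
        hγc.comp (by fun_prop) hseg
      exact (h1 1 (right_mem_Icc.2 zero_le_one)).mono Ico_subset_Icc_self
    have h1 := hcont.mem_closure (by rw [closure_Ico zero_ne_one]; exact right_mem_Icc.2 zero_le_one)
      hK
    rw [(isClosed_image_closedBall hball').closure_eq, mem_image_closedBall_iff hball',
      one_mul, add_sub_cancel] at h1
    exact ht.2 ⟨h1.1, closedBall_subset_ball (by linarith) h1.2⟩
  exact ⟨(hall s hs).1, hstep s hs fun t' ht' => hall t' (uIcc_subset_Icc hs₀ hs ht')⟩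

lemma IsExtremal.eq_of_speed_zero
    (hD : (chartCoeffs g₀ θ Λ y).IsGood (extChartAt (𝓡 m) y).target)
    (h : IsExtremal g₀ θ Λ y γ 0 a b) {s t : ℝ} (hs : s ∈ Icc a b) (ht : t ∈ Icc a b) :
    γ s = γ t := by
  obtain ⟨hsrc, v, p, h⟩ := h
  have h1 := (convex_Icc a b).norm_image_sub_le_of_norm_hasDerivWithin_le (C := 0)
    (fun t' ht' => (h t' ht').1) (fun t' ht' => ?_) ht hs
  · rw [zero_mul, norm_le_zero_iff, sub_eq_zero] at h1
    exact (extChartAt (𝓡 m) y).injOn (hsrc s hs) (hsrc t ht) h1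
  · rw [norm_le_zero_iff]
    by_contra hv
    exact (Coeffs.F_pos hD (h t' ht').2.2.2.2 hv).ne' (h t' ht').2.2.2.1

lemma IsExtremalCurve.eq_of_speed_zero (hD : ∀ y : S,
    (chartCoeffs g₀ θ Λ y).IsGood (extChartAt (𝓡 m) y).target)
    (h : IsExtremalCurve g₀ θ Λ γ 0) {s : ℝ} (hs : s ∈ Icc (0 : ℝ) 1) : γ s = γ 0 := by
  refine eq_of_eventually_eq (fun s hs => ?_) hs
  obtain ⟨y, a, b, hab, -, -, hn, h⟩ := h s hs
  filter_upwards [hn] with t ht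
  exact h.eq_of_speed_zero (hD y) ht (mem_of_mem_nhdsWithin hs hn)

/-- A solution of positive speed is nowhere locally constant. -/
lemma IsExtremal.speed_eq_zero (h : IsExtremal g₀ θ Λ y γ c a b) (hab : a < b)
    (hs₀ : s₀ ∈ Icc a b) (hγ : ∀ᶠ t in 𝓝[Icc a b] s₀, γ t = γ s₀) : c = 0 := by
  obtain ⟨hsrc, v, p, h⟩ := h
  have h1 : HasDerivWithinAt (fun s => extChartAt (𝓡 m) y (γ s)) 0 (Icc a b) s₀ :=
    (hasDerivWithinAt_const s₀ _ (extChartAt (𝓡 m) y (γ s₀))).congr_of_eventuallyEq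
      (hγ.mono fun t ht => by simp only [ht]) rfl
  have h2 := (uniqueDiffOn_Icc hab s₀ hs₀).eq_deriv _ (h s₀ hs₀).1 h1
  rw [← (h s₀ hs₀).2.2.2.1, h2, Coeffs.F, speed_zero]

lemma isExtremalCurve_const {z : S} (hz : 0 < Λ z)
    (hγ : ∀ s ∈ Icc (0 : ℝ) 1, γ s = z) : IsExtremalCurve g₀ θ Λ γ 0 := by
  refine IsExtremalCurve.congr (γ := fun _ => z) (fun s hs => ⟨z, 0, 1, one_pos, le_rfl, le_rfl,
    self_mem_nhdsWithin, fun s _ => mem_extChartAt_source z, 0, 0, fun s _ => ?_⟩) hγ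
  refine ⟨hasDerivWithinAt_const _ _ _, ?_, ?_, ?_, mem_extChartAt_target z, Or.inl ?_⟩
  · rw [Pi.zero_apply, Coeffs.force_zero]
    exact hasDerivWithinAt_const _ _ _
  · exact Coeffs.momentum_zero.symm
  · rw [Pi.zero_apply, Coeffs.F, speed_zero]
  · rwa [chartCoeffs_l (mem_extChartAt_source z)]

end Confinement

/-! ### Limits of geodesics on the manifold -/

section LimitCurve

open Metric

/-- Short times around each point of `[0,1]`, as needed for confinement to a chart. -/
lemma exists_short_interval {s : ℝ} (hs : s ∈ Icc (0 : ℝ) 1) {K r : ℝ} (hr : 0 < r) (hK : 0 ≤ K) :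
    ∃ δ > 0, max 0 (s - δ) < min 1 (s + δ) ∧ s ∈ Icc (max 0 (s - δ)) (min 1 (s + δ)) ∧
      K * (min 1 (s + δ) - max 0 (s - δ)) ≤ r := by
  have hδ : 0 < r / (2 * (K + 1)) := by positivity
  refine ⟨r / (2 * (K + 1)), hδ, ?_, ⟨max_le hs.1 (by linarith), le_min hs.2 (by linarith)⟩, ?_⟩
  · rw [max_lt_iff, lt_min_iff, lt_min_iff]
    exact ⟨⟨one_pos, by linarith [hs.1]⟩, by linarith [hs.2], by linarith⟩
  · have h1 : min 1 (s + r / (2 * (K + 1))) - max 0 (s - r / (2 * (K + 1))) ≤ r / (K + 1) := by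
      have h2 := min_le_right 1 (s + r / (2 * (K + 1)))
      have h3 := le_max_right 0 (s - r / (2 * (K + 1)))
      have h4 : r / (K + 1) = 2 * (r / (2 * (K + 1))) := by field_simp
      linarith
    calc _ ≤ K * (r / (K + 1)) := by gcongr
      _ = K / (K + 1) * r := by ring
      _ ≤ 1 * r := by
        gcongr
        exact (div_le_one (by positivity)).2 (by linarith)
      _ = r := one_mul r

variable {m : ℕ} {S : Type*} [TopologicalSpace S]
  [ChartedSpace (EuclideanSpace ℝ (Fin m)) S] [IsManifold (𝓡 m) ∞ S]
  {g₀ : RMetric m S} {θ : OneForm m S} {Λ : S → ℝ} {u : Ultrafilter ℝ} {σ : ℝ → ℝ → S}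
  {c : ℝ → ℝ} {τ : ℝ → S} {c₀ a b s₀ C M r : ℝ}

lemma exists_closedBall_isBound
    (hD : ∀ y : S, (chartCoeffs g₀ θ Λ y).IsGood (extChartAt (𝓡 m) y).target) (y : S) {r₀ : ℝ} (hr₀ : 0 < r₀) : ∃ r > 0, r ≤ r₀ ∧ ∃ C > 0,
    closedBall (extChartAt (𝓡 m) y y) r ⊆ (extChartAt (𝓡 m) y).target ∧
    (chartCoeffs g₀ θ Λ y).IsBound (closedBall (extChartAt (𝓡 m) y y) r) C := by
  obtain ⟨ρ, hρ, hsub⟩ := nhds_basis_closedBall.mem_iff.1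
    ((isOpen_extChartAt_target (I := 𝓡 m) y).mem_nhds (mem_extChartAt_target y))
  have hsub' : closedBall (extChartAt (𝓡 m) y y) (min ρ r₀) ⊆ (extChartAt (𝓡 m) y).target :=
    (closedBall_subset_closedBall (min_le_left _ _)).trans hsub
  obtain ⟨C, hC, hC'⟩ := (hD y).exists_bound (isCompact_closedBall _ (min ρ r₀)) hsub'
  exact ⟨min ρ r₀, lt_min hρ hr₀, min_le_right _ _, C, hC, hsub', hC'⟩

/-- Along the ultrafilter `u`, as `ε → 0`, the solutions `σ ε` of the Euler-Lagrange equation of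
`F_ε` converge pointwise to `τ`, and their speeds `c ε` converge to `c₀`. -/
structure IsLimitCurve (g₀ : RMetric m S) (θ : OneForm m S) (Λ : S → ℝ) (u : Ultrafilter ℝ)
    (σ : ℝ → ℝ → S) (c : ℝ → ℝ) (τ : ℝ → S) (c₀ : ℝ) : Prop where
  le_nhdsWithin : (u : Filter ℝ) ≤ 𝓝[>] 0
  solves : ∀ᶠ ε in (u : Filter ℝ), SolvesEulerLagrange g₀ θ (fun z => Λ z + ε) (σ ε) (c ε)
  nonneg : ∀ᶠ ε in (u : Filter ℝ), 0 ≤ c ε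
  tendsto_speed : Tendsto c u (𝓝 c₀)
  tendsto : ∀ s ∈ Icc (0 : ℝ) 1, Tendsto (fun ε => σ ε s) u (𝓝 (τ s))

namespace IsLimitCurve

variable (h : IsLimitCurve g₀ θ Λ u σ c τ c₀)

include h

lemma eventually_mem_Icc : ∀ᶠ ε in (u : Filter ℝ), ε ∈ Icc (0 : ℝ) 1 :=
  h.le_nhdsWithin (mem_of_superset (Ioc_mem_nhdsGT one_pos) Ioc_subset_Icc_self)

lemma speed_nonneg : 0 ≤ c₀ := ge_of_tendsto h.tendsto_speed h.nonneg

lemma eventually_le (hM : c₀ < M) : ∀ᶠ ε in (u : Filter ℝ), c ε ≤ M :=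
  h.tendsto_speed.eventually_le_const hM

variable [T2Space S]
  (hD : ∀ y : S, (chartCoeffs g₀ θ Λ y).IsGood (extChartAt (𝓡 m) y).target)

include hD

/-- With bounded speeds, the curves stay for a short time in the chart at `τ s₀`. -/
lemma eventually_mem_chart (hM : c₀ < M) (hr : 0 < r)
    (hball : closedBall (extChartAt (𝓡 m) (τ s₀) (τ s₀)) r ⊆ (extChartAt (𝓡 m) (τ s₀)).target)
    (hC : (chartCoeffs g₀ θ Λ (τ s₀)).IsBound
      (closedBall (extChartAt (𝓡 m) (τ s₀) (τ s₀)) r) C) (hC0 : 0 ≤ C)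
    (ha : 0 ≤ a) (hb : b ≤ 1) (hs₀ : s₀ ∈ Icc a b) (hMC : M * C * (b - a) ≤ r / 4) :
    (∀ᶠ ε in (u : Filter ℝ), ∀ t ∈ Icc a b, σ ε t ∈ (extChartAt (𝓡 m) (τ s₀)).source ∧
      extChartAt (𝓡 m) (τ s₀) (σ ε t) ∈ closedBall (extChartAt (𝓡 m) (τ s₀) (τ s₀)) (r / 2)) ∧
    ∀ t ∈ Icc a b, τ t ∈ (extChartAt (𝓡 m) (τ s₀)).source ∧
      extChartAt (𝓡 m) (τ s₀) (τ t) ∈ closedBall (extChartAt (𝓡 m) (τ s₀) (τ s₀)) (r / 2) := by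
  have hs₀' : s₀ ∈ Icc (0 : ℝ) 1 := ⟨ha.trans hs₀.1, hs₀.2.trans hb⟩
  have hnear : (extChartAt (𝓡 m) (τ s₀)).source ∩ extChartAt (𝓡 m) (τ s₀) ⁻¹'
      closedBall (extChartAt (𝓡 m) (τ s₀) (τ s₀)) (r / 4) ∈ 𝓝 (τ s₀) :=
    inter_mem (extChartAt_source_mem_nhds (τ s₀))
      ((continuousAt_extChartAt (τ s₀)).preimage_mem_nhds (closedBall_mem_nhds _ (by positivity)))
  have h1 : ∀ᶠ ε in (u : Filter ℝ), ∀ t ∈ Icc a b, σ ε t ∈ (extChartAt (𝓡 m) (τ s₀)).source ∧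
      extChartAt (𝓡 m) (τ s₀) (σ ε t) ∈
        closedBall (extChartAt (𝓡 m) (τ s₀) (τ s₀)) (r / 2) := by
    filter_upwards [h.eventually_mem_Icc, h.solves, h.eventually_le hM, (h.tendsto s₀ hs₀') hnear]
      with ε h1 h2 h3 h4 t ht
    exact h2.mem_chart (hD (τ s₀)) h1 h3 hr hball hC hC0 ha hb hs₀
      (h.speed_nonneg.trans hM.le) hMC h4.1 h4.2 ht
  refine ⟨h1, fun t ht => ?_⟩
  have hball' : closedBall (extChartAt (𝓡 m) (τ s₀) (τ s₀)) (r / 2) ⊆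
      (extChartAt (𝓡 m) (τ s₀)).target :=
    (closedBall_subset_closedBall (by linarith)).trans hball
  rw [← mem_image_closedBall_iff hball']
  refine (isClosed_image_closedBall hball').mem_of_tendsto
    (h.tendsto t ⟨ha.trans ht.1, ht.2.trans hb⟩) ?_
  filter_upwards [h1] with ε h1 using (mem_image_closedBall_iff hball').2 (h1 t ht)

/-- The limit curve solves the Hamiltonian equation. -/
lemma exists_hamiltonian (hpos : ∀ᶠ ε in (u : Filter ℝ), 0 < c ε) (hM : c₀ < M) (hr : 0 < r)
    (hball : closedBall (extChartAt (𝓡 m) (τ s₀) (τ s₀)) r ⊆ (extChartAt (𝓡 m) (τ s₀)).target)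
    (hC : (chartCoeffs g₀ θ Λ (τ s₀)).IsBound
      (closedBall (extChartAt (𝓡 m) (τ s₀) (τ s₀)) r) C) (hC0 : 0 ≤ C)
    (ha : 0 ≤ a) (hab : a < b) (hb : b ≤ 1) (hs₀ : s₀ ∈ Icc a b)
    (hMC : M * C * (b - a) ≤ min r 1 / 4) :
    ∃ (y : ℝ → EuclideanSpace ℝ (Fin m)) (q : ℝ → EuclideanSpace ℝ (Fin m) →L[ℝ] ℝ) (k : ℝ),
      ∀ s ∈ Icc a b, τ s ∈ (extChartAt (𝓡 m) (τ s₀)).source ∧ q s ≠ 0 ∧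
      Tendsto (fun ε => (c ε)⁻¹ • (extChartAt (𝓡 m) (τ s₀) (σ ε s) -
        extChartAt (𝓡 m) (τ s₀) (σ ε s₀))) u (𝓝 (y s)) ∧
      HasDerivWithinAt (fun s => extChartAt (𝓡 m) (τ s₀) (τ s))
        (c₀ • (chartCoeffs g₀ θ Λ (τ s₀)).vel (extChartAt (𝓡 m) (τ s₀) (τ s)) (q s))
        (Icc a b) s ∧
      HasDerivWithinAt q
        (c₀ • (chartCoeffs g₀ θ Λ (τ s₀)).drift (extChartAt (𝓡 m) (τ s₀) (τ s)) (q s))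
        (Icc a b) s ∧
      HasDerivWithinAt y
        ((chartCoeffs g₀ θ Λ (τ s₀)).vel (extChartAt (𝓡 m) (τ s₀) (τ s)) (q s)) (Icc a b) s ∧
      (chartCoeffs g₀ θ Λ (τ s₀)).H (extChartAt (𝓡 m) (τ s₀) (τ s)) (q s) = k := by
  have hmr : min r 1 / 4 ≤ r / 4 := by linarith [min_le_left r 1]
  have hm1 : min r 1 / 4 ≤ 1 / 4 := by linarith [min_le_right r 1]
  obtain ⟨h1, h2⟩ := h.eventually_mem_chart hD hM hr hball hC hC0 ha hb hs₀ (hMC.trans hmr)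
  have hhalf : closedBall (extChartAt (𝓡 m) (τ s₀) (τ s₀)) (r / 2) ⊆
      closedBall (extChartAt (𝓡 m) (τ s₀) (τ s₀)) r := closedBall_subset_closedBall (by linarith)
  obtain ⟨X, y, q, k, h3⟩ := Coeffs.exists_limit (hD (τ s₀)) (isCompact_closedBall _ r) hball hC hC0
    (h.le_nhdsWithin.trans nhdsWithin_le_nhds) h.eventually_mem_Icc hs₀ (hMC.trans hm1)
    h.tendsto_speed (hpos.and (h.eventually_le hM))
    (x := fun ε s => extChartAt (𝓡 m) (τ s₀) (σ ε s)) (by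
      filter_upwards [h.solves, h1] with ε h3 h4
      obtain ⟨-, v, p, h5⟩ := h3.2 (τ s₀) a b ha hab hb fun s hs => (h4 s hs).1
      exact ⟨v, p, fun s hs => ⟨hhalf (h4 s hs).2, (h5 s hs).2.2.2.2, (h5 s hs).1, (h5 s hs).2.1,
        (h5 s hs).2.2.1, (h5 s hs).2.2.2.1⟩⟩)
  have hX : ∀ s ∈ Icc a b, X s = extChartAt (𝓡 m) (τ s₀) (τ s) := fun s hs =>
    tendsto_nhds_unique (h3 s hs).2.2.1
      ((continuousAt_extChartAt' (h2 s hs).1).tendsto.comp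
        (h.tendsto s ⟨ha.trans hs.1, hs.2.trans hb⟩))
  refine ⟨y, q, k, fun s hs => ?_⟩
  obtain ⟨h4, h5, h6, h7, h8, h9, h10, h11⟩ := h3 s hs
  rw [← hX s hs]
  exact ⟨(h2 s hs).1, h5, h7, h8.congr (fun t ht => (hX t ht).symm) (hX s hs).symm, h9, h10, h11⟩

end IsLimitCurve

end LimitCurve

/-! ### The limit is a geodesic -/

section LimitCurve

open Metric

variable {m : ℕ} {S : Type*} [TopologicalSpace S]
  [ChartedSpace (EuclideanSpace ℝ (Fin m)) S] {τ : ℝ → S} {a b : ℝ}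

lemma eq_of_hasDerivWithinAt_zero {y : S}
    (h : ∀ s ∈ Icc a b, τ s ∈ (extChartAt (𝓡 m) y).source ∧
      HasDerivWithinAt (fun s => extChartAt (𝓡 m) y (τ s)) 0 (Icc a b) s)
    {s t : ℝ} (hs : s ∈ Icc a b) (ht : t ∈ Icc a b) : τ s = τ t := by
  have h1 := (convex_Icc a b).norm_image_sub_le_of_norm_hasDerivWithin_le (C := 0)
    (fun t' ht' => (h t' ht').2) (fun t' _ => by simp) ht hs
  rw [zero_mul, norm_le_zero_iff, sub_eq_zero] at h1
  exact (extChartAt (𝓡 m) y).injOn (h s hs).1 (h t ht).1 h1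

variable [IsManifold (𝓡 m) ∞ S]
  {g₀ : RMetric m S} {θ : OneForm m S} {Λ : S → ℝ} {u : Ultrafilter ℝ} {σ : ℝ → ℝ → S}
  {c : ℝ → ℝ} {c₀ s₀ C M r : ℝ} {x₀ x₁ : S}

lemma Icc_mem_nhdsWithin_unit {s t δ : ℝ} (ht : t ∈ Ioo (s - δ) (s + δ)) :
    Icc (max 0 (s - δ)) (min 1 (s + δ)) ∈ 𝓝[Icc (0 : ℝ) 1] t := by
  filter_upwards [self_mem_nhdsWithin, mem_nhdsWithin_of_mem_nhds (Ioo_mem_nhds ht.1 ht.2)]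
    with t' h1 h2
  exact ⟨max_le h1.1 h2.1.le, le_min h1.2 h2.2.le⟩

/-- A solution of the Hamiltonian equation with positive Hamiltonian solves the Euler-Lagrange
equation. -/
lemma isExtremal_of_hamiltonian {y : S}
    (hD : (chartCoeffs g₀ θ Λ y).IsGood (extChartAt (𝓡 m) y).target) (hc₀ : 0 < c₀)
    {q : ℝ → EuclideanSpace ℝ (Fin m) →L[ℝ] ℝ} {k : ℝ} (hk : 0 < k)
    (h : ∀ s ∈ Icc a b, τ s ∈ (extChartAt (𝓡 m) y).source ∧ q s ≠ 0 ∧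
      HasDerivWithinAt (fun s => extChartAt (𝓡 m) y (τ s))
        (c₀ • (chartCoeffs g₀ θ Λ y).vel (extChartAt (𝓡 m) y (τ s)) (q s)) (Icc a b) s ∧
      HasDerivWithinAt q
        (c₀ • (chartCoeffs g₀ θ Λ y).drift (extChartAt (𝓡 m) y (τ s)) (q s)) (Icc a b) s ∧
      (chartCoeffs g₀ θ Λ y).H (extChartAt (𝓡 m) y (τ s)) (q s) = k) :
    IsExtremal g₀ θ Λ y τ c₀ a b := by
  refine ⟨fun s hs => (h s hs).1,
    fun s => c₀ • (chartCoeffs g₀ θ Λ y).vel (extChartAt (𝓡 m) y (τ s)) (q s),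
    fun s => (c₀ / k) • q s, fun s hs => ?_⟩
  obtain ⟨h1, h2, h3, h4, h5⟩ := h s hs
  have hx := (extChartAt (𝓡 m) y).map_source h1
  have hH : 0 < (chartCoeffs g₀ θ Λ y).H (extChartAt (𝓡 m) y (τ s)) (q s) := h5 ▸ hk
  refine ⟨h3, ?_, ?_, Coeffs.F_vel hD hx h2 hc₀ hH, Coeffs.vel_mem_dom hD hx h2 hc₀ hH⟩
  · rw [Coeffs.force_vel hD hx h2 hc₀ hH, h5]
    exact h4.const_smul (c₀ / k)
  · rw [Coeffs.momentum_vel hD hx h2 hc₀ hH, h5]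

lemma eqOn_of_hasDerivWithinAt_zero {V : Type*} [NormedAddCommGroup V] [NormedSpace ℝ V] {f : ℝ → V}
    (h : ∀ s ∈ Icc a b, HasDerivWithinAt f 0 (Icc a b) s)
    {s t : ℝ} (hs : s ∈ Icc a b) (ht : t ∈ Icc a b) : f s = f t := by
  have h1 := (convex_Icc a b).norm_image_sub_le_of_norm_hasDerivWithin_le (C := 0)
    h (fun t' _ => by simp) ht hs
  rwa [zero_mul, norm_le_zero_iff, sub_eq_zero] at h1

namespace IsLimitCurve

variable [T2Space S] (h : IsLimitCurve g₀ θ Λ u σ c τ c₀)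

include h

lemma eq_of_eventually_end {s : ℝ} (hs : s ∈ Icc (0 : ℝ) 1)
    (h0 : ∀ᶠ ε in (u : Filter ℝ), σ ε s = x₀) : τ s = x₀ :=
  tendsto_nhds_unique (h.tendsto s hs) (tendsto_const_nhds.congr' (h0.mono fun _ h => h.symm))

variable (hD : ∀ y : S, (chartCoeffs g₀ θ Λ y).IsGood (extChartAt (𝓡 m) y).target)

include hD

/-- Around each point of `[0,1]`, the limit of geodesics with positive limit speed either solves the
Euler-Lagrange equation or is constant at a zero of `Λ`. -/
lemma isExtremal_or_eq (hc₀ : 0 < c₀) {s : ℝ} (hs : s ∈ Icc (0 : ℝ) 1) :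
    ∃ δ > 0, max 0 (s - δ) < min 1 (s + δ) ∧
      (IsExtremal g₀ θ Λ (τ s) τ c₀ (max 0 (s - δ)) (min 1 (s + δ)) ∨
      ∀ t ∈ Icc (max 0 (s - δ)) (min 1 (s + δ)), τ t = τ s ∧ Λ (τ s) = 0) := by
  obtain ⟨r, hr, -, C, hC, hball, hCb⟩ := exists_closedBall_isBound hD (τ s) one_pos
  have hK : 0 ≤ (c₀ + 1) * C := by positivity
  obtain ⟨δ, hδ, hab, hsab, hMC⟩ := exists_short_interval hs
    (show 0 < min r 1 / 4 by positivity) hK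
  refine ⟨δ, hδ, hab, ?_⟩
  obtain ⟨y, q, k, h1⟩ := h.exists_hamiltonian hD (h.tendsto_speed.eventually_const_lt hc₀)
    (lt_add_one c₀) hr hball hCb hC.le (le_max_left _ _) hab (min_le_left _ _) hsab hMC
  have hx : ∀ t ∈ Icc (max 0 (s - δ)) (min 1 (s + δ)),
      extChartAt (𝓡 m) (τ s) (τ t) ∈ (extChartAt (𝓡 m) (τ s)).target := fun t ht =>
    (extChartAt (𝓡 m) (τ s)).map_source (h1 t ht).1
  have hk : 0 ≤ k := by
    rw [← (h1 s hsab).2.2.2.2.2.2]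
    exact ham_nonneg ((hD (τ s)).inner _ (hx s hsab)) ((hD (τ s)).l_nonneg _ (hx s hsab)) _
  rcases hk.eq_or_lt with rfl | hk
  · right
    have h2 : ∀ t ∈ Icc (max 0 (s - δ)) (min 1 (s + δ)),
        (chartCoeffs g₀ θ Λ (τ s)).vel (extChartAt (𝓡 m) (τ s) (τ t)) (q t) = 0 ∧
        (chartCoeffs g₀ θ Λ (τ s)).l (extChartAt (𝓡 m) (τ s) (τ t)) = 0 := fun t ht =>
      dir_eq_zero_of_ham_eq_zero ((hD (τ s)).inner _ (hx t ht)) ((hD (τ s)).l_nonneg _ (hx t ht))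
        (h1 t ht).2.1 (h1 t ht).2.2.2.2.2.2
    refine fun t ht => ⟨eq_of_hasDerivWithinAt_zero (y := τ s) (fun t ht => ⟨(h1 t ht).1, ?_⟩)
      ht hsab, ?_⟩
    · have h3 := (h1 t ht).2.2.2.1
      rwa [(h2 t ht).1, smul_zero] at h3
    · rw [← chartCoeffs_l (g₀ := g₀) (θ := θ) (Λ := Λ) (mem_extChartAt_source (I := 𝓡 m) (τ s))]
      exact (h2 s hsab).2
  · left
    exact isExtremal_of_hamiltonian (hD (τ s)) hc₀ hk fun t ht => ⟨(h1 t ht).1, (h1 t ht).2.1,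
      (h1 t ht).2.2.2.1, (h1 t ht).2.2.2.2.1, (h1 t ht).2.2.2.2.2.2⟩

/-- Geodesics whose lengths tend to zero converge to points; but loops cannot do so at a point with
`Λ > 0`, where the rescaled geodesics converge to a nontrivial segment. -/
lemma speed_pos (hpos : ∀ᶠ ε in (u : Filter ℝ), 0 < c ε)
    (h0 : ∀ᶠ ε in (u : Filter ℝ), σ ε 0 = x₀) (h1 : ∀ᶠ ε in (u : Filter ℝ), σ ε 1 = x₁)
    (hx : x₀ ≠ x₁ ∨ 0 < Λ x₀) : 0 < c₀ := by
  have hm0 : (0 : ℝ) ∈ Icc (0 : ℝ) 1 := left_mem_Icc.2 zero_le_one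
  have hm1 : (1 : ℝ) ∈ Icc (0 : ℝ) 1 := right_mem_Icc.2 zero_le_one
  have hτ0 : τ 0 = x₀ := h.eq_of_eventually_end hm0 h0
  have hτ1 : τ 1 = x₁ := h.eq_of_eventually_end hm1 h1
  refine lt_of_le_of_ne h.speed_nonneg fun hc => ?_
  subst hc
  have hconst : τ 1 = τ 0 := by
    refine eq_of_eventually_eq (fun s hs => ?_) (right_mem_Icc.2 zero_le_one)
    obtain ⟨r, hr, -, C, hC, hball, hCb⟩ := exists_closedBall_isBound hD (τ s) one_pos
    obtain ⟨δ, hδ, hab, hsab, hMC⟩ := exists_short_interval hs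
      (show 0 < min r 1 / 4 by positivity) (show 0 ≤ 1 * C by positivity)
    obtain ⟨y, q, k, h1⟩ := h.exists_hamiltonian hD hpos one_pos hr hball hCb hC.le
      (le_max_left _ _) hab (min_le_left _ _) hsab hMC
    filter_upwards [Icc_mem_nhdsWithin_unit (s := s) (t := s) (δ := δ)
      ⟨by linarith, by linarith⟩] with t ht
    refine eq_of_hasDerivWithinAt_zero (y := τ s) (fun t ht => ⟨(h1 t ht).1, ?_⟩) ht hsab
    simpa using (h1 t ht).2.2.2.1
  have hx01 : x₀ = x₁ := by rw [← hτ0, ← hτ1, hconst]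
  have hΛ : 0 < Λ x₀ := hx.resolve_left (not_not.2 hx01)
  subst hx01
  obtain ⟨r, hr, -, C, hC, hball, hCb⟩ := exists_closedBall_isBound hD (τ 0) one_pos
  obtain ⟨y, q, k, h2⟩ := h.exists_hamiltonian hD hpos
    (show (0 : ℝ) < min r 1 / 4 / C by positivity) hr hball hCb hC.le le_rfl one_pos le_rfl hm0
    (by rw [div_mul_cancel₀ _ hC.ne', sub_zero, mul_one])
  have hτ : ∀ s ∈ Icc (0 : ℝ) 1, τ s = τ 0 := fun s hs =>
    eq_of_hasDerivWithinAt_zero (y := τ 0) (fun t ht => ⟨(h2 t ht).1, by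
      simpa using (h2 t ht).2.2.2.1⟩) hs hm0
  have hq : ∀ s ∈ Icc (0 : ℝ) 1, q s = q 0 := fun s hs =>
    eqOn_of_hasDerivWithinAt_zero (fun t ht => by simpa using (h2 t ht).2.2.2.2.1) hs hm0
  have hy : ∀ s ∈ Icc (0 : ℝ) 1, (∀ᶠ ε in (u : Filter ℝ), σ ε s = x₀) → y s = 0 := by
    intro s hs hσ
    refine tendsto_nhds_unique (h2 s hs).2.2.1 (tendsto_const_nhds.congr' ?_)
    filter_upwards [hσ, h0] with ε h3 h4
    rw [h3, h4, sub_self, smul_zero]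
  -- the rescaled limit is affine, and it closes up
  set w := (chartCoeffs g₀ θ Λ (τ 0)).vel (extChartAt (𝓡 m) (τ 0) (τ 0)) (q 0) with hw
  have hyw : ∀ s ∈ Icc (0 : ℝ) 1, HasDerivWithinAt (fun s => y s - s • w) 0 (Icc 0 1) s := by
    intro s hs
    have h3 := (h2 s hs).2.2.2.2.2.1
    rw [hτ s hs, hq s hs, ← hw] at h3
    have h4 := h3.sub ((hasDerivWithinAt_id s (Icc 0 1)).smul_const w)
    rw [one_smul, sub_self] at h4
    exact h4
  have h3 := eqOn_of_hasDerivWithinAt_zero hyw hm1 hm0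
  rw [hy 1 hm1 h1, hy 0 hm0 h0, one_smul, zero_smul, sub_zero, zero_sub, neg_eq_zero] at h3
  have hx := (extChartAt (𝓡 m) (τ 0)).map_source (h2 0 hm0).1
  refine dir_ne_zero ((hD (τ 0)).inner _ hx) ?_ (h2 0 hm0).2.1 h3
  rwa [chartCoeffs_l (mem_extChartAt_source (I := 𝓡 m) (τ 0)), hτ0]

/-- The limit of geodesics of positive speed between two different points, or of loops at a point
where `Λ` is positive, solves the Euler-Lagrange equation of the limit metric. -/
lemma isExtremalCurve_of_speed_pos (hpos : ∀ᶠ ε in (u : Filter ℝ), 0 < c ε)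
    (h0 : ∀ᶠ ε in (u : Filter ℝ), σ ε 0 = x₀) (h1 : ∀ᶠ ε in (u : Filter ℝ), σ ε 1 = x₁)
    (hx : x₀ ≠ x₁ ∨ 0 < Λ x₀) : IsExtremalCurve g₀ θ Λ τ c₀ := by
  have hc₀ := h.speed_pos hD hpos h0 h1 hx
  have hm0 : (0 : ℝ) ∈ Icc (0 : ℝ) 1 := left_mem_Icc.2 zero_le_one
  have hm1 : (1 : ℝ) ∈ Icc (0 : ℝ) 1 := right_mem_Icc.2 zero_le_one
  have hτ0 : τ 0 = x₀ := h.eq_of_eventually_end hm0 h0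
  have hτ1 : τ 1 = x₁ := h.eq_of_eventually_end hm1 h1
  -- two mutually exclusive, locally constant alternatives
  set P : ℝ → Prop := fun s => ∃ (y : S) (a b : ℝ), a < b ∧ 0 ≤ a ∧ b ≤ 1 ∧
    Icc a b ∈ 𝓝[Icc 0 1] s ∧ IsExtremal g₀ θ Λ y τ c₀ a b with hP
  set Q : ℝ → Prop := fun s => (∀ᶠ t in 𝓝[Icc 0 1] s, τ t = τ s) ∧ Λ (τ s) = 0 with hQ
  have hPQ : ∀ s ∈ Icc (0 : ℝ) 1, P s → Q s → False := by
    rintro s hs ⟨y, a, b, hab, ha, hb, hn, hext⟩ ⟨h2, -⟩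
    exact hc₀.ne' (hext.speed_eq_zero hab (mem_of_mem_nhdsWithin hs hn)
      (h2.filter_mono (nhdsWithin_mono _ (Icc_subset_Icc ha hb))))
  have hor : (∀ s ∈ Icc (0 : ℝ) 1, P s) ∨ ∀ s ∈ Icc (0 : ℝ) 1, Q s := by
    refine interval_induction zero_le_one (fun u w => (∀ s ∈ Icc u w, P s) ∨ ∀ s ∈ Icc u w, Q s)
      (fun u x w hu hux hxw hw h2 h3 => ?_) fun s hs => ?_
    · have hx' : x ∈ Icc (0 : ℝ) 1 := ⟨hu.trans hux, hxw.trans hw⟩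
      rcases h2 with h2 | h2 <;> rcases h3 with h3 | h3
      · exact Or.inl fun s hs => (le_total s x).elim (fun h => h2 s ⟨hs.1, h⟩)
          fun h => h3 s ⟨h, hs.2⟩
      · exact (hPQ x hx' (h2 x (right_mem_Icc.2 hux)) (h3 x (left_mem_Icc.2 hxw))).elim
      · exact (hPQ x hx' (h3 x (left_mem_Icc.2 hxw)) (h2 x (right_mem_Icc.2 hux))).elim
      · exact Or.inr fun s hs => (le_total s x).elim (fun h => h2 s ⟨hs.1, h⟩)
          fun h => h3 s ⟨h, hs.2⟩
    · obtain ⟨δ, hδ, hab, h2⟩ := h.isExtremal_or_eq hD hc₀ hs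
      have h3 : (∀ t ∈ Icc (0 : ℝ) 1, t ∈ Ioo (s - δ) (s + δ) → P t) ∨
          ∀ t ∈ Icc (0 : ℝ) 1, t ∈ Ioo (s - δ) (s + δ) → Q t := by
        rcases h2 with h2 | h2
        · exact Or.inl fun t _ ht => ⟨τ s, _, _, hab, le_max_left _ _, min_le_left _ _,
            Icc_mem_nhdsWithin_unit ht, h2⟩
        · refine Or.inr fun t ht ht' => ?_
          have h3 := h2 t (mem_of_mem_nhdsWithin ht (Icc_mem_nhdsWithin_unit ht'))
          refine ⟨?_, by rw [h3.1, h3.2]⟩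
          filter_upwards [Icc_mem_nhdsWithin_unit ht'] with t' h4
          rw [(h2 t' h4).1, h3.1]
      refine ⟨δ, hδ, fun x hx => ⟨fun h4 h5 => ?_, fun h4 h5 => ?_⟩⟩
      · exact h3.imp
          (fun h3 t ht => h3 t ⟨hx.1.trans ht.1, ht.2.trans hs.2⟩
            ⟨h4.trans_le ht.1, by linarith [ht.2]⟩)
          (fun h3 t ht => h3 t ⟨hx.1.trans ht.1, ht.2.trans hs.2⟩
            ⟨h4.trans_le ht.1, by linarith [ht.2]⟩)
      · exact h3.imp
          (fun h3 t ht => h3 t ⟨hs.1.trans ht.1, ht.2.trans hx.2⟩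
            ⟨by linarith [ht.1], ht.2.trans_lt h5⟩)
          (fun h3 t ht => h3 t ⟨hs.1.trans ht.1, ht.2.trans hx.2⟩
            ⟨by linarith [ht.1], ht.2.trans_lt h5⟩)
  refine hor.resolve_right fun hall => ?_
  have h2 := (hall 0 hm0).2
  rw [hτ0] at h2
  refine hx.elim (fun hne => hne ?_) fun h3 => h3.ne' h2
  rw [← hτ0, ← hτ1]
  exact (eq_of_eventually_eq (fun s hs => (hall s hs).1) hm1).symm

/-- The limit of geodesics of the metrics `F_ε` solves the Euler-Lagrange equation of the limit
metric; if they are not constant, nor is the limit. -/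
lemma isExtremalCurve
    (h0 : ∀ᶠ ε in (u : Filter ℝ), σ ε 0 = x₀) (h1 : ∀ᶠ ε in (u : Filter ℝ), σ ε 1 = x₁)
    (hx : x₀ ≠ x₁ ∨ 0 < Λ x₀) : IsExtremalCurve g₀ θ Λ τ c₀ ∧
      ((∀ᶠ ε in (u : Filter ℝ), ∃ s ∈ Icc (0 : ℝ) 1, σ ε s ≠ x₀) →
        ∃ s ∈ Icc (0 : ℝ) 1, τ s ≠ x₀) := by
  have hm0 : (0 : ℝ) ∈ Icc (0 : ℝ) 1 := left_mem_Icc.2 zero_le_one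
  have hm1 : (1 : ℝ) ∈ Icc (0 : ℝ) 1 := right_mem_Icc.2 zero_le_one
  rcases Ultrafilter.em u (fun ε => 0 < c ε) with hpos | hnpos
  · have h2 := h.isExtremalCurve_of_speed_pos hD hpos h0 h1 hx
    refine ⟨h2, fun _ => ?_⟩
    by_contra! hall
    obtain ⟨y, a, b, hab, ha, hb, hn, hext⟩ := h2 0 hm0
    refine (h.speed_pos hD hpos h0 h1 hx).ne' (hext.speed_eq_zero hab
      (mem_of_mem_nhdsWithin hm0 hn) ?_)
    filter_upwards [self_mem_nhdsWithin] with t ht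
    rw [hall t (Icc_subset_Icc ha hb ht), hall 0 hm0]
  · -- geodesics of speed zero are constant
    have hc : ∀ᶠ ε in (u : Filter ℝ), c ε = 0 := by
      filter_upwards [hnpos, h.nonneg] with ε h2 h3 using le_antisymm (not_lt.1 h2) h3
    have hσ : ∀ᶠ ε in (u : Filter ℝ), ∀ s ∈ Icc (0 : ℝ) 1, σ ε s = x₀ := by
      filter_upwards [hc, h.solves, h0, h.eventually_mem_Icc] with ε h2 h3 h4 h5 s hs
      rw [h2] at h3
      rw [← h4]
      exact IsExtremalCurve.eq_of_speed_zero (g₀ := g₀) (θ := θ) (Λ := fun z => Λ z + ε)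
        (fun y => (hD y).add h5.1) (isExtremalCurve_of_forall h3.1 h3.2) hs
    have hc₀ : c₀ = 0 := tendsto_nhds_unique h.tendsto_speed
      (tendsto_const_nhds.congr' (hc.mono fun _ h => h.symm))
    have hτ : ∀ s ∈ Icc (0 : ℝ) 1, τ s = x₀ := fun s hs =>
      h.eq_of_eventually_end hs (hσ.mono fun ε h => h s hs)
    have hΛ : 0 < Λ x₀ := hx.resolve_left fun hne => by
      obtain ⟨ε, h2, h3⟩ := (hσ.and h1).exists
      exact hne (by rw [← h2 1 hm1, h3])
    refine ⟨hc₀ ▸ isExtremalCurve_const hΛ hτ, fun hne => ?_⟩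
    obtain ⟨ε, h2, s, hs, h3⟩ := (hσ.and hne).exists
    exact (h3 (h2 s hs)).elim

end IsLimitCurve

end LimitCurve

/-! ### Uniform convergence and compactness -/

section Uniform

open Metric

variable {m : ℕ} {S : Type*} [TopologicalSpace S]
  [ChartedSpace (EuclideanSpace ℝ (Fin m)) S] [IsManifold (𝓡 m) ∞ S]
  {g₀ : RMetric m S} {θ : OneForm m S} {Λ : S → ℝ} {u : Ultrafilter ℝ} {σ : ℝ → ℝ → S}
  {c : ℝ → ℝ} {τ : ℝ → S} {c₀ r : ℝ} {x₀ x₁ y : S}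

/-- In a ball of a chart, the Riemannian distance is bounded by the Euclidean one. -/
lemma exists_pathDist_le (hD : (chartCoeffs g₀ θ Λ y).IsGood (extChartAt (𝓡 m) y).target)
    {xc : EuclideanSpace ℝ (Fin m)} (hball : closedBall xc r ⊆ (extChartAt (𝓡 m) y).target) :
    ∃ K > 0, ∀ x ∈ closedBall xc r, ∀ x' ∈ closedBall xc r,
      pathDist (riemannianNorm g₀) ((extChartAt (𝓡 m) y).symm x)
        ((extChartAt (𝓡 m) y).symm x') ≤ K * ‖x' - x‖ := by
  obtain ⟨K, hK⟩ := (isCompact_closedBall xc r).exists_bound_of_continuousOn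
    (hD.g_smooth.continuousOn.mono hball)
  refine ⟨√|K| + 1, by positivity, fun x hx x' hx' => ?_⟩
  set l : ℝ → EuclideanSpace ℝ (Fin m) := fun w => x + w • (x' - x) with hl
  have hlm : ∀ w ∈ Icc (0 : ℝ) 1, l w ∈ closedBall xc r := fun w hw =>
    (convex_closedBall xc r).add_smul_sub_mem hx hx' hw
  have hlsmooth : ContDiff ℝ ∞ l := by fun_prop
  have hγ : ContMDiffOn 𝓘(ℝ, ℝ) (𝓡 m) ∞ (fun w => (extChartAt (𝓡 m) y).symm (l w)) (Icc 0 1) :=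
    (contMDiffOn_extChartAt_symm y).comp hlsmooth.contMDiff.contMDiffOn
      fun w hw => hball (hlm w hw)
  have h := pathDist_le_of_speed_le (F := riemannianNorm g₀) (fun v => Real.sqrt_nonneg _) hγ
    (C := (√|K| + 1) * ‖x' - x‖) fun w hw => ?_
  · simpa [hl] using h
  · have hw' := Ioo_subset_Icc_self hw
    have hsrc := (extChartAt (𝓡 m) y).map_target (hball (hlm w hw'))
    have hcoord : coord y (velocity m (fun w => (extChartAt (𝓡 m) y).symm (l w)) w) = x' - x := by
      rw [coord_velocity ((hγ.contMDiffAt (Icc_mem_nhds hw.1 hw.2)).mdifferentiableAt (by simp))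
        hsrc]
      have h1 : (fun w => extChartAt (𝓡 m) y ((extChartAt (𝓡 m) y).symm (l w))) =ᶠ[𝓝 w] l := by
        filter_upwards [Icc_mem_nhds hw.1 hw.2] with w hw
        exact (extChartAt (𝓡 m) y).right_inv (hball (hlm w hw))
      rw [h1.deriv_eq]
      have h2 : HasDerivAt l ((1 : ℝ) • (x' - x)) w :=
        ((hasDerivAt_id w).smul_const (x' - x)).const_add x
      rw [h2.deriv, one_smul]
    set V := velocity m (fun w => (extChartAt (𝓡 m) y).symm (l w)) w with hV
    have h1 := chartCoeffs_g (g₀ := g₀) (θ := θ) (Λ := Λ) (v := V) hsrc (x' - x)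
    have hf : frame m y V.1 (coord y V) = V.2 := frame_coord hsrc V.2
    rw [hcoord] at h1 hf
    rw [hf] at h1
    have h2 : g₀.inner V.1 V.2 V.2 = (chartCoeffs g₀ θ Λ y).g (l w) (x' - x) (x' - x) :=
      h1.symm.trans (congrArg (fun z => (chartCoeffs g₀ θ Λ y).g z (x' - x) (x' - x))
        ((extChartAt (𝓡 m) y).right_inv (hball (hlm w hw'))))
    have h3 : (chartCoeffs g₀ θ Λ y).g (l w) (x' - x) (x' - x) ≤ |K| * ‖x' - x‖ ^ 2 := by
      have h4 := (le_abs_self _).trans (((chartCoeffs g₀ θ Λ y).g (l w)).le_opNorm₂ (x' - x)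
        (x' - x))
      have h5 : ‖(chartCoeffs g₀ θ Λ y).g (l w)‖ ≤ |K| := (hK _ (hlm w hw')).trans (le_abs_self K)
      calc _ ≤ _ := h4
        _ ≤ |K| * ‖x' - x‖ * ‖x' - x‖ := by gcongr
        _ = _ := by ring
    rw [riemannianNorm]
    refine (Real.sqrt_le_sqrt (h2.le.trans h3)).trans ?_
    rw [Real.sqrt_mul (abs_nonneg K), Real.sqrt_sq (norm_nonneg _)]
    nlinarith [norm_nonneg (x' - x)]

/-- The convergence to the limit curve is uniform. -/
lemma IsLimitCurve.eventually_pathDist_lt [T2Space S] (h : IsLimitCurve g₀ θ Λ u σ c τ c₀)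
    (hD : ∀ y : S, (chartCoeffs g₀ θ Λ y).IsGood (extChartAt (𝓡 m) y).target) {η : ℝ}
    (hη : 0 < η) : ∀ᶠ ε in (u : Filter ℝ), ∀ s ∈ Icc (0 : ℝ) 1,
      pathDist (riemannianNorm g₀) (σ ε s) (τ s) < η := by
  refine interval_induction zero_le_one (fun a b => ∀ᶠ ε in (u : Filter ℝ), ∀ s ∈ Icc a b,
      pathDist (riemannianNorm g₀) (σ ε s) (τ s) < η) (fun a x b _ _ _ _ h1 h2 => ?_)
    fun s hs => ?_
  · filter_upwards [h1, h2] with ε h1 h2 s hs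
    exact (le_total s x).elim (fun h => h1 s ⟨hs.1, h⟩) fun h => h2 s ⟨h, hs.2⟩
  · obtain ⟨r₁, hr₁, -, C₁, -, hball₁, -⟩ := exists_closedBall_isBound hD (τ s) one_pos
    obtain ⟨K, hK, hKd⟩ := exists_pathDist_le (g₀ := g₀) (θ := θ) (Λ := Λ) (hD (τ s)) hball₁
    obtain ⟨r, hr, hrr, C, hC, hball, hCb⟩ := exists_closedBall_isBound hD (τ s)
      (show 0 < min r₁ (η / (2 * K)) by positivity)
    obtain ⟨δ, hδ, hab, hsab, hMC⟩ := exists_short_interval hs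
      (show 0 < r / 4 by positivity) (show 0 ≤ (c₀ + 1) * C from
        mul_nonneg (add_nonneg h.speed_nonneg zero_le_one) hC.le)
    obtain ⟨h1, h2⟩ := h.eventually_mem_chart hD (lt_add_one c₀) hr hball hCb hC.le
      (le_max_left _ _) (min_le_left _ _) hsab hMC
    have h3 : ∀ᶠ ε in (u : Filter ℝ), ∀ t ∈ Icc (max 0 (s - δ)) (min 1 (s + δ)),
        pathDist (riemannianNorm g₀) (σ ε t) (τ t) < η := by
      filter_upwards [h1] with ε h1 t ht
      have hsub : closedBall (extChartAt (𝓡 m) (τ s) (τ s)) (r / 2) ⊆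
          closedBall (extChartAt (𝓡 m) (τ s) (τ s)) r₁ :=
        closedBall_subset_closedBall (by linarith [hrr.trans (min_le_left _ _)])
      have h4 := hKd _ (hsub (h1 t ht).2) _ (hsub (h2 t ht).2)
      rw [(extChartAt (𝓡 m) (τ s)).left_inv (h1 t ht).1,
        (extChartAt (𝓡 m) (τ s)).left_inv (h2 t ht).1] at h4
      refine h4.trans_lt ?_
      have h5 : ‖extChartAt (𝓡 m) (τ s) (τ t) - extChartAt (𝓡 m) (τ s) (σ ε t)‖ ≤
          η / (2 * K) := by
        rw [← dist_eq_norm]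
        have h6 := dist_triangle_right (extChartAt (𝓡 m) (τ s) (τ t))
          (extChartAt (𝓡 m) (τ s) (σ ε t)) (extChartAt (𝓡 m) (τ s) (τ s))
        have h7 := mem_closedBall.1 (h1 t ht).2
        have h8 := mem_closedBall.1 (h2 t ht).2
        linarith [hrr.trans (min_le_right _ _)]
      calc _ ≤ K * (η / (2 * K)) := by gcongr
        _ = η / 2 := by field_simp
        _ < η := half_lt_self hη
    refine ⟨δ, hδ, fun x hx => ⟨fun h4 h5 => ?_, fun h4 h5 => ?_⟩⟩
    · filter_upwards [h3] with ε h3 t ht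
      exact h3 t ⟨max_le (hx.1.trans ht.1) (h4.le.trans ht.1),
        le_min (ht.2.trans hs.2) (by linarith [ht.2])⟩
    · filter_upwards [h3] with ε h3 t ht
      exact h3 t ⟨max_le (hs.1.trans ht.1) (by linarith [ht.1]),
        le_min (ht.2.trans hx.2) (ht.2.trans h5.le)⟩

variable (hθ : θ.IsSmooth) (hθ_ne : ∀ x, θ x ≠ 0)
    (hΛ : ContMDiff (𝓡 m) 𝓘(ℝ, ℝ) ∞ Λ) (hΛ_nonneg : ∀ x, 0 ≤ Λ x)

include hθ hθ_ne hΛ hΛ_nonneg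

/-- Geodesics of `F_ε` have constant speed and solve the Euler-Lagrange equation. -/
lemma exists_solvesEulerLagrange {ε : ℝ} (hε : 0 < ε) {γ : ℝ → S}
    (hγ : IsFinslerGeodesic univ (randers g₀ θ Λ ε) x₀ x₁ γ) :
    ∃ c, 0 ≤ c ∧ SolvesEulerLagrange g₀ θ (fun z => Λ z + ε) γ c ∧
      finslerLength (randers g₀ θ Λ ε) γ = c ∧ energy (randers g₀ θ Λ ε) γ = 1 / 2 * c ^ 2 := by
  have hpos : ∀ x, 0 < Λ x + ε := fun x => add_pos_of_nonneg_of_pos (hΛ_nonneg x) hε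
  have hsmooth : ContMDiff (𝓡 m) 𝓘(ℝ, ℝ) ∞ fun z => Λ z + ε := hΛ.add contMDiff_const
  have hcont : ContinuousOn γ (Icc 0 1) := hγ.1.1.1
  rw [randers_eq hΛ_nonneg hε] at hγ ⊢
  obtain ⟨c, hc, h⟩ := exists_speed hθ hθ_ne hsmooth hpos hγ
  have hext := isExtremalCurve_of_forall hcont h
  exact ⟨c, hc, ⟨hcont, h⟩, hext.finslerLength_eq hθ hθ_ne hsmooth fun x => (hpos x).le,
    hext.energy_eq hθ hθ_ne hsmooth fun x => (hpos x).le⟩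

/-- The condition on the balls confines the geodesics of bounded energy to a compact set. -/
lemma exists_isCompact {εb : ℝ} (hεb : 0 < εb)
    (hstar : ∀ (x y : S) (r s : ℝ), 0 < r → 0 < s →
      IsCompact (closure (forwardBall (randers g₀ θ Λ εb) x r) ∩
        closure (backwardBall (randers g₀ θ Λ εb) y s))) (x₀ x₁ : S) (M : ℝ) (hM : 0 ≤ M) :
    ∃ K : Set S, IsCompact K ∧ ∀ ε ∈ Ioc 0 εb, ∀ (γ : ℝ → S) (c : ℝ), 0 ≤ c → c ≤ M →
      SolvesEulerLagrange g₀ θ (fun z => Λ z + ε) γ c → γ 0 = x₀ → γ 1 = x₁ →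
      ∀ s ∈ Icc (0 : ℝ) 1, γ s ∈ K := by
  have hpos : ∀ {ε : ℝ}, 0 < ε → ∀ x, 0 < Λ x + ε := fun hε x =>
    add_pos_of_nonneg_of_pos (hΛ_nonneg x) hε
  have hsmooth : ∀ ε : ℝ, ContMDiff (𝓡 m) 𝓘(ℝ, ℝ) ∞ fun z => Λ z + ε := fun ε =>
    hΛ.add contMDiff_const
  refine ⟨insert x₀ (insert x₁ (closure (forwardBall (randers g₀ θ Λ εb) x₀ (M + 1)) ∩
    closure (backwardBall (randers g₀ θ Λ εb) x₁ (M + 1)))),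
    ((hstar x₀ x₁ _ _ (by positivity) (by positivity)).insert x₁).insert x₀,
    fun ε hε γ c hc hcM hγ h0 h1 s hs => ?_⟩
  have hΛε : ∀ x, 0 ≤ Λ x + ε := fun x => (hpos hε.1 x).le
  have hext := isExtremalCurve_of_forall hγ.1 hγ.2
  have hle := fun v => randersKropina_anti (g₀ := g₀) (θ := θ) (Λ := fun z => Λ z + ε)
    (Λ' := fun z => Λ z + εb) (hpos hε.1) (fun x => by linarith [hε.2]) v
  have hnn : ∀ v, 0 ≤ randersKropina g₀ θ (fun z => Λ z + εb) v :=
    randersKropina_nonneg fun x => (hpos hεb x).le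
  have hdist : ∀ α β : ℝ, 0 ≤ α → 0 < β → α + β ≤ 1 →
      pathDist (randers g₀ θ Λ εb) (γ α) (γ (α + β)) < M + 1 := fun α β hα hβ hαβ => by
    rw [randers_eq hΛ_nonneg hεb]
    exact (pathDist_affine_le hnn hle (hext.contMDiffOn hθ hθ_ne (hsmooth ε) hΛε) hc
      (fun s hs => hext.speed_eq hθ hθ_ne (hsmooth ε) hΛε hs) hα hβ hαβ).trans_lt (by linarith)
  rcases hs.1.eq_or_lt with rfl | hs0
  · exact Or.inl h0
  rcases hs.2.eq_or_lt with rfl | hs1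
  · exact Or.inr (Or.inl h1)
  refine Or.inr (Or.inr ⟨subset_closure ?_, subset_closure ?_⟩)
  · have h2 := hdist 0 s le_rfl hs0 (by linarith)
    rwa [zero_add, h0] at h2
  · have h2 := hdist s (1 - s) hs.1 (by linarith) (by linarith)
    rwa [add_sub_cancel, h1] at h2

omit [IsManifold (𝓡 m) ∞ S] hθ hθ_ne in
/-- At its zeros, a nonnegative function is critical. -/
lemma mfderiv_eq_zero_of_eq_zero {x : S} (hx : Λ x = 0) : mfderiv (𝓡 m) 𝓘(ℝ, ℝ) Λ x = 0 := by
  have h1 := hΛ.mdifferentiableAt (by simp) (x := x)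
  rw [h1.mfderiv, ModelWithCorners.range_eq_univ, fderivWithin_univ]
  refine IsLocalMin.fderiv_eq_zero (Eventually.of_forall fun z => ?_)
  change Λ ((extChartAt (𝓡 m) x).symm (extChartAt (𝓡 m) x x)) ≤ Λ ((extChartAt (𝓡 m) x).symm z)
  rw [extChartAt_to_inv, hx]
  exact hΛ_nonneg _

end Uniform

end RandersKropina

end

theorem mainTheorem3 {m : ℕ} (hm : 2 ≤ m) {S : Type*} [TopologicalSpace S] [T2Space S]
    [SecondCountableTopology S] [ConnectedSpace S]
    [ChartedSpace (EuclideanSpace ℝ (Fin m)) S] [IsManifold (𝓡 m) ∞ S]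
    (g₀ : RMetric m S) (θ : OneForm m S) (hθ : θ.IsSmooth)
    (Λ : S → ℝ) (hΛ : ContMDiff (𝓡 m) 𝓘(ℝ, ℝ) ∞ Λ)
    (hΛ_nonneg : ∀ x, 0 ≤ Λ x) (hθ_ne : ∀ x, θ x ≠ 0)
    (hstar : CompactBallsCondition g₀ θ Λ)
    (x₀ x₁ : S) (σ : ℝ → ℝ → S)
    (hσ : ∀ ε ∈ Ioc (0 : ℝ) 1, IsFinslerGeodesic univ (randers g₀ θ Λ ε) x₀ x₁ (σ ε))
    (hE : ∃ E : ℝ, ∀ ε ∈ Ioc (0 : ℝ) 1, energy (randers g₀ θ Λ ε) (σ ε) ≤ E)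
    (hx : x₀ ≠ x₁ ∨
      (x₁ = x₀ ∧ Λ x₀ ≠ 0) ∨
      (x₁ = x₀ ∧ Λ x₀ = 0 ∧
        ∃ v : TangentSpace (𝓡 m) x₀, θ x₀ v = 0 ∧ mfderiv (𝓡 m) 𝓘(ℝ, ℝ) Λ x₀ v ≠ (0 : ℝ))) :
    ∃ (e : ℕ → ℝ) (τ : ℝ → S),
      (∀ n, e n ∈ Ioc (0 : ℝ) 1) ∧ Tendsto e atTop (𝓝 0) ∧
      IsFinslerGeodesic (randersKropinaDomain θ Λ) (randersKropina g₀ θ Λ) x₀ x₁ τ ∧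
      (∀ η > 0, ∀ᶠ n in atTop, ∀ s ∈ Icc (0 : ℝ) 1,
        pathDist (riemannianNorm g₀) (σ (e n) s) (τ s) < η) ∧
      Tendsto (fun n => finslerLength (randers g₀ θ Λ (e n)) (σ (e n))) atTop
        (𝓝 (finslerLength (randersKropina g₀ θ Λ) τ)) ∧
      ((∀ ε ∈ Ioc (0 : ℝ) 1, ∃ s ∈ Icc (0 : ℝ) 1, σ ε s ≠ x₀) →
        ∃ s ∈ Icc (0 : ℝ) 1, τ s ≠ x₀) := by
  have hD : ∀ y : S, (RandersKropina.chartCoeffs g₀ θ Λ y).IsGood (extChartAt (𝓡 m) y).target :=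
    RandersKropina.isGood_chartCoeffs hθ hθ_ne hΛ hΛ_nonneg
  -- the third alternative is void, as `Λ` is critical at its zeros
  have hx' : x₀ ≠ x₁ ∨ 0 < Λ x₀ := by
    rcases hx with h | ⟨-, h⟩ | ⟨-, h0, v, -, hv⟩
    · exact Or.inl h
    · exact Or.inr (lt_of_le_of_ne (hΛ_nonneg x₀) h.symm)
    · rw [RandersKropina.mfderiv_eq_zero_of_eq_zero hΛ hΛ_nonneg h0] at hv
      exact (hv rfl).elim
  obtain ⟨E, hE⟩ := hE
  obtain ⟨εb, hεb, hstar⟩ := hstar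
  have hspeed : ∀ ε ∈ Ioc (0 : ℝ) 1, ∃ c, 0 ≤ c ∧ c ≤ |E| + 1 ∧
      RandersKropina.SolvesEulerLagrange g₀ θ (fun z => Λ z + ε) (σ ε) c ∧
      finslerLength (randers g₀ θ Λ ε) (σ ε) = c := fun ε hε => by
    obtain ⟨c, hc, h1, h2, h3⟩ :=
      RandersKropina.exists_solvesEulerLagrange hθ hθ_ne hΛ hΛ_nonneg hε.1 (hσ ε hε)
    have h4 := hE ε hε
    rw [h3] at h4
    exact ⟨c, hc, by nlinarith [le_abs_self E, sq_nonneg (c - 1)], h1, h2⟩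
  choose! c hc hcM hsolve hlen using hspeed
  obtain ⟨K, hK, hσK⟩ := RandersKropina.exists_isCompact hθ hθ_ne hΛ hΛ_nonneg hεb.1 hstar x₀ x₁
    (|E| + 1) (by positivity)
  set u : Ultrafilter ℝ := Ultrafilter.of (𝓝[>] 0) with hu
  have hu0 : (u : Filter ℝ) ≤ 𝓝[>] 0 := Ultrafilter.of_le _
  have hu1 : ∀ᶠ ε in (u : Filter ℝ), ε ∈ Ioc (0 : ℝ) 1 := hu0 (Ioc_mem_nhdsGT one_pos)
  have huK : ∀ᶠ ε in (u : Filter ℝ), ∀ s ∈ Icc (0 : ℝ) 1, σ ε s ∈ K := by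
    filter_upwards [hu1, hu0 (Ioc_mem_nhdsGT hεb.1)] with ε h1 h2
    exact hσK ε h2 (σ ε) (c ε) (hc ε h1) (hcM ε h1) (hsolve ε h1) (hσ ε h1).1.2.1
      (hσ ε h1).1.2.2.1
  obtain ⟨c₀, -, hc₀⟩ := RandersKropina.exists_tendsto_of_mem_isCompact isCompact_Icc u
    (f := c) (hu1.mono fun ε h => ⟨hc ε h, hcM ε h⟩)
  have hτ : ∀ s ∈ Icc (0 : ℝ) 1, ∃ z, Tendsto (fun ε => σ ε s) u (𝓝 z) := fun s hs => by
    obtain ⟨z, -, hz⟩ := RandersKropina.exists_tendsto_of_mem_isCompact hK u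
      (f := fun ε => σ ε s) (huK.mono fun ε h => h s hs)
    exact ⟨z, hz⟩
  have : Nonempty S := ⟨x₀⟩
  choose! τ hτ using hτ
  have hlim : RandersKropina.IsLimitCurve g₀ θ Λ u σ c τ c₀ :=
    ⟨hu0, hu1.mono fun ε h => hsolve ε h, hu1.mono fun ε h => hc ε h, hc₀, hτ⟩
  have h0 : ∀ᶠ ε in (u : Filter ℝ), σ ε 0 = x₀ := hu1.mono fun ε h => (hσ ε h).1.2.1
  have h1 : ∀ᶠ ε in (u : Filter ℝ), σ ε 1 = x₁ := hu1.mono fun ε h => (hσ ε h).1.2.2.1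
  have hτ0 : τ 0 = x₀ := hlim.eq_of_eventually_end (left_mem_Icc.2 zero_le_one) h0
  have hτ1 : τ 1 = x₁ := hlim.eq_of_eventually_end (right_mem_Icc.2 zero_le_one) h1
  obtain ⟨hext, hne⟩ := hlim.isExtremalCurve hD h0 h1 hx'
  have hgeo := hext.isFinslerGeodesic hθ hθ_ne hΛ hΛ_nonneg
  rw [hτ0, hτ1] at hgeo
  -- a sequence along which the convergence holds
  have hseq : ∀ n : ℕ, ∃ ε, ε ∈ Ioc (0 : ℝ) 1 ∧ ε < 1 / ((n : ℝ) + 1) ∧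
      (∀ s ∈ Icc (0 : ℝ) 1,
        pathDist (riemannianNorm g₀) (σ ε s) (τ s) < 1 / ((n : ℝ) + 1)) ∧
      dist (c ε) c₀ < 1 / ((n : ℝ) + 1) := fun n => by
    have hn : (0 : ℝ) < 1 / ((n : ℝ) + 1) := Nat.one_div_pos_of_nat
    have h2 : ∀ᶠ ε in (u : Filter ℝ), ε < 1 / ((n : ℝ) + 1) :=
      (hu0.trans nhdsWithin_le_nhds) (Iio_mem_nhds hn)
    exact (hu1.and (h2.and ((hlim.eventually_pathDist_lt hD hn).and
      (hc₀ (Metric.ball_mem_nhds c₀ hn))))).exists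
  choose e he1 he0 hed hec using hseq
  have hinv : Tendsto (fun n : ℕ => 1 / ((n : ℝ) + 1)) atTop (𝓝 0) :=
    tendsto_one_div_add_atTop_nhds_zero_nat
  refine ⟨e, τ, he1, squeeze_zero (fun n => (he1 n).1.le) (fun n => (he0 n).le) hinv, hgeo,
    fun η hη => ?_, ?_, fun hall => hne (hu1.mono fun ε h => hall ε h)⟩
  · filter_upwards [hinv.eventually_lt_const hη] with n hn s hs
    exact (hed n s hs).trans hn
  · rw [hext.finslerLength_eq hθ hθ_ne hΛ hΛ_nonneg]
    refine (tendsto_iff_dist_tendsto_zero.2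
      (squeeze_zero (fun n => dist_nonneg) (fun n => (hec n).le) hinv)).congr fun n => ?_
    exact (hlen (e n) (he1 n)).symm
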